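/- All posets are finite. An embedding of a poset $\mathcal Q=(Q,\le^Q)$ into a poset $\mathcal P=(P,\le^P)$ is an injective map $e:Q\to P$ with $q\le^Q q'\iff e(q)\le^P e(q')$ for all $q,q'\in Q$; $\mathrm{width}(\mathcal P)$ is the maximum cardinality of an antichain of $\mathcal P$. The problem EMBEDDING takes two posets $\mathcal Q,\mathcal P$, given by their sizes and order matrices, has the parameter $(\mathrm{width}(\mathcal P),|Q|)$, and asks whether $\mathcal Q$ embeds into $\mathcal P$. Running times are numbers of steps of a random access machine with addition, truncated subtraction, indirect addressing and jumps, each at unit cost. Theorem. (1) EMBEDDING is fixed-parameter tractable: there are an algorithm, a computable function $g$ and a constant $c$ such that the algorithm decides every instance $(\mathcal Q,\mathcal P)$ of encoding length $N$ in time at most $g(\mathrm{width}(\mathcal P),|Q|)\cdot N^{c}$. (2) More precisely, EMBEDDING can be solved in time $O\big(\mathrm{width}(\mathcal P)^{|Q|}\cdot|Q|^4\cdot|P|^4\big)$, and in time $O(1)$ if $Q$ or $P$ is empty. (3) Let $(C_1,\dots,C_k)$ be a partition of $P$ into nonempty chains (for instance with $k=\mathrm{width}(\mathcal P)$) and let $f:Q\to\{1,\dots,k\}$.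 Call an embedding $e$ of $\mathcal Q$ into $\mathcal P$ compatible with $f$ if $e(q)\in C_{f(q)}$ for all $q\in Q$. Let $I$ be the constraint satisfaction instance with a variable $x_q$ for every $q\in Q$, with values in $P$, with the unary constraint $x_q\in C_{f(q)}$ for every $q\in Q$, and, for all ordered pairs of distinct $q,q'\in Q$, with the constraint that $(x_q,x_{q'})$ belongs to the set of all $(p,p')\in C_{f(q)}\times C_{f(q')}$ such that $p\le^P p'\iff q\le^Q q'$ and $p'\le^P p\iff q'\le^Q q$. Then: - $I$ can be computed from $\mathcal Q$, $\mathcal P$, $(C_1,\dots,C_k)$ and $f$ in time $O\big((|Q|\cdot|P|)^2\big)$ (in time $O(1)$ if $Q$ is empty), where the constraint relations are listed tuple by tuple; - the solutions of $I$ are exactly the maps $x_q\mapsto e(q)$ for the embeddings $e$ of $\mathcal Q$ into $\mathcal P$ that are compatible with $f$; - every constraint relation of $I$ is closed under the componentwise binary operation $\min_L$ for every linear order $L$ on $P$ that extends $\le^P$; in particular, $I$ is closed under a min polymorphism. -/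

import Mathlib

/-! ### Random access machines with uniform cost -/

namespace RAM

/-- Instructions of a random access machine. `R` is the register file, `M` the memory; both hold
natural numbers, and memory is addressed indirectly, through registers. -/
inductive Instr where
  /-- `R[d] := k` -/
  | const (d k : ℕ)
  /-- `R[d] := R[a]` -/
  | copy (d a : ℕ)
  /-- `R[d] := R[a] + R[b]` -/
  | add (d a b : ℕ)
  /-- `R[d] := max (R[a] - R[b]) 0` -/
  | sub (d a b : ℕ)
  /-- `R[d] := M[R[a]]` -/
  | load (d a : ℕ)
  /-- `M[R[a]] := R[b]` -/
  | store (a b : ℕ)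
  /-- jump to instruction `l` -/
  | jump (l : ℕ)
  /-- jump to instruction `l` if `R[a] = 0` -/
  | jumpZero (a l : ℕ)

/-- A program is a finite list of instructions, numbered from `0`. -/
abbrev Program := List Instr

structure Config where
  pc : ℕ
  reg : ℕ → ℕ
  mem : ℕ → ℕ

/-- The effect of one instruction. -/
def Instr.exec : Instr → Config → Config
  | .const d k, c => ⟨c.pc + 1, Function.update c.reg d k, c.mem⟩
  | .copy d a, c => ⟨c.pc + 1, Function.update c.reg d (c.reg a), c.mem⟩
  | .add d a b, c => ⟨c.pc + 1, Function.update c.reg d (c.reg a + c.reg b), c.mem⟩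
  | .sub d a b, c => ⟨c.pc + 1, Function.update c.reg d (c.reg a - c.reg b), c.mem⟩
  | .load d a, c => ⟨c.pc + 1, Function.update c.reg d (c.mem (c.reg a)), c.mem⟩
  | .store a b, c => ⟨c.pc + 1, c.reg, Function.update c.mem (c.reg a) (c.reg b)⟩
  | .jump l, c => ⟨l, c.reg, c.mem⟩
  | .jumpZero a l, c => ⟨if c.reg a = 0 then l else c.pc + 1, c.reg, c.mem⟩

/-- The machine has halted when the program counter points outside the program. -/
def Program.Halted (A : Program) (c : Config) : Prop := A.length ≤ c.pc

/-- One step of the computation, of cost one; a halted configuration does not change. -/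
def Program.step (A : Program) (c : Config) : Config :=
  match A[c.pc]? with
  | some i => i.exec c
  | none => c

/-- The initial configuration: the input is in the memory cells `0, 1, 2, …`, and all other
cells and all registers are zero. -/
def init (input : List ℕ) : Config := ⟨0, fun _ => 0, fun i => input.getD i 0⟩

/-- On the given input, `A` halts after at most `T` steps, with `R[0] = 1` if `yes` holds and
with `R[0] = 0` if it does not. -/
def Program.DecidesWithin (A : Program) (input : List ℕ) (yes : Prop) (T : ℕ) : Prop :=
  ∃ t ≤ T, A.Halted (A.step^[t] (init input)) ∧
    (yes → (A.step^[t] (init input)).reg 0 = 1) ∧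
    (¬ yes → (A.step^[t] (init input)).reg 0 = 0)

/-- On the given input, `A` halts after at most `T` steps, with the list `output` in a block of
consecutive memory cells whose first address is in `R[0]` and whose length is in `R[1]`. -/
def Program.ComputesWithin (A : Program) (input output : List ℕ) (T : ℕ) : Prop :=
  ∃ t ≤ T, A.Halted (A.step^[t] (init input)) ∧
    (A.step^[t] (init input)).reg 1 = output.length ∧
    ∀ (i : ℕ) (h : i < output.length),
      (A.step^[t] (init input)).mem ((A.step^[t] (init input)).reg 0 + i) = output[i]

end RAM

/-! ### Parameterized problems -/

/-- A parameterized decision problem with parameters in `κ`: its instances, their encoding as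
machine inputs, their parameter, and the set of yes-instances. -/
structure ParamProblem (κ : Type) where
  Inst : Type 1
  encode : Inst → List ℕ
  param : Inst → κ
  Yes : Inst → Prop

/-- Every instance `x` with parameter `k` is decided in time `f k * |x| ^ c`, where `f` is
computable and `c` is constant. -/
def ParamProblem.FixedParameterTractable {κ : Type} [Primcodable κ] (X : ParamProblem κ) : Prop :=
  ∃ (A : RAM.Program) (f : κ → ℕ) (c : ℕ), Computable f ∧
    ∀ x : X.Inst, A.DecidesWithin (X.encode x) (X.Yes x) (f (X.param x) * (X.encode x).length ^ c)

/-! ### Finite posets and the embedding problem -/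

/-- The width of a (finite) poset: the largest cardinality of an antichain. -/
noncomputable def posetWidth (α : Type) [PartialOrder α] : ℕ :=
  sSup {k | ∃ A : Finset α, IsAntichain (· ≤ ·) (A : Set α) ∧ A.card = k}

/-- A finite poset whose elements are numbered `0, …, size - 1`, in an arbitrary way that need not
respect the order, so that it can be given to a machine. -/
structure FinPoset where
  carrier : Type
  [order : PartialOrder carrier]
  size : ℕ
  label : carrier ≃ Fin size

instance : CoeSort FinPoset Type := ⟨FinPoset.carrier⟩

instance (P : FinPoset) : PartialOrder P := P.order

namespace FinPoset

noncomputable def width (P : FinPoset) : ℕ := posetWidth P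

/-- The linear order `L` extends the order of `P`. -/
def IsLinearExtension (P : FinPoset) (L : LinearOrder P) : Prop :=
  ∀ a b : P, P.order.le a b → L.le a b

/-- The elements, in the order of their labels. -/
def elems (P : FinPoset) : List P := (List.finRange P.size).map P.label.symm

open Classical in
/-- The order relation as a 0/1 matrix, row by row: entry `i * size + j` is `1` iff
element `i` is at most element `j`. -/
noncomputable def matrix (P : FinPoset) : List ℕ :=
  List.ofFn fun t : Fin (P.size * P.size) =>
    if P.label.symm t.divNat ≤ P.label.symm t.modNat then 1 else 0

end FinPoset

/-- Given finite posets `Q` and `P`, with parameter `(width P, |Q|)`: is there an embedding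
of `Q` into `P`? -/
noncomputable def embeddingProblem : ParamProblem (ℕ × ℕ) where
  Inst := FinPoset × FinPoset
  encode := fun x => [x.1.size, x.2.size] ++ x.1.matrix ++ x.2.matrix
  param := fun x => (x.2.width, x.1.size)
  Yes := fun x => Nonempty (x.1 ↪o x.2)

/-! ### Chain partitions and compatible embeddings -/

/-- A partition of a poset into a tuple of `k` chains. -/
structure ChainPartition (α : Type) [PartialOrder α] (k : ℕ) where
  part : Fin k → Set α
  nonempty : ∀ i, (part i).Nonempty
  disjoint : ∀ i j, i ≠ j → Disjoint (part i) (part j)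
  cover : ∀ a, ∃ i, a ∈ part i
  chain : ∀ i, IsChain (· ≤ ·) (part i)

/-- The embedding `e` sends every `q` into the chain with index `f q`. -/
def CompatibleWith {α β : Type} [PartialOrder α] [PartialOrder β] {k : ℕ}
    (C : ChainPartition β k) (f : α → Fin k) (e : α ↪o β) : Prop :=
  ∀ q, e q ∈ C.part (f q)

/-! ### Constraint satisfaction problems -/

/-- A constraint: a scope (a tuple of distinct variables) and a relation of the same arity, given
by the list of its tuples. -/
structure Constraint (V D : Type) where
  arity : ℕ
  scope : Fin arity → V
  scope_injective : Function.Injective scope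
  rel : List (Fin arity → D)

/-- A CSP instance with variables `V` and domain `D`. -/
structure CSP (V D : Type) where
  constraints : List (Constraint V D)

def CSP.IsSolution {V D : Type} (I : CSP V D) (τ : V → D) : Prop :=
  ∀ c ∈ I.constraints, (fun j => τ (c.scope j)) ∈ c.rel

/-- The `n`-ary operation `φ` is a polymorphism of the constraint `c`. -/
def Constraint.ClosedUnder {V D : Type} {n : ℕ} (c : Constraint V D) (φ : (Fin n → D) → D) :
    Prop :=
  ∀ t : Fin n → (Fin c.arity → D), (∀ i, t i ∈ c.rel) → (fun j => φ (fun i => t i j)) ∈ c.rel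

/-- The `n`-ary operation `φ` is a polymorphism of all constraints of `I`. -/
def CSP.ClosedUnder {V D : Type} {n : ℕ} (I : CSP V D) (φ : (Fin n → D) → D) : Prop :=
  ∀ c ∈ I.constraints, c.ClosedUnder φ

/-- The binary minimum operation of a linear order on `D`. -/
def minOp {D : Type} (L : LinearOrder D) (x : Fin 2 → D) : D := L.min (x 0) (x 1)

/-- `φ` is a min operation: the minimum with respect to some linear ordering of `D`. -/
def IsMinOp {D : Type} (φ : (Fin 2 → D) → D) : Prop := ∃ L : LinearOrder D, φ = minOp L

/-- The encoding of a constraint: arity, scope, number of tuples, tuples. -/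
def Constraint.encode {V D : Type} {v d : ℕ} (eV : V ≃ Fin v) (eD : D ≃ Fin d)
    (c : Constraint V D) : List ℕ :=
  c.arity :: (List.ofFn fun j => (eV (c.scope j) : ℕ)) ++
    c.rel.length :: c.rel.flatMap fun t => List.ofFn fun j => (eD (t j) : ℕ)

/-- The encoding of a CSP instance: numbers of variables, domain elements and constraints, then
the constraints. -/
def CSP.encode {V D : Type} {v d : ℕ} (eV : V ≃ Fin v) (eD : D ≃ Fin d) (I : CSP V D) : List ℕ :=
  [v, d, I.constraints.length] ++ I.constraints.flatMap (Constraint.encode eV eD)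

/-! ### The CSP instance of a chain assignment -/

section Assignment

variable (Q P : FinPoset) {k : ℕ} (C : ChainPartition P k) (f : Q → Fin k)

open Classical in
/-- The constraint that the value of the variable `q` lies in the chain `C_{f q}`; it expresses
that this chain is the domain of the variable `q`. -/
noncomputable def domainConstraint (q : Q) : Constraint Q P where
  arity := 1
  scope := ![q]
  scope_injective := Function.injective_of_subsingleton _
  rel := (P.elems.filter fun p => p ∈ C.part (f q)).map fun p => ![p]

open Classical in
/-- The constraint on two distinct variables `q`, `q'`: the pairs in `C_{f q} × C_{f q'}` that are
ordered in `P` in the same way as `(q, q')` is in `Q`. -/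
noncomputable def orderConstraint (q q' : Q) (h : q ≠ q') : Constraint Q P where
  arity := 2
  scope := ![q, q']
  scope_injective := by
    intro i j hij
    fin_cases i <;> fin_cases j <;> simp_all
  rel := ((P.elems ×ˢ P.elems).filter fun x =>
      x.1 ∈ C.part (f q) ∧ x.2 ∈ C.part (f q') ∧
        (x.1 ≤ x.2 ↔ q ≤ q') ∧ (x.2 ≤ x.1 ↔ q' ≤ q)).map fun x => ![x.1, x.2]

open Classical in
/-- The CSP instance of the chain assignment `f`: the variables are the elements of `Q`, the values
are elements of `P`. -/
noncomputable def assignmentCSP : CSP Q P where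
  constraints := Q.elems.map (domainConstraint Q P C f) ++
    (Q.elems ×ˢ Q.elems).filterMap fun x =>
      if h : x.1 ≠ x.2 then some (orderConstraint Q P C f x.1 x.2 h) else none

open Classical in
/-- The encoding of `(Q, P, C, f)`: the sizes, the two order matrices, the 0/1 membership
matrix of the chains row by row, and the values of `f`. -/
noncomputable def encodeAssignment : List ℕ :=
  [Q.size, P.size, k] ++ Q.matrix ++ P.matrix ++
    (List.ofFn fun t : Fin (k * P.size) =>
      if P.label.symm t.modNat ∈ C.part t.divNat then 1 else 0) ++
    Q.elems.map fun q => (f q : ℕ)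

end Assignment

/-! Mathematical idea. By Dilworth's theorem `P` is a union of `width P` chains. They come from a
maximum matching in the bipartite graph whose two sides are copies of `P` and whose edges are the
pairs `a < b`: following matched pairs upwards gives chains, one for each upper copy that is
unmatched. When no augmenting path is left, König's argument produces an antichain with at least as
many elements as there are chains (`IsMatching.exists_antichain`), and every element lies on one of
the chains (`IsMatching.exists_head`).

An embedding sends each `q` into some chain, so at most `width P ^ |Q|` assignments of chains have
to be tried. For a fixed assignment, every candidate value starts at the bottom of its chain and is
moved up only when forced. The invariant is that a candidate lies on its chain at or below the image
under every compatible embedding. If the candidate of `i` is wrong relative to that of `j` in a way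
that only raising it can repair, then no compatible embedding has this value at `i` (`TooSmall.ne`),
so the step up keeps the invariant. If a chain is exhausted, there is no compatible embedding; if no
candidate is too small, the candidates form an embedding (`natEmb_of_forall_not_tooSmall`). At most
`|Q| * |P|` moves are possible.

The polymorphism explains why least candidates suffice. On a chain every linear extension of the
order of `P` agrees with that order, so the minimum of two pairs in a relation is either one of the
pairs or is squeezed between them (`closedUnder_minOp`). Compatible embeddings are thus closed under
pointwise minima.

For the time bounds, programs are written in a small structured language with a clock. Compilation
to the machine costs a factor bounded by the length of the code (`Cmd.Runs.code_correct`), a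
constant. Programs are verified by weakest precondition rules that carry a clock bound
(`Cmd.wp_loop`, `Cmd.wp_for`) and by a syntactic frame rule (`Cmd.Runs.frame`). -/

/-! ### A structured language on top of random access machines -/

namespace RAM

/-- The variables of structured programs. Variable number `i` is kept in register `i`. -/
inductive Var where
  | base | len | q | n | k | i | j | a | b | r | col | found | go | ans | t | total | carry | aux
  | rowA | rowB | rowI | rowJ | ci | cj | pb | cb | fb | out | slot | cnt | num
  deriving DecidableEq

/-- The names of the arrays that are interleaved in the memory above the address `base`. -/
inductive Arr where
  | rowQ | rowP | nxt | prd | par | heads | idx | ptr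
  deriving DecidableEq

/-- The order of the constructors matters: `base` and `len` are registers 0 and 1, where the machine
model expects the answer, or the address and the length of the output. -/
def Var.reg (x : Var) : ℕ := x.ctorIdx

def Arr.offset (j : Arr) : ℕ := j.ctorIdx

/-- Registers from 64 on remain free for the evaluation of expressions. -/
theorem Var.reg_lt (x : Var) : x.reg < 64 := by cases x <;> decide

theorem Var.reg_injective : Function.Injective Var.reg := by
  intro x y h
  have key : ∀ z : Var, z = Var.ofNat z.reg := by intro z; cases z <;> rfl
  rw [key x, key y, h]

/-- Arrays are interleaved with stride 8, so offsets below 8 keep them disjoint without any bound on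
their lengths. -/
theorem Arr.offset_lt (j : Arr) : j.offset < 8 := by cases j <;> decide

theorem Arr.offset_injective : Function.Injective Arr.offset := by
  intro x y h
  cases x <;> cases y <;> first | rfl | (exact absurd h (by decide))

/-- States of structured programs; `clk` counts the executed commands and tests. -/
structure St where
  v : Var → ℕ
  m : ℕ → ℕ
  clk : ℕ

namespace St

def setv (s : St) (x : Var) (n : ℕ) : St := ⟨Function.update s.v x n, s.m, s.clk + 1⟩

def sto (s : St) (a n : ℕ) : St := ⟨s.v, Function.update s.m a n, s.clk + 1⟩

def tick (s : St) : St := ⟨s.v, s.m, s.clk + 1⟩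

/-- Entry `i` of the array `j`. -/
def arr (s : St) (j : Arr) (i : ℕ) : ℕ := s.m (s.v .base + 8 * i + j.offset)

def aset (s : St) (j : Arr) (i n : ℕ) : St := s.sto (s.v .base + 8 * i + j.offset) n

@[simp] theorem setv_v (s : St) (x y : Var) (n : ℕ) :
    (s.setv x n).v y = if y = x then n else s.v y := by
  simp [setv, Function.update_apply]

@[simp] theorem setv_m (s : St) (x : Var) (n : ℕ) : (s.setv x n).m = s.m := rfl

@[simp] theorem setv_clk (s : St) (x : Var) (n : ℕ) : (s.setv x n).clk = s.clk + 1 := rfl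

@[simp] theorem sto_v (s : St) (a n : ℕ) : (s.sto a n).v = s.v := rfl

@[simp] theorem sto_m (s : St) (a n b : ℕ) :
    (s.sto a n).m b = if b = a then n else s.m b := by
  simp [sto, Function.update_apply]

@[simp] theorem sto_clk (s : St) (a n : ℕ) : (s.sto a n).clk = s.clk + 1 := rfl

@[simp] theorem tick_v (s : St) : s.tick.v = s.v := rfl

@[simp] theorem tick_m (s : St) : s.tick.m = s.m := rfl

@[simp] theorem tick_clk (s : St) : s.tick.clk = s.clk + 1 := rfl

@[simp] theorem tick_arr (s : St) : s.tick.arr = s.arr := rfl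

@[simp] theorem setv_arr (s : St) {x : Var} (hx : x ≠ .base) (n : ℕ) :
    (s.setv x n).arr = s.arr := by
  funext j i
  simp [arr, hx.symm]

@[simp] theorem aset_v (s : St) (j : Arr) (i n : ℕ) : (s.aset j i n).v = s.v := rfl

@[simp] theorem aset_clk (s : St) (j : Arr) (i n : ℕ) : (s.aset j i n).clk = s.clk + 1 := rfl

@[simp] theorem aset_arr_self (s : St) (j : Arr) (i n : ℕ) :
    (s.aset j i n).arr j = Function.update (s.arr j) i n := by
  funext i'
  simp only [arr, aset, sto_v, sto_m, Function.update_apply]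
  congr 1
  simp

@[simp] theorem aset_arr_ne (s : St) {j j' : Arr} (h : j' ≠ j) (i n : ℕ) :
    (s.aset j i n).arr j' = s.arr j' := by
  funext i'
  have h1 := j.offset_lt
  have h2 := j'.offset_lt
  have h3 : j'.offset ≠ j.offset := fun e => h (Arr.offset_injective e)
  simp only [arr, aset, sto_v, sto_m]
  rw [if_neg]
  omega

theorem aset_m (s : St) (j : Arr) (i n : ℕ) {a : ℕ} (h : a < s.v .base) :
    (s.aset j i n).m a = s.m a := by
  simp only [aset, sto_m]
  rw [if_neg]
  omega

end St

/-- Expressions. -/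
inductive Exp where
  | c (n : ℕ)
  | v (x : Var)
  | add (e f : Exp)
  | sub (e f : Exp)
  | get (e : Exp)

namespace Exp

def eval (s : St) : Exp → ℕ
  | c n => n
  | v x => s.v x
  | add e f => e.eval s + f.eval s
  | sub e f => e.eval s - f.eval s
  | get e => s.m (e.eval s)

@[simp] theorem eval_c (s : St) (n : ℕ) : (c n).eval s = n := rfl
@[simp] theorem eval_v (s : St) (x : Var) : (v x).eval s = s.v x := rfl
@[simp] theorem eval_add (s : St) (e f : Exp) : (add e f).eval s = e.eval s + f.eval s := rfl
@[simp] theorem eval_sub (s : St) (e f : Exp) : (sub e f).eval s = e.eval s - f.eval s := rfl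
@[simp] theorem eval_get (s : St) (e : Exp) : (get e).eval s = s.m (e.eval s) := rfl

@[simp] theorem eval_tick (s : St) (e : Exp) : e.eval s.tick = e.eval s := by
  induction e with
  | c n => rfl
  | v x => rfl
  | add e f ihe ihf | sub e f ihe ihf => simp [ihe, ihf]
  | get e ih => simp [ih]

/-- The address of entry `e` of the array `j`. -/
def addr (j : Arr) (e : Exp) : Exp :=
  -- The machine has no multiplication, so `8 * e` is a sum of eight copies of `e`.
  add (add (v .base) (add (add (add e e) (add e e)) (add (add e e) (add e e)))) (c j.offset)

theorem eval_addr (s : St) (j : Arr) (e : Exp) :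
    (addr j e).eval s = s.v .base + 8 * e.eval s + j.offset := by
  simp only [addr, eval_add, eval_v, eval_c]
  omega

/-- Entry `e` of the array `j`. -/
def aget (j : Arr) (e : Exp) : Exp := get (addr j e)

@[simp] theorem eval_aget (s : St) (j : Arr) (e : Exp) :
    (aget j e).eval s = s.arr j (e.eval s) := by
  simp [aget, eval_addr, St.arr]

/-- Negation; as a condition, an expression holds if its value is not zero. -/
def not (e : Exp) : Exp := sub (c 1) e

def or (e f : Exp) : Exp := add e f

def and (e f : Exp) : Exp := not (or (not e) (not f))

def eq (e f : Exp) : Exp := not (or (sub e f) (sub f e))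

/-- Truth values matter only up to being zero, since `or` is addition and may return values above 1.
Hence these lemmas only say when a value vanishes. -/
theorem eval_not (s : St) (e : Exp) : (not e).eval s = 0 ↔ e.eval s ≠ 0 := by
  simp only [not, eval_sub, eval_c]
  omega

theorem eval_or (s : St) (e f : Exp) : (or e f).eval s = 0 ↔ e.eval s = 0 ∧ f.eval s = 0 := by
  simp only [or, eval_add]
  omega

theorem eval_and (s : St) (e f : Exp) : (and e f).eval s = 0 ↔ ¬ (e.eval s ≠ 0 ∧ f.eval s ≠ 0) := by
  simp only [and, eval_not, eval_or, Ne]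

theorem eval_eq (s : St) (e f : Exp) : (eq e f).eval s = 0 ↔ e.eval s ≠ f.eval s := by
  rw [eq, eval_not, Ne, eval_or, eval_sub, eval_sub]
  omega

end Exp

/-- Structured programs. -/
inductive Cmd where
  | skip
  | assign (x : Var) (e : Exp)
  | store (e f : Exp)
  | aset (j : Arr) (e f : Exp)
  | seq (c d : Cmd)
  /-- if the value of `e` is not zero then `c` else `d` -/
  | ite (e : Exp) (c d : Cmd)
  /-- as long as the value of `e` is not zero, repeat `c` -/
  | loop (e : Exp) (c : Cmd)

namespace Cmd

/-- `Runs c s s'`: started in `s`, the program `c` terminates in `s'`. -/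
inductive Runs : Cmd → St → St → Prop
  | skip (s : St) : Runs skip s s
  | assign (x : Var) (e : Exp) (s : St) : Runs (assign x e) s (s.setv x (e.eval s))
  | store (e f : Exp) (s : St) : Runs (store e f) s (s.sto (e.eval s) (f.eval s))
  | aset (j : Arr) (e f : Exp) (s : St) : Runs (aset j e f) s (s.aset j (e.eval s) (f.eval s))
  | seq {c d : Cmd} {s₁ s₂ s₃ : St} : Runs c s₁ s₂ → Runs d s₂ s₃ → Runs (seq c d) s₁ s₃
  | ite_true {e : Exp} {c d : Cmd} {s s' : St} :
      e.eval s ≠ 0 → Runs c s.tick s' → Runs (ite e c d) s s'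
  | ite_false {e : Exp} {c d : Cmd} {s s' : St} :
      e.eval s = 0 → Runs d s.tick s' → Runs (ite e c d) s s'
  | loop_done {e : Exp} {c : Cmd} {s : St} : e.eval s = 0 → Runs (loop e c) s s.tick
  | loop_step {e : Exp} {c : Cmd} {s₁ s₂ s₃ : St} :
      e.eval s₁ ≠ 0 → Runs c s₁.tick s₂ → Runs (loop e c) s₂ s₃ → Runs (loop e c) s₁ s₃

def block : List Cmd → Cmd
  | [] => skip
  | c :: l => seq c (block l)

/-- `for x := 0, …, e - 1 do c` -/
def for' (x : Var) (e : Exp) (c : Cmd) : Cmd :=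
  seq (assign x (.c 0)) (loop (.sub e (.v x)) (seq c (assign x (.add (.v x) (.c 1)))))

end Cmd

/-! ### Compilation -/

/-- The code that computes the value of an expression in register `64 + d`, with the registers from
`64 + d` on as scratch space. -/
def Exp.code : Exp → ℕ → List Instr
  | c n, d => [.const (64 + d) n]
  | v x, d => [.copy (64 + d) x.reg]
  | add e f, d => e.code d ++ (f.code (d + 1) ++ [.add (64 + d) (64 + d) (64 + (d + 1))])
  | sub e f, d => e.code d ++ (f.code (d + 1) ++ [.sub (64 + d) (64 + d) (64 + (d + 1))])
  | get e, d => e.code d ++ [.load (64 + d) (64 + d)]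

/-- The code of a structured program, to be placed at address `p`. -/
def Cmd.code : Cmd → ℕ → List Instr
  | skip, _ => []
  | assign x e, _ => e.code 0 ++ [.copy x.reg 64]
  | store e f, _ => e.code 0 ++ (f.code 1 ++ [.store 64 65])
  | aset j e f, _ => (Exp.addr j e).code 0 ++ (f.code 1 ++ [.store 64 65])
  | seq c d, p => c.code p ++ d.code (p + (c.code p).length)
  | ite e c d, p =>
      let p₁ := p + (e.code 0).length + 1
      let p₂ := p₁ + (c.code p₁).length + 1
      e.code 0 ++ ([.jumpZero 64 p₂] ++ (c.code p₁ ++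
        ([.jump (p₂ + (d.code p₂).length)] ++ d.code p₂)))
  | loop e c, p =>
      let p₁ := p + (e.code 0).length + 1
      e.code 0 ++ ([.jumpZero 64 (p₁ + (c.code p₁).length + 1)] ++ (c.code p₁ ++ [.jump p]))

/-- The code `L` is in the program `A` at address `p`. -/
def Program.HasCode (A : Program) (p : ℕ) (L : List Instr) : Prop :=
  ∀ i (h : i < L.length), A[p + i]? = some L[i]

theorem Program.HasCode.append {A : Program} {p : ℕ} {L L' : List Instr}
    (h : A.HasCode p (L ++ L')) : A.HasCode p L ∧ A.HasCode (p + L.length) L' := by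
  constructor
  · intro i hi
    rw [h i (by simp; omega), List.getElem_append_left hi]
  · intro i hi
    rw [add_assoc, h (L.length + i) (by simp; omega), List.getElem_append_right (by omega)]
    simp

theorem Program.HasCode.step {A : Program} {c : Config} {I : Instr} {p : ℕ}
    (h : A.HasCode p [I]) (hp : c.pc = p) : A.step c = I.exec c := by
  subst hp
  have := h 0 (by simp)
  simp only [add_zero, List.getElem_cons_zero] at this
  simp [Program.step, this]

/-- The configuration `c` represents the state `s`. -/
def Represents (c : Config) (s : St) : Prop :=
  (∀ x : Var, c.reg x.reg = s.v x) ∧ c.mem = s.m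

/-- The scratch registers act as a stack: the second operand is evaluated one register higher, and
the clause on registers below `64 + d` guarantees that the first operand survives. -/
theorem Exp.code_correct {A : Program} {s : St} (e : Exp) (d : ℕ) (c : Config)
    (hA : A.HasCode c.pc (e.code d)) (hc : Represents c s) :
    ∃ c', A.step^[(e.code d).length] c = c' ∧ c'.pc = c.pc + (e.code d).length ∧
      Represents c' s ∧ c'.reg (64 + d) = e.eval s ∧ ∀ i < 64 + d, c'.reg i = c.reg i := by
  have hvar (x : Var) (d : ℕ) : x.reg ≠ 64 + d := by have := x.reg_lt; omega
  induction e generalizing d c with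
  | c n =>
    refine ⟨_, rfl, ?_⟩
    simp only [code, List.length_singleton, Function.iterate_one] at hA ⊢
    rw [hA.step rfl]
    simp only [Instr.exec, Represents, Function.update_self, eval_c, true_and]
    refine ⟨⟨fun x => ?_, hc.2⟩, fun i hi => ?_⟩
    · rw [Function.update_of_ne (hvar x d), hc.1]
    · rw [Function.update_of_ne (by omega)]
  | v x =>
    refine ⟨_, rfl, ?_⟩
    simp only [code, List.length_singleton, Function.iterate_one] at hA ⊢
    rw [hA.step rfl]
    simp only [Instr.exec, Represents, Function.update_self, eval_v, true_and]
    refine ⟨⟨fun x => ?_, hc.2⟩, hc.1 x, fun i hi => ?_⟩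
    · rw [Function.update_of_ne (hvar x d), hc.1]
    · rw [Function.update_of_ne (by omega)]
  | add e f ihe ihf | sub e f ihe ihf =>
    obtain ⟨h1, h2⟩ := hA.append
    obtain ⟨c₁, e1, p1, r1, v1, k1⟩ := ihe d c h1 hc
    rw [← p1] at h2
    obtain ⟨h2, h3⟩ := h2.append
    obtain ⟨c₂, e2, p2, r2, v2, k2⟩ := ihf (d + 1) c₁ h2 r1
    refine ⟨_, rfl, ?_⟩
    simp only [code, List.length_append, List.length_singleton]
    rw [← add_assoc, Function.iterate_succ_apply', add_comm, Function.iterate_add_apply, e1, e2,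
      h3.step p2]
    simp only [Instr.exec, Represents, Function.update_self, p2, p1, v2, k2 (64 + d) (by omega), v1,
      eval_add, eval_sub, true_and]
    refine ⟨by omega, ⟨fun x => ?_, r2.2⟩, fun i hi => ?_⟩
    · rw [Function.update_of_ne (hvar x d), r2.1]
    · rw [Function.update_of_ne (by omega), k2 i (by omega), k1 i hi]
  | get e ihe =>
    obtain ⟨h1, h2⟩ := hA.append
    obtain ⟨c₁, e1, p1, r1, v1, k1⟩ := ihe d c h1 hc
    refine ⟨_, rfl, ?_⟩
    simp only [code, List.length_append, List.length_singleton]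
    rw [Function.iterate_succ_apply', e1, h2.step p1]
    simp only [Instr.exec, Represents, Function.update_self, p1, v1, r1.2, eval_get, true_and, and_true]
    refine ⟨by omega, fun x => ?_, fun i hi => ?_⟩
    · rw [Function.update_of_ne (hvar x d), r1.1]
    · rw [Function.update_of_ne (by omega), k1 i hi]

/-- The code of `e` and `f` followed by a `store` instruction. -/
theorem store_code_correct {A : Program} {s : St} (e f : Exp) (c : Config)
    (hA : A.HasCode c.pc (e.code 0 ++ (f.code 1 ++ [.store 64 65]))) (hc : Represents c s) :
    ∃ c', A.step^[(e.code 0 ++ (f.code 1 ++ [Instr.store 64 65])).length] c = c' ∧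
      c'.pc = c.pc + (e.code 0 ++ (f.code 1 ++ [Instr.store 64 65])).length ∧
      Represents c' (s.sto (e.eval s) (f.eval s)) := by
  obtain ⟨h1, h2⟩ := hA.append
  obtain ⟨c₁, e1, p1, r1, v1, k1⟩ := e.code_correct 0 c h1 hc
  rw [← p1] at h2
  obtain ⟨h2, h3⟩ := h2.append
  obtain ⟨c₂, e2, p2, r2, v2, k2⟩ := f.code_correct 1 c₁ h2 r1
  refine ⟨_, rfl, ?_⟩
  simp only [List.length_append, List.length_singleton]
  rw [← add_assoc, Function.iterate_succ_apply', add_comm, Function.iterate_add_apply, e1, e2,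
    h3.step p2]
  have h64 := k2 64 (by omega)
  simp only [add_zero] at v1
  refine ⟨by simp only [Instr.exec, p2, p1]; omega, fun x => r2.1 x, ?_⟩
  simp only [Instr.exec, h64, v1, v2, r2.2, St.sto]

/-- Each clock tick pays for one command or test together with the jumps around it, which is
straight-line code of length at most `M`; hence `t ≤ M * T`. The bound `M` is independent of the
subprogram at hand, so that it passes unchanged through the induction and can finally be the length
of the whole code. -/
theorem Cmd.Runs.code_correct {c : Cmd} {s s' : St} (h : c.Runs s s') (A : Program) (p M : ℕ)
    (k : Config) (hp : k.pc = p) (hA : A.HasCode p (c.code p)) (hM : (c.code p).length ≤ M)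
    (hk : Represents k s) :
    ∃ t T k', A.step^[t] k = k' ∧ s'.clk = s.clk + T ∧ t ≤ M * T ∧
      k'.pc = p + (c.code p).length ∧ Represents k' s' := by
  induction h generalizing p M k with
  | skip s => exact ⟨0, 0, k, rfl, rfl, by simp, by simp [hp, code], hk⟩
  | assign x e s =>
    subst hp
    obtain ⟨h1, h2⟩ := hA.append
    obtain ⟨c₁, e1, p1, r1, v1, k1⟩ := e.code_correct 0 k h1 hk
    simp only [code, List.length_append, List.length_singleton] at hM ⊢
    refine ⟨(e.code 0).length + 1, 1, _, rfl, rfl, by omega, ?_⟩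
    rw [Function.iterate_succ_apply', e1, h2.step p1]
    simp only [add_zero] at v1
    refine ⟨by simp [Instr.exec, p1, add_assoc], fun y => ?_, r1.2⟩
    simp only [Instr.exec, v1, St.setv_v, Function.update_apply, Var.reg_injective.eq_iff]
    split_ifs
    · rfl
    · exact r1.1 y
  | store e f s =>
    subst hp
    obtain ⟨c₁, e1, p1, r1⟩ := store_code_correct e f k hA hk
    exact ⟨_, 1, c₁, e1, rfl, by simpa [code] using hM, p1, r1⟩
  | aset j e f s =>
    subst hp
    obtain ⟨c₁, e1, p1, r1⟩ := store_code_correct (Exp.addr j e) f k hA hk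
    refine ⟨_, 1, c₁, e1, rfl, by simpa [code] using hM, p1, ?_⟩
    rwa [Exp.eval_addr] at r1
  | @seq c d s₁ s₂ s₃ _ _ ih1 ih2 =>
    obtain ⟨h1, h2⟩ := hA.append
    simp only [code, List.length_append] at hM
    obtain ⟨t1, T1, k1, e1, c1, b1, p1, r1⟩ := ih1 p M k hp h1 (by omega) hk
    obtain ⟨t2, T2, k2, e2, c2, b2, p2, r2⟩ := ih2 _ M k1 p1 h2 (by omega) r1
    refine ⟨t2 + t1, T1 + T2, k2, ?_, by omega, ?_, ?_, r2⟩
    · rw [Function.iterate_add_apply, e1, e2]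
    · rw [mul_add]; omega
    · rw [p2]; simp only [code, List.length_append]; omega
  | @ite_true e c d s s' hne _ ih =>
    subst hp
    obtain ⟨h1, h2⟩ := hA.append
    obtain ⟨c₁, e1, p1, r1, v1, k1⟩ := e.code_correct 0 k h1 hk
    obtain ⟨h2, h3⟩ := h2.append
    obtain ⟨h3, h4⟩ := h3.append
    rw [List.length_singleton] at h3 h4
    obtain ⟨h4, h5⟩ := h4.append
    rw [List.length_singleton] at h5
    simp only [code, List.length_append, List.length_singleton] at hM
    have s1 : A.step c₁ = ⟨c₁.pc + 1, c₁.reg, c₁.mem⟩ := by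
      rw [h2.step p1]
      simp only [Instr.exec, Config.mk.injEq, and_true]
      rw [if_neg (by rw [← v1] at hne; exact hne)]
    obtain ⟨t2, T2, k2, e2, c2, b2, p2, r2⟩ :=
      ih _ M ⟨c₁.pc + 1, c₁.reg, c₁.mem⟩ (by simp [p1]) h3 (by omega) r1
    -- The tick of the test pays for evaluating `e`, for the conditional jump and for the jump over
    -- the other branch.
    refine ⟨1 + (t2 + (1 + (e.code 0).length)), 1 + T2, _, rfl, by rw [c2, St.tick_clk]; omega, ?_,
      ?_⟩
    · rw [mul_add]; omega
    · rw [Function.iterate_add_apply, Function.iterate_add_apply, Function.iterate_add_apply, e1,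
        Function.iterate_one, s1, e2, h4.step p2]
      refine ⟨?_, r2⟩
      simp only [Instr.exec, code, List.length_append, List.length_singleton]
      omega
  | @ite_false e c d s s' heq _ ih =>
    subst hp
    obtain ⟨h1, h2⟩ := hA.append
    obtain ⟨c₁, e1, p1, r1, v1, k1⟩ := e.code_correct 0 k h1 hk
    obtain ⟨h2, h3⟩ := h2.append
    obtain ⟨h3, h4⟩ := h3.append
    rw [List.length_singleton] at h3 h4
    obtain ⟨h4, h5⟩ := h4.append
    rw [List.length_singleton] at h5
    simp only [code, List.length_append, List.length_singleton] at hM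
    have s1 : A.step c₁ = ⟨k.pc + (e.code 0).length + 1 +
        (c.code (k.pc + (e.code 0).length + 1)).length + 1, c₁.reg, c₁.mem⟩ := by
      rw [h2.step p1]
      simp only [Instr.exec, Config.mk.injEq, and_true]
      rw [if_pos (by rw [← v1] at heq; exact heq)]
    obtain ⟨t2, T2, k2, e2, c2, b2, p2, r2⟩ := ih _ M ⟨_, c₁.reg, c₁.mem⟩ rfl h5 (by dsimp only; omega) r1
    refine ⟨t2 + (1 + (e.code 0).length), 1 + T2, k2, ?_, by rw [c2, St.tick_clk]; omega, ?_, ?_,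
      r2⟩
    · rw [Function.iterate_add_apply, Function.iterate_add_apply, e1, Function.iterate_one, s1, e2]
    · rw [mul_add]; omega
    · rw [p2]
      simp only [code, List.length_append, List.length_singleton]
      omega
  | @loop_done e c s heq =>
    subst hp
    obtain ⟨h1, h2⟩ := hA.append
    obtain ⟨c₁, e1, p1, r1, v1, k1⟩ := e.code_correct 0 k h1 hk
    obtain ⟨h2, h3⟩ := h2.append
    simp only [code, List.length_append, List.length_singleton] at hM
    refine ⟨1 + (e.code 0).length, 1, _, rfl, rfl, by omega, ?_⟩
    rw [Function.iterate_add_apply, e1, Function.iterate_one, h2.step p1]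
    refine ⟨?_, r1⟩
    simp only [Instr.exec, code, List.length_append, List.length_singleton]
    rw [if_pos (by rw [← v1] at heq; exact heq)]
    omega
  | @loop_step e c s₁ s₂ s₃ hne _ _ ih1 ih2 =>
    subst hp
    have hA' := hA
    obtain ⟨h1, h2⟩ := hA.append
    obtain ⟨c₁, e1, p1, r1, v1, k1⟩ := e.code_correct 0 k h1 hk
    obtain ⟨h2, h3⟩ := h2.append
    obtain ⟨h3, h4⟩ := h3.append
    rw [List.length_singleton] at h3 h4
    have hM' := hM
    simp only [code, List.length_append, List.length_singleton] at hM
    have s1 : A.step c₁ = ⟨c₁.pc + 1, c₁.reg, c₁.mem⟩ := by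
      rw [h2.step p1]
      simp only [Instr.exec, Config.mk.injEq, and_true]
      rw [if_neg (by rw [← v1] at hne; exact hne)]
    obtain ⟨t2, T2, k2, e2, c2, b2, p2, r2⟩ :=
      ih1 _ M ⟨c₁.pc + 1, c₁.reg, c₁.mem⟩ (by simp [p1]) h3 (by omega) r1
    -- The jump back leads to the address of the loop itself, so the induction hypothesis for the
    -- remaining rounds applies to the same code.
    obtain ⟨t3, T3, k3, e3, c3, b3, p3, r3⟩ :=
      ih2 k.pc M ⟨k.pc, k2.reg, k2.mem⟩ rfl hA' hM' r2
    refine ⟨t3 + (1 + (t2 + (1 + (e.code 0).length))), 1 + T2 + T3, k3, ?_, ?_, ?_, p3, r3⟩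
    · rw [Function.iterate_add_apply, Function.iterate_add_apply, Function.iterate_add_apply,
        Function.iterate_add_apply, e1, Function.iterate_one, s1, e2, h4.step p2]
      exact e3
    · rw [c3, c2, St.tick_clk]; omega
    · rw [mul_add, mul_add]; omega

/-- The initial state of a structured program. -/
def St.start (input : List ℕ) : St := ⟨fun _ => 0, fun i => input.getD i 0, 0⟩

/-- From here on it suffices to bound the clock, as the length of the code is a constant. -/
theorem Cmd.Runs.halts {c : Cmd} {input : List ℕ} {s : St} (h : c.Runs (St.start input) s) :
    ∃ t ≤ (c.code 0).length * s.clk,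
      Program.Halted (c.code 0) ((Program.step (c.code 0))^[t] (init input)) ∧
      Represents ((Program.step (c.code 0))^[t] (init input)) s := by
  obtain ⟨t, T, k', e1, hc, ht, hp, hr⟩ := h.code_correct (c.code 0) 0 (c.code 0).length
    (init input) rfl (fun i hi => by simp [hi]) le_rfl ⟨fun x => rfl, rfl⟩
  have hc' : s.clk = T := by rw [hc]; simp [St.start]
  refine ⟨t, hc' ▸ ht, ?_, e1 ▸ hr⟩
  simp [Program.Halted, e1, hp]

end RAM

/-! ### Frames and weakest preconditions -/

namespace RAM

namespace Cmd

/-- Does the program assign to the variable `x`? -/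
def writes (x : Var) : Cmd → Bool
  | skip => false
  | assign y _ => y = x
  | store _ _ => false
  | aset _ _ _ => false
  | seq c d => c.writes x || d.writes x
  | ite _ c d => c.writes x || d.writes x
  | loop _ c => c.writes x

/-- Does the program write to the array `j`? -/
def writesArr (j : Arr) : Cmd → Bool
  | skip => false
  | assign _ _ => false
  | store _ _ => false
  | aset j' _ _ => j' = j
  | seq c d => c.writesArr j || d.writesArr j
  | ite _ c d => c.writesArr j || d.writesArr j
  | loop _ c => c.writesArr j

/-- Does the program change the memory by `store`, or the variable `base`? -/
def raw : Cmd → Bool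
  | skip => false
  | assign y _ => y = .base
  | store _ _ => true
  | aset _ _ _ => false
  | seq c d => c.raw || d.raw
  | ite _ c d => c.raw || d.raw
  | loop _ c => c.raw

/-- What the program `c` does not change on its way from `s` to `s'`. -/
structure Frame (c : Cmd) (s s' : St) : Prop where
  v : ∀ x, c.writes x = false → s'.v x = s.v x
  base : c.raw = false → s'.v .base = s.v .base
  mem : c.raw = false → ∀ a < s.v .base, s'.m a = s.m a
  arr : c.raw = false → ∀ j, c.writesArr j = false → s'.arr j = s.arr j

theorem Frame.refl (c : Cmd) (s : St) : Frame c s s :=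
  ⟨fun _ _ => rfl, fun _ => rfl, fun _ _ _ => rfl, fun _ _ _ => rfl⟩

theorem Frame.tick (c : Cmd) (s : St) : Frame c s s.tick :=
  ⟨fun _ _ => rfl, fun _ => rfl, fun _ _ _ => rfl, fun _ _ _ => rfl⟩

theorem Frame.trans {c : Cmd} {s₁ s₂ s₃ : St} (h₁ : Frame c s₁ s₂) (h₂ : Frame c s₂ s₃) :
    Frame c s₁ s₃ where
  v x hx := (h₂.v x hx).trans (h₁.v x hx)
  base hc := (h₂.base hc).trans (h₁.base hc)
  mem hc a ha := (h₂.mem hc a (by rwa [h₁.base hc])).trans (h₁.mem hc a ha)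
  arr hc j hj := (h₂.arr hc j hj).trans (h₁.arr hc j hj)

theorem Frame.mono {c d : Cmd} {s s' : St} (h : Frame c s s')
    (hv : ∀ x, d.writes x = false → c.writes x = false) (hr : d.raw = false → c.raw = false)
    (ha : ∀ j, d.writesArr j = false → c.writesArr j = false) : Frame d s s' where
  v x hx := h.v x (hv x hx)
  base hc := h.base (hr hc)
  mem hc := h.mem (hr hc)
  arr hc j hj := h.arr (hr hc) j (ha j hj)

/-- The side conditions are Boolean functions of the program text, so for concrete programs they
hold by `rfl`. Array facts need `raw = false` because changing `base` would move all arrays. -/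
theorem Runs.frame {c : Cmd} {s s' : St} (h : c.Runs s s') : Frame c s s' := by
  induction h with
  | skip s => exact .refl _ s
  | assign x e s =>
    refine ⟨fun y hy => ?_, fun hc => ?_, fun _ _ _ => rfl, fun hc j _ => ?_⟩
    · simp only [writes, decide_eq_false_iff_not] at hy
      rw [St.setv_v, if_neg (Ne.symm hy)]
    · simp only [raw, decide_eq_false_iff_not] at hc
      rw [St.setv_v, if_neg (Ne.symm hc)]
    · simp only [raw, decide_eq_false_iff_not] at hc
      rw [St.setv_arr _ hc]
  | store e f s => exact ⟨fun _ _ => rfl, fun _ => rfl, nofun, nofun⟩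
  | aset j e f s =>
    refine ⟨fun _ _ => rfl, fun _ => rfl, fun _ a ha => St.aset_m _ _ _ _ ha, fun _ j' hj => ?_⟩
    simp only [writesArr, decide_eq_false_iff_not] at hj
    rw [St.aset_arr_ne _ (Ne.symm hj)]
  | seq _ _ ih1 ih2 =>
    exact (ih1.mono (by simp +contextual [writes]) (by simp +contextual [raw])
      (by simp +contextual [writesArr])).trans (ih2.mono (by simp +contextual [writes])
        (by simp +contextual [raw]) (by simp +contextual [writesArr]))
  | ite_true _ _ ih | ite_false _ _ ih =>
    exact (Frame.tick _ _).trans (ih.mono (by simp +contextual [writes])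
      (by simp +contextual [raw]) (by simp +contextual [writesArr]))
  | loop_done _ => exact .tick _ _
  | loop_step _ _ _ ih1 ih2 =>
    exact ((Frame.tick _ _).trans (ih1.mono (by simp [writes]) (by simp [raw])
      (by simp [writesArr]))).trans ih2

/-- Started in `s`, the program `c` terminates in a state that satisfies `R`. -/
def wp (c : Cmd) (s : St) (R : St → Prop) : Prop := ∃ s', c.Runs s s' ∧ R s'

/-- The frame comes for free with every run, so specifications of subprograms need mention only what
changes. -/
theorem wp.mono {c : Cmd} {s : St} {R R' : St → Prop} (h : c.wp s R)
    (hR : ∀ s', Frame c s s' → R s' → R' s') : c.wp s R' :=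
  let ⟨s', h1, h2⟩ := h
  ⟨s', h1, hR s' h1.frame h2⟩

theorem wp_skip {s : St} {R : St → Prop} (h : R s) : skip.wp s R := ⟨_, .skip s, h⟩

theorem wp_assign {x : Var} {e : Exp} {s : St} {R : St → Prop} (h : R (s.setv x (e.eval s))) :
    (assign x e).wp s R := ⟨_, .assign x e s, h⟩

theorem wp_store {e f : Exp} {s : St} {R : St → Prop} (h : R (s.sto (e.eval s) (f.eval s))) :
    (store e f).wp s R := ⟨_, .store e f s, h⟩

theorem wp_aset {j : Arr} {e f : Exp} {s : St} {R : St → Prop}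
    (h : R (s.aset j (e.eval s) (f.eval s))) : (aset j e f).wp s R := ⟨_, .aset j e f s, h⟩

theorem wp_seq {c d : Cmd} {s : St} {R : St → Prop} (h : c.wp s fun s' => d.wp s' R) :
    (seq c d).wp s R :=
  let ⟨_, h1, s₂, h2, h3⟩ := h
  ⟨s₂, h1.seq h2, h3⟩

theorem wp_nil {s : St} {R : St → Prop} (h : R s) : (block []).wp s R := wp_skip h

theorem wp_cons {c : Cmd} {l : List Cmd} {s : St} {R : St → Prop}
    (h : c.wp s fun s' => (block l).wp s' R) : (block (c :: l)).wp s R := wp_seq h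

theorem wp_ite {e : Exp} {c d : Cmd} {s : St} {R : St → Prop}
    (h1 : e.eval s ≠ 0 → c.wp s.tick R) (h2 : e.eval s = 0 → d.wp s.tick R) :
    (ite e c d).wp s R := by
  by_cases h : e.eval s = 0
  · obtain ⟨s', h3, h4⟩ := h2 h
    exact ⟨s', .ite_false h h3, h4⟩
  · obtain ⟨s', h3, h4⟩ := h1 h
    exact ⟨s', .ite_true h h3, h4⟩

/-- The constant `C` covers one round including its test; the additional 1 is the last test, which
fails. -/
theorem wp_loop {e : Exp} {c : Cmd} {s : St} {R : St → Prop} (I : St → Prop) (μ : St → ℕ) (C : ℕ)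
    (h0 : I s)
    (hstep : ∀ s₁, Frame (loop e c) s s₁ → I s₁ → e.eval s₁ ≠ 0 →
      c.wp s₁.tick fun s₂ => I s₂ ∧ μ s₂ < μ s₁ ∧ s₂.clk ≤ s₁.clk + C)
    (hR : ∀ s', Frame (loop e c) s s' → I s' → e.eval s' = 0 →
      s'.tick.clk ≤ s.clk + (μ s * C + 1) → R s'.tick) :
    (loop e c).wp s R := by
  -- The potential `clk + μ * C` never increases from round to round, which yields the clock bound
  -- at the exit.
  have key : ∀ N s₁, μ s₁ ≤ N → Frame (loop e c) s s₁ → I s₁ →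
      s₁.clk + μ s₁ * C ≤ s.clk + μ s * C → (loop e c).wp s₁ R := by
    intro N
    induction N with
    | zero =>
      intro s₁ hN hF hI hc
      by_cases he : e.eval s₁ = 0
      · exact ⟨_, .loop_done he, hR s₁ hF hI he (by simp only [St.tick_clk]; omega)⟩
      · obtain ⟨s₂, -, -, h2, -⟩ := hstep s₁ hF hI he
        omega
    | succ N ih =>
      intro s₁ hN hF hI hc
      by_cases he : e.eval s₁ = 0
      · exact ⟨_, .loop_done he, hR s₁ hF hI he (by simp only [St.tick_clk]; omega)⟩
      · obtain ⟨s₂, h1, h2, h3, h4⟩ := hstep s₁ hF hI he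
        have hF2 : Frame (loop e c) s₁ s₂ := (Frame.tick _ _).trans
          (h1.frame.mono (by simp [writes]) (by simp [raw]) (by simp [writesArr]))
        have hmul : (μ s₂ + 1) * C ≤ μ s₁ * C := Nat.mul_le_mul_right _ h3
        rw [add_mul] at hmul
        obtain ⟨s₃, h5, h6⟩ := ih s₂ (by omega) (hF.trans hF2) h2 (by omega)
        exact ⟨s₃, .loop_step he h1 h5, h6⟩
  exact key _ s le_rfl (.refl _ _) h0 le_rfl

/-- The bound `e` is evaluated anew in each round, hence the hypothesis `he`. The strict inequality
in `hstep` leaves one tick for incrementing the counter; the 2 in `hR` stands for the initial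
assignment and the last test. -/
theorem wp_for {x : Var} {e : Exp} {c : Cmd} {s : St} {R : St → Prop} (N : ℕ) (I : ℕ → St → Prop)
    (C : ℕ) (h0 : I 0 (s.setv x 0))
    (he : ∀ i s₁, Frame (for' x e c) s s₁ → I i s₁ → s₁.v x = i → e.eval s₁ = N)
    (hstep : ∀ i s₁, i < N → Frame (for' x e c) s s₁ → I i s₁ → s₁.v x = i →
      c.wp s₁.tick fun s₂ => s₂.v x = i ∧ I (i + 1) (s₂.setv x (i + 1)) ∧ s₂.clk < s₁.clk + C)
    (hR : ∀ s', Frame (for' x e c) s s' → I N s' → s'.v x = N →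
      s'.tick.clk ≤ s.clk + (N * C + 2) → R s'.tick) :
    (for' x e c).wp s R := by
  have hF0 : Frame (for' x e c) s (s.setv x 0) := by
    have := (Runs.assign x (.c 0) s).frame
    exact this.mono (by simp +contextual [writes, for']) (by simp +contextual [raw, for'])
      (by simp +contextual [writesArr, for'])
  have hsub : ∀ s₁ s₂, Frame (loop (.sub e (.v x)) (seq c (assign x (.add (.v x) (.c 1))))) s₁ s₂ →
      Frame (for' x e c) s₁ s₂ := fun s₁ s₂ h => h.mono (by simp +contextual [writes, for'])
        (by simp +contextual [raw, for']) (by simp +contextual [writesArr, for'])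
  refine wp_seq (wp_assign (wp_loop (fun s₁ => ∃ i ≤ N, I i s₁ ∧ s₁.v x = i)
    (fun s₁ => N - s₁.v x) C ⟨0, by simp, h0, by simp⟩ ?_ ?_))
  · rintro s₁ hF ⟨i, hiN, hI, hx⟩ hne
    have hF1 := hF0.trans (hsub _ _ hF)
    have heN := he i s₁ hF1 hI hx
    simp only [Exp.eval_sub, Exp.eval_v, heN, hx] at hne
    obtain ⟨s₂, h1, h2, h3, h4⟩ := hstep i s₁ (by omega) hF1 hI hx
    refine wp_seq ⟨s₂, h1, wp_assign ?_⟩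
    simp only [Exp.eval_add, Exp.eval_v, Exp.eval_c, h2]
    refine ⟨⟨i + 1, by omega, h3, by simp⟩, ?_, ?_⟩
    · simp only [St.setv_v, if_pos, hx]; omega
    · simp only [St.setv_clk]; omega
  · rintro s' hF ⟨i, hiN, hI, hx⟩ h0' hclk
    have hF1 := hF0.trans (hsub _ _ hF)
    have heN := he i s' hF1 hI hx
    simp only [Exp.eval_sub, Exp.eval_v, heN, hx] at h0'
    obtain rfl : i = N := by omega
    simp only [St.setv_clk, St.setv_v, if_pos, Exp.eval_c, Nat.sub_zero] at hclk
    refine hR s' hF1 hI hx ?_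
    simp only [St.tick_clk] at hclk ⊢
    omega

end Cmd

end RAM

/-! ### Chain covers from matchings -/

/-- A partial order on `{0, …, n - 1}`. -/
structure NatOrder (n : ℕ) (le : ℕ → ℕ → Prop) : Prop where
  bound : ∀ {i j}, le i j → i < n ∧ j < n
  refl : ∀ {i}, i < n → le i i
  trans : ∀ {i j k}, le i j → le j k → le i k
  antisymm : ∀ {i j}, le i j → le j i → i = j

/-- The number of zeros among `f 0, …, f (n - 1)`. -/
def zeros (n : ℕ) (f : ℕ → ℕ) : ℕ := ((Finset.range n).filter fun i => f i = 0).card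

theorem zeros_le (n : ℕ) (f : ℕ → ℕ) : zeros n f ≤ n :=
  (Finset.card_filter_le _ _).trans (Finset.card_range n).le

theorem zeros_update_of_zero {n : ℕ} {f : ℕ → ℕ} {a v : ℕ} (ha : a < n) (hf : f a = 0)
    (hv : v ≠ 0) : zeros n (Function.update f a v) + 1 = zeros n f := by
  have : (Finset.range n).filter (fun i => f i = 0) =
      insert a ((Finset.range n).filter fun i => Function.update f a v i = 0) := by
    ext i
    by_cases h : i = a
    · subst h; simp [ha, hf]
    · simp [h]
  rw [zeros, zeros, this, Finset.card_insert_of_notMem]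
  simp [hv]

theorem zeros_update_of_ne_zero {n : ℕ} {f : ℕ → ℕ} {a v : ℕ} (hf : f a ≠ 0)
    (hv : v ≠ 0) : zeros n (Function.update f a v) = zeros n f := by
  unfold zeros
  congr 1
  ext i
  by_cases h : i = a
  · subst h; simp [hf, hv]
  · simp [h]

/-- A matching in the comparability graph, between lower elements `a` and upper elements `b`, given
by the maps `nxt` and `prd`: `nxt a = b + 1` and `prd b = a + 1` if `a` and `b` are matched, and the
value `0` stands for unmatched elements. The upper element `w - 1` is disregarded, if `w ≠ 0`. -/
structure IsMatching (n : ℕ) (le : ℕ → ℕ → Prop) (nxt prd : ℕ → ℕ) (w : ℕ) : Prop where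
  nxt_spec : ∀ {a b}, a < n → nxt a = b + 1 → b < n ∧ le a b ∧ a ≠ b ∧ prd b = a + 1 ∧ b + 1 ≠ w
  prd_spec : ∀ {a b}, b < n → prd b = a + 1 → b + 1 ≠ w → a < n ∧ nxt a = b + 1

/-- If `b` is marked by `a`, then `a` is below `b` and is unmatched or matched to a marked element of
smaller rank. -/
def MarkSpec (n : ℕ) (le : ℕ → ℕ → Prop) (nxt par rank : ℕ → ℕ) (b : ℕ) : Prop :=
  ∀ a, par b = a + 1 → a < n ∧ le a b ∧ a ≠ b ∧
    ∀ b', nxt a = b' + 1 → par b' ≠ 0 ∧ rank b' < rank b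

/-- All marked elements are reached by alternating paths. -/
def Marking (n : ℕ) (le : ℕ → ℕ → Prop) (nxt par : ℕ → ℕ) : Prop :=
  ∃ rank : ℕ → ℕ, ∀ b < n, MarkSpec n le nxt par rank b ∧ (par b ≠ 0 → rank b + zeros n par < n)

/-- The lower element `a` is unmatched or matched to a marked element. -/
def Reached (nxt par : ℕ → ℕ) (a : ℕ) : Prop := ∀ b, nxt a = b + 1 → par b ≠ 0

section

variable {n : ℕ} {le : ℕ → ℕ → Prop} {nxt prd par rank : ℕ → ℕ}

/-- Marks are ranked by the time at which they are set. The partner of `a` was marked earlier, so it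
has smaller rank. -/
theorem Marking.mark {a b : ℕ} (hM : IsMatching n le nxt prd 0) (h : Marking n le nxt par)
    (ha : a < n) (hb : b < n) (hpar : par b = 0) (hab : le a b) (hne : a ≠ b)
    (hr : Reached nxt par a) : Marking n le nxt (Function.update par b (a + 1)) := by
  obtain ⟨rank, hrank⟩ := h
  have hz := zeros_update_of_zero (v := a + 1) hb hpar (by omega)
  have hzn := zeros_le n par
  -- The new rank is the number of marks set so far. It exceeds all old ranks by the inequality in
  -- `Marking`, and that inequality persists since one zero of `par` disappears.
  refine ⟨Function.update rank b (n - zeros n par), fun c hc => ?_⟩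
  by_cases hcb : c = b
  · subst hcb
    refine ⟨fun a' ha' => ?_, fun _ => ?_⟩
    · rw [Function.update_self] at ha'
      obtain rfl : a = a' := by omega
      refine ⟨ha, hab, hne, fun b' hb' => ?_⟩
      have h1 := hr b' hb'
      have h2 := (hM.nxt_spec ha hb').1
      have h3 := (hrank b' h2).2 h1
      have h4 : b' ≠ c := fun h => h1 (h ▸ hpar)
      rw [Function.update_of_ne h4, Function.update_of_ne h4, Function.update_self]
      exact ⟨h1, by omega⟩
    · rw [Function.update_self]; omega
  · rw [Function.update_of_ne hcb, Function.update_of_ne hcb]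
    refine ⟨fun a' ha' => ?_, fun h => ?_⟩
    · rw [Function.update_of_ne hcb] at ha'
      obtain ⟨h1, h2, h3, h4⟩ := (hrank c hc).1 a' ha'
      refine ⟨h1, h2, h3, fun b' hb' => ?_⟩
      have h5 := h4 b' hb'
      have h6 : b' ≠ b := fun h => h5.1 (h ▸ hpar)
      rwa [Function.update_of_ne h6, Function.update_of_ne h6, Function.update_of_ne hcb]
    · have := (hrank c hc).2 h
      omega

/-- One step back along an alternating path. The upper element `h`, so far a hole whose `prd` may be
stale, is matched to the element `a` that marked it; the former partner of `a` becomes the new hole.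
In the format of `w` the new hole is just `nxt a`, with 0 if `a` was free, and only in that case
does the matching grow. An element marked by `a` has larger rank than the former partner of `a`, so
the marks of rank at most that of the new hole do not involve `a` and remain valid. -/
theorem IsMatching.augment {h a : ℕ} (hM : IsMatching n le nxt prd (h + 1)) (hh : h < n)
    (hmark : ∀ b < n, rank b ≤ rank h → MarkSpec n le nxt par rank b) (ha : par h = a + 1) :
    IsMatching n le (Function.update nxt a (h + 1)) (Function.update prd h (a + 1)) (nxt a) ∧
    (nxt a = 0 → zeros n (Function.update nxt a (h + 1)) + 1 = zeros n nxt) ∧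
    (∀ h', nxt a = h' + 1 → h' < n ∧ par h' ≠ 0 ∧ rank h' < rank h ∧
      zeros n (Function.update nxt a (h + 1)) = zeros n nxt ∧
      ∀ b < n, rank b ≤ rank h' → MarkSpec n le (Function.update nxt a (h + 1)) par rank b) := by
  obtain ⟨han, hah, hne, hprev⟩ := hmark h hh le_rfl a ha
  refine ⟨⟨fun {a' b'} ha' hb' => ?_, fun {a' b'} hb' ha' hw => ?_⟩, fun h0 => ?_, fun h' hh' => ?_⟩
  · by_cases haa : a' = a
    · subst haa
      rw [Function.update_self] at hb'
      obtain rfl : h = b' := by omega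
      refine ⟨hh, hah, hne, by simp, fun he => ?_⟩
      exact (hM.nxt_spec ha' he.symm).2.2.2.2 rfl
    · rw [Function.update_of_ne haa] at hb'
      obtain ⟨h1, h2, h3, h4, h5⟩ := hM.nxt_spec ha' hb'
      refine ⟨h1, h2, h3, ?_, fun he => ?_⟩
      · rwa [Function.update_of_ne (by omega)]
      · have := (hM.nxt_spec han he.symm).2.2.2.1
        omega
  · by_cases hbh : b' = h
    · subst hbh
      rw [Function.update_self] at ha'
      obtain rfl : a = a' := by omega
      exact ⟨han, by simp⟩
    · rw [Function.update_of_ne hbh] at ha'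
      obtain ⟨h1, h2⟩ := hM.prd_spec hb' ha' (by omega)
      refine ⟨h1, ?_⟩
      rw [Function.update_of_ne]
      · exact h2
      · rintro rfl
        exact hw h2.symm
  · exact zeros_update_of_zero han h0 (by omega)
  · obtain ⟨h1, h2⟩ := hprev h' hh'
    refine ⟨(hM.nxt_spec han hh').1, h1, h2, zeros_update_of_ne_zero (by omega) (by omega),
      fun b hb hrb c hc => ?_⟩
    obtain ⟨h3, h4, h5, h6⟩ := hmark b hb (by omega) c hc
    have hca : c ≠ a := by
      rintro rfl
      have := (h6 h' hh').2
      omega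
    rw [Function.update_of_ne hca]
    exact ⟨h3, h4, h5, h6⟩

/-- If there is no augmenting path, then there is an antichain with at least as many elements as
there are unmatched upper elements. -/
theorem IsMatching.exists_antichain (hM : IsMatching n le nxt prd 0)
    (hmark : ∀ b < n, par b ≠ 0 → prd b ≠ 0)
    (hclosed : ∀ a < n, ∀ b < n, Reached nxt par a → le a b → a ≠ b → par b ≠ 0) :
    ∃ A : Finset ℕ, (∀ a ∈ A, a < n) ∧ (∀ a ∈ A, ∀ b ∈ A, a ≠ b → ¬ le a b) ∧
      zeros n prd ≤ A.card := by
  classical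
  -- König's argument: lower copies outside `RL` and upper copies in `RR` cover all edges, so the
  -- elements with neither copy in the cover form an antichain. With `Z` the unmatched upper
  -- elements and `U` the matched unmarked ones, `n - |RL| ≤ |U|` and `|RR| + |Z| + |U| ≤ n` give
  -- `|Z| ≤ |RL| - |RR|`.
  set RL := (Finset.range n).filter fun a => Reached nxt par a with hRL
  set RR := (Finset.range n).filter fun b => par b ≠ 0 with hRR
  refine ⟨RL \ RR, fun a ha => ?_, fun a ha b hb hne hab => ?_, ?_⟩
  · simp only [hRL, Finset.mem_sdiff, Finset.mem_filter, Finset.mem_range] at ha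
    exact ha.1.1
  · simp only [hRL, hRR, Finset.mem_sdiff, Finset.mem_filter, Finset.mem_range] at ha hb
    exact hb.2 ⟨hb.1.1, hclosed a ha.1.1 b hb.1.1 ha.1.2 hab hne⟩
  · set Z := (Finset.range n).filter fun b => prd b = 0 with hZ
    set U := (Finset.range n).filter fun b => par b = 0 ∧ prd b ≠ 0 with hU
    have hcompl : ∀ a ∈ Finset.range n \ RL, a < n ∧ ∃ b, nxt a = b + 1 ∧ par b = 0 := by
      intro a ha
      simp only [hRL, Finset.mem_sdiff, Finset.mem_filter, Finset.mem_range, not_and] at ha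
      have hb := ha.2 ha.1
      simp only [Reached, not_forall, not_not, exists_prop] at hb
      exact ⟨ha.1, hb⟩
    -- A lower element that is not reached is matched to an unmarked element, and distinct lower
    -- elements have distinct partners.
    have h1 : (Finset.range n \ RL).card ≤ U.card := by
      refine Finset.card_le_card_of_injOn (fun a => nxt a - 1) ?_ ?_
      · intro a ha
        obtain ⟨han, b, hb1, hb2⟩ := hcompl a ha
        obtain ⟨h1, h2, h3, h4, h5⟩ := hM.nxt_spec han hb1
        simp [hU, hb1, h1, hb2, h4]
      · intro a ha a' ha' haa
        obtain ⟨han, b, hb1, -⟩ := hcompl a ha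
        obtain ⟨han', b', hb1', -⟩ := hcompl a' ha'
        simp only [hb1, hb1', Nat.add_sub_cancel] at haa
        subst haa
        have h2 := (hM.nxt_spec han hb1).2.2.2.1
        have h3 := (hM.nxt_spec han' hb1').2.2.2.1
        omega
    -- Disjointness of `RR` and `Z` is the absence of augmenting paths.
    have h2 : RR.card + (Z.card + U.card) ≤ n := by
      have hdisj : Disjoint Z U := by
        rw [Finset.disjoint_left]
        intro b hb hb'
        simp only [hZ, hU, Finset.mem_filter] at hb hb'
        exact hb'.2.2 hb.2
      have hdisj' : Disjoint RR (Z ∪ U) := by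
        rw [Finset.disjoint_left]
        intro b hb hb'
        simp only [hRR, hZ, hU, Finset.mem_union, Finset.mem_filter, Finset.mem_range] at hb hb'
        rcases hb' with hb' | hb'
        · exact hmark b hb.1 hb.2 hb'.2
        · exact hb.2 hb'.2.1
      rw [← Finset.card_union_of_disjoint hdisj, ← Finset.card_union_of_disjoint hdisj']
      refine (Finset.card_le_card ?_).trans (Finset.card_range n).le
      simp only [hRR, hZ, hU]
      refine Finset.union_subset ?_ (Finset.union_subset ?_ ?_) <;> exact Finset.filter_subset _ _
    have h3 : (Finset.range n \ RL).card + RL.card = n := by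
      rw [Finset.card_sdiff_add_card_eq_card (Finset.filter_subset _ _), Finset.card_range]
    have h4 := Finset.card_le_card_sdiff_add_card (s := RL) (t := RR)
    change Z.card ≤ _
    omega

/-- `y` is on the chain that starts in `x` and follows the matching. -/
def OnChain (nxt : ℕ → ℕ) : ℕ → ℕ → Prop := Relation.ReflTransGen fun a b => nxt a = b + 1

theorem OnChain.rel {x y : ℕ} (h : OnChain nxt x y) (hP : NatOrder n le)
    (hM : IsMatching n le nxt prd 0) (hx : x < n) : le x y := by
  induction h with
  | refl => exact hP.refl hx
  | tail _ hbc ih => exact hP.trans ih (hM.nxt_spec (hP.bound ih).2 hbc).2.1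

theorem OnChain.of_ne {x y : ℕ} (h : OnChain nxt x y) (hne : y ≠ x) :
    ∃ z, nxt x = z + 1 ∧ OnChain nxt z y := by
  rcases Relation.ReflTransGen.cases_head h with rfl | ⟨z, hz, h'⟩
  · exact absurd rfl hne
  · exact ⟨z, hz, h'⟩

open Classical in
/-- The number of elements above `x`. -/
noncomputable def numAbove (n : ℕ) (le : ℕ → ℕ → Prop) (x : ℕ) : ℕ :=
  ((Finset.range n).filter fun z => le x z).card

theorem numAbove_le (x : ℕ) : numAbove n le x ≤ n := by
  classical
  exact (Finset.card_filter_le _ _).trans (Finset.card_range n).le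

/-- This count measures progress twice: in the descent to the bottom of a chain, and for the
candidates that climb along the chains. -/
theorem NatOrder.numAbove_lt (hP : NatOrder n le) {x y : ℕ} (hxy : le x y) (hne : x ≠ y) :
    numAbove n le y < numAbove n le x := by
  classical
  apply Finset.card_lt_card
  rw [Finset.ssubset_iff_of_subset]
  · refine ⟨x, by simp [(hP.bound hxy).1, hP.refl (hP.bound hxy).1], ?_⟩
    simp only [Finset.mem_filter, not_and]
    exact fun _ h => hne (hP.antisymm hxy h)
  · intro z
    simp only [Finset.mem_filter]
    exact fun h => ⟨h.1, hP.trans hxy h.2⟩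

/-- Every element is on a chain that starts in an unmatched upper element. -/
theorem IsMatching.exists_head (hP : NatOrder n le) (hM : IsMatching n le nxt prd 0) {x : ℕ}
    (hx : x < n) : ∃ h < n, prd h = 0 ∧ OnChain nxt h x := by
  -- Going down to the matched predecessor increases the number of elements above.
  induction hk : n - numAbove n le x using Nat.strong_induction_on generalizing x with
  | _ k ih =>
    subst hk
    rcases hp : prd x with _ | a
    · exact ⟨x, hx, hp, .refl⟩
    · obtain ⟨h1, h2⟩ := hM.prd_spec hx hp (by omega)
      obtain ⟨h3, h4, h5, -⟩ := hM.nxt_spec h1 h2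
      have h6 := hP.numAbove_lt h4 h5
      have h7 := numAbove_le (n := n) (le := le) a
      obtain ⟨h, h8, h9, h10⟩ := ih _ (by omega) h1 rfl
      exact ⟨h, h8, h9, h10.tail h2⟩

end

/-! ### Embeddings along chains -/

/-- `e` is an embedding of the order `leQ` on `{0, …, q - 1}` into the order `le` on
`{0, …, n - 1}`. -/
def NatEmb (q n : ℕ) (leQ le : ℕ → ℕ → Prop) (e : ℕ → ℕ) : Prop :=
  ∀ i < q, e i < n ∧ ∀ j < q, (leQ i j ↔ le (e i) (e j))

/-- With respect to the candidate values `x`, the value of `i` is too small, because of `j`. -/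
def TooSmall (leQ le : ℕ → ℕ → Prop) (x : ℕ → ℕ) (i j : ℕ) : Prop :=
  i ≠ j ∧ ((leQ j i ∧ ¬ (le (x j) (x i) ∧ x j ≠ x i)) ∨
    (¬ leQ j i ∧ ¬ leQ i j ∧ le (x i) (x j)))

section

variable {q n : ℕ} {leQ le : ℕ → ℕ → Prop} {nxt prd e x : ℕ → ℕ}

theorem NatEmb.injective (hQ : NatOrder q leQ) (hP : NatOrder n le) (he : NatEmb q n leQ le e)
    {i j : ℕ} (hi : i < q) (hj : j < q) (h : e i = e j) : i = j := by
  have h1 := ((he i hi).2 j hj).2 (h ▸ hP.refl (he i hi).1)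
  have h2 := ((he j hj).2 i hi).2 (h ▸ hP.refl (he i hi).1)
  exact hQ.antisymm h1 h2

/-- Suppose `e i = x i`, and recall `x j ≤ e j`. If `j < i` in `Q`, then `x j ≤ e j ≤ e i = x i`,
and equality of `x j` and `x i` would collapse `e j` and `e i`. If `i` and `j` are incomparable and
`x i ≤ x j`, then `e i ≤ e j`. Both contradict the choice of `i` and `j`, so raising `x i` is
forced. -/
theorem TooSmall.ne (hQ : NatOrder q leQ) (hP : NatOrder n le) (hM : IsMatching n le nxt prd 0)
    (he : NatEmb q n leQ le e) (hx : ∀ i < q, x i < n) (hch : ∀ i < q, OnChain nxt (x i) (e i))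
    {i j : ℕ} (hi : i < q) (hj : j < q) (h : TooSmall leQ le x i j) : e i ≠ x i := by
  intro hei
  have hle := (hch j hj).rel hP hM (hx j hj)
  obtain ⟨hij, ⟨h1, h2⟩ | ⟨h1, h2, h3⟩⟩ := h
  · have h3 := ((he j hj).2 i hi).1 h1
    have h4 : le (x j) (x i) := hei ▸ hP.trans hle h3
    refine h2 ⟨h4, fun h5 => hij ?_⟩
    have h6 : e j = x j := hP.antisymm (by rw [h5, ← hei]; exact h3) hle
    exact he.injective hQ hP hi hj (by rw [hei, h6, h5])
  · exact h2 (((he i hi).2 j hj).2 (hei ▸ hP.trans h3 hle))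

/-- Every violated order condition makes an element of the pair too small: if a relation is missing,
the element that is larger in `Q`; if a relation is superfluous, the element with the smaller value.
-/
theorem natEmb_of_forall_not_tooSmall (hQ : NatOrder q leQ) (hP : NatOrder n le)
    (hx : ∀ i < q, x i < n) (h : ∀ i < q, ∀ j < q, ¬ TooSmall leQ le x i j) :
    NatEmb q n leQ le x := by
  refine fun i hi => ⟨hx i hi, fun j hj => ?_⟩
  by_cases hij : i = j
  · subst hij
    exact iff_of_true (hQ.refl hi) (hP.refl (hx i hi))
  · have h1 := h i hi j hj
    have h2 := h j hj i hi
    simp only [TooSmall] at h1 h2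
    constructor
    · intro hle
      by_contra hc
      exact h2 ⟨Ne.symm hij, Or.inl ⟨hle, fun h => hc h.1⟩⟩
    · intro hle
      by_contra hc
      by_cases hji : leQ j i
      · exact h1 ⟨hij, Or.inl ⟨hji, fun h => h.2 (hP.antisymm h.1 hle)⟩⟩
      · exact h1 ⟨hij, Or.inr ⟨hji, hc, hle⟩⟩

end

namespace RAM

open Cmd

/-! ### Searching for a pair -/

/-- Search for numbers `a < e` and `b < f` that satisfy the condition `test`. If there are any, then
`r = a + 1` and `col = b` for some of them at the end, and otherwise `r = 0`. -/
def search (e f test : Exp) : Cmd :=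
  block [assign .r (.c 0),
    for' .a e (for' .b f (ite test
      (block [assign .r (.add (.v .a) (.c 1)), assign .col (.v .b)]) skip))]

/-- The frame in `ht` expresses that the search alters only `a`, `b`, `r` and `col`, so that the
test has a fixed meaning `T` throughout. There is no early exit. The 5 counts loop test, condition,
two assignments and increment of the inner loop. -/
theorem wp_search {e f test : Exp} {s : St} {R : St → Prop} (n₁ n₂ : ℕ) (T : ℕ → ℕ → Prop)
    (he : ∀ s', Frame (search e f test) s s' → e.eval s' = n₁)
    (hf : ∀ s', Frame (search e f test) s s' → f.eval s' = n₂)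
    (ht : ∀ s', Frame (search e f test) s s' → s'.v .a < n₁ → s'.v .b < n₂ →
      (test.eval s' ≠ 0 ↔ T (s'.v .a) (s'.v .b)))
    (hR : ∀ s', Frame (search e f test) s s' →
      ((s'.v .r = 0 ∧ ∀ i < n₁, ∀ j < n₂, ¬ T i j) ∨
        ∃ i j, i < n₁ ∧ j < n₂ ∧ T i j ∧ s'.v .r = i + 1 ∧ s'.v .col = j) →
      s'.clk ≤ s.clk + (n₁ * (n₂ * 5 + 4) + 3) → R s') :
    (search e f test).wp s R := by
  set D := ite test (block [assign .r (.add (.v .a) (.c 1)), assign .col (.v .b)]) skip with hD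
  have F1 : ∀ {s₁ s₂}, Frame (for' .a e (for' .b f D)) s₁ s₂ → Frame (search e f test) s₁ s₂ :=
    fun h => h.mono (by simp +contextual [writes, search, block, hD])
      (by simp +contextual [raw, search, block, hD])
      (by simp +contextual [writesArr, search, block, hD])
  have F2 : ∀ {s₁ s₂}, Frame (for' .b f D) s₁ s₂ → Frame (search e f test) s₁ s₂ :=
    fun h => h.mono (by simp +contextual [writes, search, block, hD, for'])
      (by simp +contextual [raw, search, block, hD, for'])
      (by simp +contextual [writesArr, search, block, hD, for'])
  have F0 : Frame (search e f test) s (s.setv .r 0) :=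
    (Runs.assign .r (.c 0) s).frame.mono (by simp +contextual [writes, search, block])
      (by simp +contextual [raw]) (by simp +contextual [writesArr])
  refine wp_cons (wp_assign (wp_cons ?_))
  have F0' : Frame (search e f test) s (s.setv .r ((Exp.c 0).eval s)) := F0
  refine wp_for n₁ (fun i s' => (s'.v .r = 0 ∧ ∀ i' < i, ∀ j < n₂, ¬ T i' j) ∨
    ∃ i' j, i' < n₁ ∧ j < n₂ ∧ T i' j ∧ s'.v .r = i' + 1 ∧ s'.v .col = j) (n₂ * 5 + 4)
    (by simp) (fun i s₁ hF _ _ => he s₁ (F0'.trans (F1 hF))) ?_ ?_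
  · intro i s₁ hi hF hI ha
    refine wp_for n₂ (fun j s' => s'.v .a = i ∧
      ((s'.v .r = 0 ∧ (∀ i' < i, ∀ j < n₂, ¬ T i' j) ∧ ∀ j' < j, ¬ T i j') ∨
      ∃ i' j, i' < n₁ ∧ j < n₂ ∧ T i' j ∧ s'.v .r = i' + 1 ∧ s'.v .col = j)) 5 ?_
      (fun j s₂ hF2 _ _ => hf s₂ ((F0'.trans (F1 hF)).trans (.trans (.tick _ _) (F2 hF2)))) ?_ ?_
    · simpa [ha] using hI
    · rintro j s₂ hj hF2 ⟨hi2, hI2⟩ hb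
      have hF3 := ((F0'.trans (F1 hF)).trans (.trans (.tick _ _) (F2 hF2)))
      have hT := ht s₂ hF3 (by omega) (by omega)
      rw [hi2, hb] at hT
      refine wp_ite (fun h => ?_) (fun h => ?_)
      · have hT' : T i j := hT.1 (by simpa using h)
        refine wp_cons (wp_assign (wp_cons (wp_assign (wp_nil ?_))))
        simp only [St.setv_v, St.tick_v, St.setv_clk, St.tick_clk, Exp.eval_add, Exp.eval_v,
          Exp.eval_c, hb, hi2, if_true, reduceCtorEq, if_false, true_and]
        refine ⟨Or.inr ⟨i, j, hi, hj, hT', rfl, rfl⟩, by omega⟩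
      · have hT' : ¬ T i j := fun h' => (hT.2 h') (by simpa using h)
        refine wp_skip ?_
        simp only [St.setv_v, St.tick_v, St.tick_clk, hb, hi2, reduceCtorEq,
          if_false, true_and]
        refine ⟨?_, by omega⟩
        rcases hI2 with ⟨h1, h2, h3⟩ | h1
        · refine Or.inl ⟨h1, h2, fun j' hj' => ?_⟩
          rcases Nat.lt_succ_iff_lt_or_eq.1 hj' with h4 | rfl
          · exact h3 j' h4
          · exact hT'
        · exact Or.inr h1
    · rintro s₂ hF2 ⟨hi2, hI2⟩ hb hclk
      simp only [St.setv_v, St.tick_v, St.tick_clk, reduceCtorEq, if_false] at hclk ⊢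
      refine ⟨hi2, ?_, by omega⟩
      rcases hI2 with ⟨h1, h2, h3⟩ | h1
      · refine Or.inl ⟨h1, fun i' hi' => ?_⟩
        rcases Nat.lt_succ_iff_lt_or_eq.1 hi' with h4 | rfl
        · exact h2 i' h4
        · exact h3
      · exact Or.inr h1
  · intro s' hF hI _ hclk
    refine wp_nil (hR _ ((F0'.trans (F1 hF)).trans (.tick _ _)) hI ?_)
    rw [St.setv_clk] at hclk
    omega

end RAM

namespace RAM

open Cmd

/-! ### The input of the embedding problem in memory -/

/-- The orders `leQ` and `le` are given by their matrices in memory, and the addresses of the rows of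
the matrices are in the arrays `rowQ` and `rowP`. -/
structure Ctx (q n : ℕ) (leQ le : ℕ → ℕ → Prop) (s : St) : Prop where
  hq : s.v .q = q
  hn : s.v .n = n
  base : s.v .base = 2 + q * q + n * n
  memQ : ∀ i < q, ∀ j < q, (s.m (2 + i * q + j) ≠ 0 ↔ leQ i j)
  memP : ∀ i < n, ∀ j < n, (s.m (2 + q * q + i * n + j) ≠ 0 ↔ le i j)
  rowQ : ∀ i < q, s.arr .rowQ i = 2 + i * q
  rowP : ∀ i < n, s.arr .rowP i = 2 + q * q + i * n

theorem mul_add_lt {i j n m : ℕ} (hi : i < m) (hj : j < n) : i * n + j < m * n :=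
  calc i * n + j < i * n + n := by omega
    _ = (i + 1) * n := by ring
    _ ≤ m * n := Nat.mul_le_mul_right _ hi

/-- Row addresses are looked up in a table, as the machine cannot multiply. -/
def entryQ (e f : Exp) : Exp := .get (.add (.aget .rowQ e) f)

def entryP (e f : Exp) : Exp := .get (.add (.aget .rowP e) f)

section

variable {q n : ℕ} {leQ le : ℕ → ℕ → Prop} {s s' : St}

/-- The matrices lie below `base`, out of reach of array assignments. -/
theorem Ctx.frame {c : Cmd} (h : Ctx q n leQ le s) (F : Frame c s s')
    (hc : (c.raw || c.writes .q || c.writes .n || c.writesArr .rowQ || c.writesArr .rowP) = false) :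
    Ctx q n leQ le s' := by
  simp only [Bool.or_eq_false_iff] at hc
  obtain ⟨⟨⟨⟨h1, h2⟩, h3⟩, h4⟩, h5⟩ := hc
  refine ⟨?_, ?_, ?_, fun i hi j hj => ?_, fun i hi j hj => ?_, ?_, ?_⟩
  · rw [F.v _ h2, h.hq]
  · rw [F.v _ h3, h.hn]
  · rw [F.base h1, h.base]
  · rw [F.mem h1, h.memQ i hi j hj]
    have := mul_add_lt hi hj
    rw [h.base]
    omega
  · rw [F.mem h1, h.memP i hi j hj]
    have := mul_add_lt hi hj
    rw [h.base]
    omega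
  · rw [F.arr h1 _ h4]
    exact h.rowQ
  · rw [F.arr h1 _ h5]
    exact h.rowP

theorem Ctx.tick (h : Ctx q n leQ le s) : Ctx q n leQ le s.tick :=
  h.frame (.tick .skip s) rfl

theorem Ctx.setv (h : Ctx q n leQ le s) {x : Var} (v : ℕ)
    (hx : ((assign x (.c v)).raw || (assign x (.c v)).writes .q || (assign x (.c v)).writes .n) =
      false) : Ctx q n leQ le (s.setv x v) :=
  h.frame (Runs.assign x (.c v) s).frame (by simpa [writesArr] using hx)

theorem Ctx.eval_entryQ (h : Ctx q n leQ le s) {e f : Exp} (he : e.eval s < q) (hf : f.eval s < q) :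
    (entryQ e f).eval s ≠ 0 ↔ leQ (e.eval s) (f.eval s) := by
  simp only [entryQ, Exp.eval_get, Exp.eval_add, Exp.eval_aget]
  rw [h.rowQ _ he, h.memQ _ he _ hf]

theorem Ctx.eval_entryP (h : Ctx q n leQ le s) {e f : Exp} (he : e.eval s < n) (hf : f.eval s < n) :
    (entryP e f).eval s ≠ 0 ↔ le (e.eval s) (f.eval s) := by
  simp only [entryP, Exp.eval_get, Exp.eval_add, Exp.eval_aget]
  rw [h.rowP _ he, h.memP _ he _ hf]

end

/-! ### Computing a chain cover -/

/-- `a` is unmatched or matched to a marked element, and it is below the unmarked element `b`. -/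
def markTest : Exp :=
  .and (.or (.not (.aget .nxt (.v .a))) (.aget .par (.sub (.aget .nxt (.v .a)) (.c 1))))
    (.and (.not (.eq (.v .a) (.v .b))) (.and (entryP (.v .a) (.v .b)) (.not (.aget .par (.v .b)))))

/-- Mark all elements that are reached by alternating paths. At the end, `found` is the successor of
an unmatched marked element, if there is any, and `0` otherwise. -/
def markAll : Cmd :=
  block [for' .i (.v .n) (aset .par (.v .i) (.c 0)), assign .found (.c 0), assign .r (.c 1),
    loop (.v .r) (block [search (.v .n) (.v .n) markTest,
      ite (.v .r) (block [aset .par (.v .col) (.v .r),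
        ite (.aget .prd (.v .col)) skip (assign .found (.add (.v .col) (.c 1)))]) skip])]

/-- Augment the matching along the alternating path that ends in `found - 1`. -/
def augment : Cmd :=
  loop (.v .found) (block [assign .aux (.aget .par (.sub (.v .found) (.c 1))),
    assign .t (.aget .nxt (.sub (.v .aux) (.c 1))),
    aset .nxt (.sub (.v .aux) (.c 1)) (.v .found),
    aset .prd (.sub (.v .found) (.c 1)) (.v .aux),
    assign .found (.v .t)])

/-- The copy of `found` in `go` is needed because `augment` ends with `found = 0` in any case. -/
def findMatching : Cmd :=
  block [assign .go (.c 1), loop (.v .go) (block [markAll, assign .go (.v .found), augment])]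

section

variable {q n : ℕ} {leQ le : ℕ → ℕ → Prop}

theorem eval_markTest {s : St} {nxt : ℕ → ℕ} (h : Ctx q n leQ le s) (ha : s.v .a < n)
    (hb : s.v .b < n) (hnxt : s.arr .nxt = nxt) :
    markTest.eval s ≠ 0 ↔ Reached nxt (s.arr .par) (s.v .a) ∧ s.v .a ≠ s.v .b ∧
      le (s.v .a) (s.v .b) ∧ s.arr .par (s.v .b) = 0 := by
  have hP := h.eval_entryP (e := .v .a) (f := .v .b) ha hb
  simp only [markTest, Ne, Exp.eval_and, Exp.eval_or, Exp.eval_not, Exp.eval_eq, not_not,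
    Exp.eval_aget, Exp.eval_sub, Exp.eval_v, Exp.eval_c] at hP ⊢
  rw [hP, hnxt]
  refine and_congr ?_ Iff.rfl
  -- For unmatched `a` the truncated subtraction reads the irrelevant entry 0 of `par`, but then the
  -- first disjunct is already true.
  rcases hx : nxt (s.v .a) with _ | b
  · simp [Reached, hx]
  · simp [Reached, hx]

/-- The two outcomes are what the next step needs: `found ≠ 0` gives the end of an augmenting path,
and `found = 0` gives the hypotheses of `IsMatching.exists_antichain`. -/
theorem wp_markAll {s : St} (h : Ctx q n leQ le s)
    (hM : IsMatching n le (s.arr .nxt) (s.arr .prd) 0) :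
    markAll.wp s fun s' => Marking n le (s.arr .nxt) (s'.arr .par) ∧
      (∀ b, s'.v .found = b + 1 → b < n ∧ s'.arr .par b ≠ 0 ∧ s.arr .prd b = 0) ∧
      (s'.v .found = 0 → (∀ b < n, s'.arr .par b ≠ 0 → s.arr .prd b ≠ 0) ∧
        ∀ a < n, ∀ b < n, Reached (s.arr .nxt) (s'.arr .par) a → le a b → a ≠ b →
          s'.arr .par b ≠ 0) ∧
      s'.clk ≤ s.clk + ((n + 1) * (n * (n * 5 + 4) + 9) + (n * 3 + 5)) := by
  refine wp_cons (wp_for n (fun i s₁ => ∀ b < i, s₁.arr .par b = 0) 3 (by simp)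
    (fun i s₁ hF _ _ => (hF.v .n rfl).trans h.hn) ?_ ?_)
  · intro i s₁ hi hF hI hx
    refine wp_aset ?_
    simp only [Exp.eval_v, St.tick_v, hx, Exp.eval_c, St.aset_v, St.aset_clk, St.tick_clk, ne_eq,
      reduceCtorEq, not_false_eq_true, St.setv_arr, St.aset_arr_self, St.tick_arr, true_and]
    refine ⟨fun b hb => ?_, by omega⟩
    by_cases hbi : b = i
    · simp [hbi]
    · rw [Function.update_of_ne hbi, hI b (by omega)]
  intro s₁ hF1 hI1 _ hclk1
  have hC1 := h.frame hF1 rfl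
  have hnxt1 := hF1.arr rfl .nxt rfl
  have hprd1 := hF1.arr rfl .prd rfl
  refine wp_cons (wp_assign (wp_cons (wp_assign (wp_cons ?_))))
  have hmark0 : ∀ par : ℕ → ℕ, (∀ b < n, par b = 0) → Marking n le (s.arr .nxt) par :=
    fun par hp => ⟨fun _ => 0, fun b hb =>
      ⟨fun a ha => by rw [hp b hb] at ha; omega, fun hb' => absurd (hp b hb) hb'⟩⟩
  refine wp_loop (fun s₂ => Marking n le (s.arr .nxt) (s₂.arr .par) ∧
      (∀ b, s₂.v .found = b + 1 → b < n ∧ s₂.arr .par b ≠ 0 ∧ s.arr .prd b = 0) ∧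
      (s₂.v .found = 0 → ∀ b < n, s₂.arr .par b ≠ 0 → s.arr .prd b ≠ 0) ∧
      (s₂.v .r = 0 → ∀ a < n, ∀ b < n, Reached (s.arr .nxt) (s₂.arr .par) a → le a b → a ≠ b →
          s₂.arr .par b ≠ 0))
    -- Each successful round marks a new element; the second summand accounts for the final round,
    -- which finds nothing and sets `r` to 0.
    (fun s₂ => zeros n (s₂.arr .par) + if s₂.v .r = 0 then 0 else 1)
    (n * (n * 5 + 4) + 9) ?_ ?_ ?_
  · simp only [St.setv_v, St.setv_arr, St.tick_arr, ne_eq, reduceCtorEq, not_false_eq_true,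
      if_true, if_false, Exp.eval_c]
    refine ⟨hmark0 _ hI1, by simp, fun _ b hb hb' => absurd (hI1 b hb) hb', by simp⟩
  · rintro s₂ hF2 ⟨hI1, hI2, hI3, hI4⟩ hr
    have hC2 : Ctx q n leQ le s₂ := ((hC1.tick.setv 0 rfl).setv 1 rfl).frame hF2 rfl
    have hnxt2 : s₂.arr .nxt = s.arr .nxt := (hF2.arr rfl .nxt rfl).trans (by simpa using hnxt1)
    have hprd2 : s₂.arr .prd = s.arr .prd := (hF2.arr rfl .prd rfl).trans (by simpa using hprd1)
    rw [Exp.eval_v] at hr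
    refine wp_cons (wp_search n n (fun a b => Reached (s.arr .nxt) (s₂.arr .par) a ∧ a ≠ b ∧
      le a b ∧ s₂.arr .par b = 0) (fun s₃ hF3 => (hF3.v .n rfl).trans hC2.hn)
      (fun s₃ hF3 => (hF3.v .n rfl).trans hC2.hn) (fun s₃ hF3 ha hb => ?_) ?_)
    · have := eval_markTest (hC2.tick.frame hF3 rfl) ha hb
        ((hF3.arr rfl .nxt rfl).trans hnxt2)
      rwa [hF3.arr rfl .par rfl] at this
    · intro s₃ hF3 hres hclk3
      have hpar3 : s₃.arr .par = s₂.arr .par := hF3.arr rfl .par rfl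
      have hprd3 : s₃.arr .prd = s.arr .prd := (hF3.arr rfl .prd rfl).trans hprd2
      have hfound3 : s₃.v .found = s₂.v .found := hF3.v .found rfl
      rw [St.tick_clk] at hclk3
      rcases hres with ⟨hr0, hno⟩ | ⟨a, b, ha, hb, ⟨hreach, hne, hle, hpar⟩, hr1, hcol⟩
      · refine wp_cons (wp_ite (fun h => absurd hr0 h) fun _ => wp_skip (wp_nil ?_))
        simp only [St.tick_arr, hpar3, St.tick_v, hfound3, hr0, if_true, St.tick_clk, hr, if_false]
        refine ⟨⟨hI1, hI2, hI3, fun _ a ha b hb hreach hle hne h0 => ?_⟩, by omega, by omega⟩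
        exact hno a ha b hb ⟨hreach, hne, hle, h0⟩
      · refine wp_cons (wp_ite (fun _ => ?_) fun h => absurd h (by simp [hr1]))
        refine wp_cons (wp_aset (wp_cons ?_))
        simp only [Exp.eval_v, St.tick_v, hr1, hcol]
        have hmk := hI1.mark hM ha hb hpar hle hne hreach
        have hz := zeros_update_of_zero (v := a + 1) hb hpar (by omega)
        refine wp_ite (fun hp => ?_) (fun hp => ?_)
        · simp only [Exp.eval_aget, Exp.eval_v, St.aset_v, St.tick_v, hcol, ne_eq, reduceCtorEq,
            not_false_eq_true, St.aset_arr_ne, St.tick_arr, hprd3] at hp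
          refine wp_skip (wp_nil (wp_nil ?_))
          simp only [St.tick_arr, St.aset_arr_self, hpar3, St.tick_v, St.aset_v, hfound3, hr1,
            Nat.succ_ne_zero, false_imp_iff, and_true, if_false, hr, St.tick_clk, St.aset_clk]
          refine ⟨⟨hmk, fun b' hb' => ?_, fun h0 b' hb' => ?_⟩, by omega, by omega⟩
          · obtain ⟨h1, h2, h3⟩ := hI2 b' hb'
            refine ⟨h1, ?_, h3⟩
            by_cases hbb : b' = b <;> simp [hbb, h2]
          · by_cases hbb : b' = b
            · intro _; rw [hbb]; exact hp
            · rw [Function.update_of_ne hbb]; exact hI3 h0 b' hb'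
        · simp only [Exp.eval_aget, Exp.eval_v, St.aset_v, St.tick_v, hcol, ne_eq, reduceCtorEq,
            not_false_eq_true, St.aset_arr_ne, St.tick_arr, hprd3] at hp
          refine wp_assign (wp_nil (wp_nil ?_))
          simp only [St.tick_arr, St.aset_arr_self, hpar3, St.tick_v, St.aset_v, hr1, ne_eq,
            reduceCtorEq, not_false_eq_true, St.setv_arr, St.setv_v, if_true, Exp.eval_add,
            Exp.eval_v, Exp.eval_c, hcol, Nat.succ_ne_zero, false_imp_iff, and_true, if_false, hr,
            St.tick_clk, St.aset_clk, St.setv_clk]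
          refine ⟨⟨hmk, fun b' hb' => ?_⟩, by omega, by omega⟩
          obtain rfl : b = b' := by omega
          exact ⟨hb, by simp, hp⟩
  · rintro s₂ hF2 ⟨hI1', hI2, hI3, hI4⟩ hr hclk2
    refine wp_nil ?_
    simp only [St.setv_arr, St.tick_arr, ne_eq, reduceCtorEq, not_false_eq_true, St.setv_v, if_true,
      Exp.eval_c, one_ne_zero, if_false, St.setv_clk] at hclk2
    refine ⟨hI1', hI2, fun h0 => ⟨hI3 h0, hI4 hr⟩, ?_⟩
    have h1 := Nat.mul_le_mul_right (n * (n * 5 + 4) + 9)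
      (Nat.add_le_add_right (zeros_le n (s₁.arr .par)) 1)
    simp only [St.tick_clk] at hclk1 hclk2 ⊢
    omega

/-- The variable `found` is the hole of `IsMatching.augment`, so the invariant is a matching up to
this hole. The rank of the hole decreases strictly, and at `found = 0` the matching is complete
again. -/
theorem wp_augment {s : St} (hM : IsMatching n le (s.arr .nxt) (s.arr .prd) 0)
    (hmark : Marking n le (s.arr .nxt) (s.arr .par))
    (hfound : ∀ b, s.v .found = b + 1 → b < n ∧ s.arr .par b ≠ 0 ∧ s.arr .prd b = 0) :
    augment.wp s fun s' => IsMatching n le (s'.arr .nxt) (s'.arr .prd) 0 ∧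
      (s.v .found = 0 → s'.arr .nxt = s.arr .nxt ∧ s'.arr .prd = s.arr .prd) ∧
      (s.v .found ≠ 0 → zeros n (s'.arr .nxt) < zeros n (s.arr .nxt)) ∧
      s'.clk ≤ s.clk + (n * 6 + 1) := by
  obtain ⟨rank, hrank⟩ := hmark
  refine wp_loop (fun s₁ => IsMatching n le (s₁.arr .nxt) (s₁.arr .prd) (s₁.v .found) ∧
    (s.v .found = 0 → s₁.v .found = 0 ∧ s₁.arr .nxt = s.arr .nxt ∧ s₁.arr .prd = s.arr .prd) ∧
    (s₁.v .found = 0 → s.v .found ≠ 0 → zeros n (s₁.arr .nxt) < zeros n (s.arr .nxt)) ∧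
    ∀ h, s₁.v .found = h + 1 → h < n ∧ s.arr .par h ≠ 0 ∧
      zeros n (s₁.arr .nxt) = zeros n (s.arr .nxt) ∧
      ∀ b < n, rank b ≤ rank h → MarkSpec n le (s₁.arr .nxt) (s.arr .par) rank b)
    (fun s₁ => if s₁.v .found = 0 then 0 else rank (s₁.v .found - 1) + 1) 6 ?_ ?_ ?_
  -- An unmatched upper element may be declared to be the hole.
  · refine ⟨⟨fun {a b} ha hb => ?_, fun {a b} hb ha hw => ?_⟩, fun h => ⟨h, rfl, rfl⟩,
      fun h1 h2 => absurd h1 h2, fun h hh => ?_⟩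
    · obtain ⟨h1, h2, h3, h4, -⟩ := hM.nxt_spec ha hb
      refine ⟨h1, h2, h3, h4, fun h5 => ?_⟩
      have := (hfound b h5.symm).2.2
      omega
    · exact hM.prd_spec hb ha (by omega)
    · obtain ⟨h1, h2, h3⟩ := hfound h hh
      exact ⟨h1, h2, rfl, fun b hb _ => (hrank b hb).1⟩
  · rintro s₁ hF ⟨hM1, hI1, hI2, hI3⟩ hne
    have hpar1 : s₁.arr .par = s.arr .par := hF.arr rfl .par rfl
    obtain ⟨h, hh⟩ := Nat.exists_eq_succ_of_ne_zero hne
    simp only [Exp.eval_v, Nat.succ_eq_add_one] at hh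
    obtain ⟨hn, hp, hz, hmk⟩ := hI3 h hh
    obtain ⟨a, ha⟩ := Nat.exists_eq_succ_of_ne_zero hp
    rw [Nat.succ_eq_add_one] at ha
    rw [hh] at hM1
    obtain ⟨hM2, hz1, hz2⟩ := hM1.augment hn hmk ha
    have hne0 : s.v .found ≠ 0 := fun h0 => by rw [(hI1 h0).1] at hh; omega
    refine wp_cons (wp_assign (wp_cons (wp_assign (wp_cons (wp_aset (wp_cons (wp_aset (wp_cons
      (wp_assign (wp_nil ?_))))))))))
    simp only [Exp.eval_aget, Exp.eval_sub, Exp.eval_v, St.tick_v, hh, Exp.eval_c,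
      Nat.add_sub_cancel, St.tick_arr, hpar1, ha, St.setv_v, if_true, ne_eq, reduceCtorEq,
      not_false_eq_true, St.setv_arr, if_false, St.aset_v, St.aset_arr_self, St.aset_arr_ne,
      St.setv_clk, St.aset_clk, St.tick_clk, Nat.succ_ne_zero, hne0, false_imp_iff, true_and]
    refine ⟨⟨hM2, fun h0 _ => ?_, fun h' hh' => ?_⟩, ?_, by omega⟩
    · have := hz1 h0
      omega
    · obtain ⟨h1, h2, h3, h4, h5⟩ := hz2 h' hh'
      exact ⟨h1, h2, by omega, h5⟩
    · split_ifs with h0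
      · omega
      · obtain ⟨h', hh'⟩ := Nat.exists_eq_succ_of_ne_zero h0
        obtain ⟨h1, h2, h3, h4, h5⟩ := hz2 h' hh'
        rw [hh', Nat.succ_eq_add_one, Nat.add_sub_cancel]
        omega
  · rintro s₁ hF ⟨hM1, hI1, hI2, hI3⟩ h0 hclk
    rw [Exp.eval_v] at h0
    rw [h0] at hM1
    refine ⟨hM1, fun h => (hI1 h).2, hI2 h0, hclk.trans ?_⟩
    -- Ranks of marked elements are below `n`, so there are at most `n` rounds.
    have : (if s.v .found = 0 then 0 else rank (s.v .found - 1) + 1) ≤ n := by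
      split_ifs with h1
      · omega
      · obtain ⟨h, hh⟩ := Nat.exists_eq_succ_of_ne_zero h1
        obtain ⟨h2, h3, h4⟩ := hfound h hh
        have := (hrank h h2).2 h3
        rw [hh, Nat.succ_eq_add_one, Nat.add_sub_cancel]
        omega
    have := Nat.mul_le_mul_right 6 this
    omega

/-- Each round but the last enlarges the matching, so there are at most `n + 1` rounds of cubic
cost. -/
theorem wp_findMatching {s : St} (h : Ctx q n leQ le s)
    (hM : IsMatching n le (s.arr .nxt) (s.arr .prd) 0) (hn : 0 < n) :
    findMatching.wp s fun s' => IsMatching n le (s'.arr .nxt) (s'.arr .prd) 0 ∧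
      (∃ A : Finset ℕ, (∀ a ∈ A, a < n) ∧ (∀ a ∈ A, ∀ b ∈ A, a ≠ b → ¬ le a b) ∧
        zeros n (s'.arr .prd) ≤ A.card) ∧
      s'.clk ≤ s.clk + 200 * n ^ 4 := by
  -- The left side is `5 n^3 + 9 n^2 + 22 n + 17`; as `n ≥ 1`, every term is at most its coefficient
  -- times `n^3`.
  have hbound : (n + 1) * (n * (n * 5 + 4) + 9) + (n * 3 + 5) + (n * 6 + 1) + 2 ≤ 70 * n ^ 3 := by
    obtain ⟨m, rfl⟩ := Nat.exists_eq_add_of_lt hn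
    ring_nf
    nlinarith [Nat.zero_le m, Nat.zero_le (m ^ 2), Nat.zero_le (m ^ 3)]
  refine wp_cons (wp_assign (wp_cons (wp_loop
    (fun s₁ => IsMatching n le (s₁.arr .nxt) (s₁.arr .prd) 0 ∧ (s₁.v .go = 0 →
      ∃ A : Finset ℕ, (∀ a ∈ A, a < n) ∧ (∀ a ∈ A, ∀ b ∈ A, a ≠ b → ¬ le a b) ∧
        zeros n (s₁.arr .prd) ≤ A.card))
    (fun s₁ => zeros n (s₁.arr .nxt) + if s₁.v .go = 0 then 0 else 1) (70 * n ^ 3) ?_ ?_ ?_)))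
  · simpa using hM
  · rintro s₁ hF ⟨hM1, -⟩ hgo
    rw [Exp.eval_v] at hgo
    have hC1 : Ctx q n leQ le s₁ := (h.setv 1 rfl).frame hF rfl
    refine wp_cons ((wp_markAll hC1.tick hM1).mono ?_)
    rintro s₂ hF2 ⟨hmark, hf1, hf2, hclk2⟩
    have hnxt2 : s₂.arr .nxt = s₁.arr .nxt := hF2.arr rfl .nxt rfl
    have hprd2 : s₂.arr .prd = s₁.arr .prd := hF2.arr rfl .prd rfl
    simp only [St.tick_arr, St.tick_clk] at hmark hf1 hf2 hclk2
    refine wp_cons (wp_assign (wp_cons ((wp_augment (n := n) (le := le) ?_ ?_ ?_).mono ?_)))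
    · simpa [hnxt2, hprd2] using hM1
    · simpa [hnxt2] using hmark
    · simpa [hprd2] using hf1
    · rintro s₃ hF3 ⟨hM3, h1, h2, h3⟩
      have hgo3 : s₃.v .go = s₂.v .found := (hF3.v .go rfl).trans (by simp)
      simp only [St.setv_v, St.setv_arr, ne_eq, reduceCtorEq, not_false_eq_true, if_false,
        hnxt2, hprd2, St.setv_clk] at h1 h2 h3
      refine wp_nil ⟨⟨hM3, fun h0 => ?_⟩, ?_, by omega⟩
      · rw [hgo3] at h0
        rw [(h1 h0).2]
        exact hM1.exists_antichain (hf2 h0).1 (hf2 h0).2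
      · rw [hgo3, if_neg hgo]
        split_ifs with h0
        · rw [(h1 h0).1]
          omega
        · have := h2 h0
          omega
  · rintro s₁ hF ⟨hM1, hA⟩ hgo hclk
    refine wp_nil ⟨hM1, hA hgo, hclk.trans ?_⟩
    have h1 : zeros n (s.arr .nxt) + 1 ≤ 2 * n := by
      have := zeros_le n (s.arr .nxt)
      omega
    have h2 := Nat.mul_le_mul_right (70 * n ^ 3) h1
    have h3 : 2 * n * (70 * n ^ 3) = 140 * n ^ 4 := by ring
    have h4 : 0 < n ^ 4 := by positivity
    simp only [St.setv_arr, St.setv_v, ne_eq, reduceCtorEq, not_false_eq_true, if_true,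
      Exp.eval_c, one_ne_zero, if_false, St.setv_clk]
    omega

end

end RAM

namespace RAM

open Cmd

/-! ### Preparing the tables -/

/-- Compute the end of the input and the addresses of the rows of the order matrices. -/
def setup : Cmd :=
  block [assign .pb (.c 2), for' .i (.v .q) (assign .pb (.add (.v .pb) (.v .q))),
    assign .base (.v .pb), for' .i (.v .n) (assign .base (.add (.v .base) (.v .n))),
    assign .aux (.c 2),
    for' .i (.v .q) (block [aset .rowQ (.v .i) (.v .aux), assign .aux (.add (.v .aux) (.v .q))]),
    assign .aux (.v .pb),
    for' .i (.v .n) (block [aset .rowP (.v .i) (.v .aux), assign .aux (.add (.v .aux) (.v .n))])]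

/-- List the unmatched upper elements in the array `heads`. -/
def listHeads : Cmd :=
  block [assign .k (.c 0), for' .i (.v .n) (ite (.aget .prd (.v .i)) skip
    (block [aset .heads (.v .k) (.v .i), assign .k (.add (.v .k) (.c 1))]))]

/-- Compute the power `k ^ q`. -/
def power : Cmd :=
  block [assign .total (.c 1), for' .i (.v .q) (block [assign .aux (.c 0),
    for' .j (.v .k) (assign .aux (.add (.v .aux) (.v .total))), assign .total (.v .aux)])]

section

variable {q n : ℕ} {leQ le : ℕ → ℕ → Prop}

/-- Memory beyond the input is zero, so the arrays that are not filled here start out as zero. This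
provides the empty matching and the first assignment of chains. -/
theorem wp_setup {s : St} (hq : s.v .q = q) (hn : s.v .n = n)
    (hQ : ∀ i < q, ∀ j < q, (s.m (2 + i * q + j) ≠ 0 ↔ leQ i j))
    (hP : ∀ i < n, ∀ j < n, (s.m (2 + q * q + i * n + j) ≠ 0 ↔ le i j))
    (h0 : ∀ a, 2 + q * q + n * n ≤ a → s.m a = 0) :
    setup.wp s fun s' => Ctx q n leQ le s' ∧
      (∀ j, j ≠ .rowQ → j ≠ .rowP → ∀ i, s'.arr j i = 0) ∧
      s'.clk ≤ s.clk + (7 * q + 7 * n + 12) := by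
  refine wp_cons (wp_assign (wp_cons (wp_for q (fun i s₁ => s₁.m = s.m ∧ s₁.v .pb = 2 + i * q) 3
    (by simp) (fun i s₁ hF _ _ => (hF.v .q rfl).trans (by simpa using hq)) ?_ ?_)))
  · rintro i s₁ hi hF ⟨hm, hpb⟩ hx
    have hq1 : s₁.v .q = q := (hF.v .q rfl).trans (by simpa using hq)
    refine wp_assign ?_
    simp [hx, hm, hpb, hq1, Nat.succ_mul, add_assoc]
  rintro s₁ hF1 ⟨hm1, hpb1⟩ - hclk1
  have hq1 : s₁.v .q = q := (hF1.v .q rfl).trans (by simpa using hq)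
  have hn1 : s₁.v .n = n := (hF1.v .n rfl).trans (by simpa using hn)
  refine wp_cons (wp_assign (wp_cons (wp_for n
    (fun i s₂ => s₂.m = s.m ∧ s₂.v .base = 2 + q * q + i * n) 3
    (by simp [hm1, hpb1]) (fun i s₂ hF _ _ => (hF.v .n rfl).trans (by simpa using hn1)) ?_ ?_)))
  · rintro i s₂ hi hF ⟨hm, hpb⟩ hx
    have hn2 : s₂.v .n = n := (hF.v .n rfl).trans (by simpa using hn1)
    refine wp_assign ?_
    simp [hx, hm, hpb, hn2, Nat.succ_mul, add_assoc]
  rintro s₂ hF2 ⟨hm2, hbase2⟩ - hclk2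
  have hq2 : s₂.v .q = q := (hF2.v .q rfl).trans (by simpa using hq1)
  have hn2 : s₂.v .n = n := (hF2.v .n rfl).trans (by simpa using hn1)
  have hpb2 : s₂.v .pb = 2 + q * q := (hF2.v .pb rfl).trans (by simpa using hpb1)
  have harr2 : ∀ j i, s₂.arr j i = 0 := by
    intro j i
    rw [St.arr, hm2, hbase2]
    exact h0 _ (by omega)
  refine wp_cons (wp_assign (wp_cons (wp_for q (fun i s₃ => s₃.v .aux = 2 + i * q ∧
    ∀ i' < i, s₃.arr .rowQ i' = 2 + i' * q) 4 (by simp)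
    (fun i s₃ hF _ _ => (hF.v .q rfl).trans (by simpa using hq2)) ?_ ?_)))
  · rintro i s₃ hi hF ⟨haux, hrow⟩ hx
    have hq3 : s₃.v .q = q := (hF.v .q rfl).trans (by simpa using hq2)
    refine wp_cons (wp_aset (wp_cons (wp_assign (wp_nil ?_))))
    simp only [Exp.eval_v, St.tick_v, hx, haux, Exp.eval_add, St.aset_v, hq3, ne_eq, reduceCtorEq,
      not_false_eq_true, St.setv_arr, St.aset_arr_self, St.setv_v, if_true, if_false, true_and,
      St.tick_arr, St.setv_clk, St.aset_clk, St.tick_clk]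
    refine ⟨⟨by ring, fun i' hi' => ?_⟩, by omega⟩
    by_cases h : i' = i
    · simp [h]
    · rw [Function.update_of_ne h, hrow i' (by omega)]
  rintro s₃ hF3 ⟨-, hrow3⟩ - hclk3
  have hq3 : s₃.v .q = q := (hF3.v .q rfl).trans (by simpa using hq2)
  have hn3 : s₃.v .n = n := (hF3.v .n rfl).trans (by simpa using hn2)
  have hpb3 : s₃.v .pb = 2 + q * q := (hF3.v .pb rfl).trans (by simpa using hpb2)
  have hbase3 : s₃.v .base = 2 + q * q + n * n := (hF3.base rfl).trans (by simpa using hbase2)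
  have hm3 : ∀ a < 2 + q * q + n * n, s₃.m a = s.m a := fun a ha =>
    (hF3.mem rfl a (by simpa [hbase2] using ha)).trans (by simp [hm2])
  have harr3 : ∀ j, j ≠ .rowQ → ∀ i, s₃.arr j i = 0 := fun j hj i => by
    rw [hF3.arr rfl j (by cases j <;> first | rfl | exact absurd rfl hj)]
    simp [harr2]
  refine wp_cons (wp_assign (wp_cons (wp_for n (fun i s₄ => s₄.v .aux = 2 + q * q + i * n ∧
    ∀ i' < i, s₄.arr .rowP i' = 2 + q * q + i' * n) 4 (by simp [hpb3])
    (fun i s₄ hF _ _ => (hF.v .n rfl).trans (by simpa using hn3)) ?_ ?_)))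
  · rintro i s₄ hi hF ⟨haux, hrow⟩ hx
    have hn4 : s₄.v .n = n := (hF.v .n rfl).trans (by simpa using hn3)
    refine wp_cons (wp_aset (wp_cons (wp_assign (wp_nil ?_))))
    simp only [Exp.eval_v, St.tick_v, hx, haux, Exp.eval_add, St.aset_v, hn4, ne_eq, reduceCtorEq,
      not_false_eq_true, St.setv_arr, St.aset_arr_self, St.setv_v, if_true, if_false, true_and,
      St.tick_arr, St.setv_clk, St.aset_clk, St.tick_clk]
    refine ⟨⟨by ring, fun i' hi' => ?_⟩, by omega⟩
    by_cases h : i' = i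
    · simp [h]
    · rw [Function.update_of_ne h, hrow i' (by omega)]
  rintro s₄ hF4 ⟨-, hrow4⟩ - hclk4
  have hm4 : ∀ a < 2 + q * q + n * n, s₄.m a = s.m a := fun a ha =>
    (hF4.mem rfl a (by simpa [hbase3] using ha)).trans (hm3 a ha)
  refine wp_nil ⟨⟨?_, ?_, ?_, fun i hi j hj => ?_, fun i hi j hj => ?_, fun i hi => ?_, hrow4⟩,
    fun j hj hj' i => ?_, ?_⟩
  · exact (hF4.v .q rfl).trans (by simpa using hq3)
  · exact (hF4.v .n rfl).trans (by simpa using hn3)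
  · exact (hF4.base rfl).trans (by simpa using hbase3)
  · have := mul_add_lt hi hj
    rw [St.tick_m, hm4 _ (by omega)]
    exact hQ i hi j hj
  · have := mul_add_lt hi hj
    rw [St.tick_m, hm4 _ (by omega)]
    exact hP i hi j hj
  · rw [St.tick_arr, hF4.arr rfl .rowQ rfl]
    simpa using hrow3 i hi
  · rw [St.tick_arr, hF4.arr rfl j (by cases j <;> first | rfl | exact absurd rfl hj')]
    simpa using harr3 j hj i
  · simp only [St.setv_clk] at *
    omega

theorem zeros_succ (i : ℕ) (f : ℕ → ℕ) :
    zeros (i + 1) f = zeros i f + if f i = 0 then 1 else 0 := by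
  rw [zeros, zeros, Finset.range_add_one, Finset.filter_insert]
  split_ifs
  · rw [Finset.card_insert_of_notMem (by simp)]
  · rfl

/-- An element that is unmatched as an upper element is the bottom of its chain, so `k` becomes the
number of chains. -/
theorem wp_listHeads {s : St} (hn : s.v .n = n) :
    listHeads.wp s fun s' => s'.v .k = zeros n (s.arr .prd) ∧
      (∀ c < s'.v .k, s'.arr .heads c < n) ∧
      (∀ h < n, s.arr .prd h = 0 → ∃ c < s'.v .k, s'.arr .heads c = h) ∧
      s'.clk ≤ s.clk + (5 * n + 3) := by
  refine wp_cons (wp_assign (wp_cons (wp_for n (fun i s₁ => s₁.v .k = zeros i (s.arr .prd) ∧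
      (∀ c < s₁.v .k, s₁.arr .heads c < i) ∧
      (∀ h < i, s.arr .prd h = 0 → ∃ c < s₁.v .k, s₁.arr .heads c = h)) 5 (by simp [zeros])
    (fun i s₁ hF _ _ => (hF.v .n rfl).trans (by simpa using hn)) ?_ ?_)))
  · rintro i s₁ hi hF ⟨hk, h1, h2⟩ hx
    have hprd : s₁.arr .prd = s.arr .prd := (hF.arr rfl .prd rfl).trans (by simp)
    refine wp_ite (fun h => ?_) (fun h => ?_)
    · simp only [Exp.eval_aget, Exp.eval_v, St.tick_v, St.tick_arr, hx, hprd, ne_eq] at h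
      refine wp_skip ?_
      simp only [St.tick_v, hx, St.setv_v, reduceCtorEq, if_false, hk, zeros_succ, if_neg h, ne_eq,
        not_false_eq_true, St.setv_arr, St.tick_arr, St.tick_clk, true_and, add_zero] at h1 h2 ⊢
      refine ⟨⟨fun c hc => (h1 c hc).trans (by omega), fun c hc hc0 => h2 c ?_ hc0⟩, by omega⟩
      rcases Nat.lt_succ_iff_lt_or_eq.1 hc with h3 | rfl
      · exact h3
      · exact absurd hc0 h
    · simp only [Exp.eval_aget, Exp.eval_v, St.tick_v, St.tick_arr, hx, hprd] at h
      refine wp_cons (wp_aset (wp_cons (wp_assign (wp_nil ?_))))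
      simp only [Exp.eval_v, Exp.eval_add, Exp.eval_c, St.aset_v, St.tick_v, hx, hk, St.setv_v,
        reduceCtorEq, if_false, if_true, zeros_succ, if_pos h, ne_eq, not_false_eq_true,
        St.setv_arr, St.aset_arr_self, St.tick_arr, St.setv_clk, St.aset_clk, St.tick_clk,
        true_and] at h1 h2 ⊢
      refine ⟨⟨fun c hc => ?_, fun c hc hc0 => ?_⟩, by omega⟩
      · by_cases h3 : c = zeros i (s.arr .prd)
        · simp [h3]
        · rw [Function.update_of_ne h3]
          exact (h1 c (by omega)).trans (by omega)
      · rcases Nat.lt_succ_iff_lt_or_eq.1 hc with h3 | rfl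
        · obtain ⟨d, hd, hd'⟩ := h2 c h3 hc0
          exact ⟨d, by omega, by rw [Function.update_of_ne (by omega), hd']⟩
        · exact ⟨_, Nat.lt_succ_self _, by simp⟩
  · rintro s₁ hF ⟨hk, h1, h2⟩ - hclk
    refine wp_nil ⟨hk, h1, h2, ?_⟩
    simp only [St.setv_clk] at hclk
    omega

theorem wp_power {s : St} {k : ℕ} (hq : s.v .q = q) (hk : s.v .k = k) :
    power.wp s fun s' => s'.v .total = k ^ q ∧ s'.clk ≤ s.clk + (q * (3 * k + 6) + 3) := by
  refine wp_cons (wp_assign (wp_cons (wp_for q (fun i s₁ => s₁.v .total = k ^ i) (3 * k + 6)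
    (by simp) (fun i s₁ hF _ _ => (hF.v .q rfl).trans (by simpa using hq)) ?_ ?_)))
  · rintro i s₁ hi hF htot hx
    have hk1 : s₁.v .k = k := (hF.v .k rfl).trans (by simpa using hk)
    refine wp_cons (wp_assign (wp_cons (wp_for k (fun j s₂ => s₂.v .aux = j * k ^ i) 3
      (by simp) (fun j s₂ hF2 _ _ => (hF2.v .k rfl).trans (by simpa using hk1)) ?_ ?_)))
    · rintro j s₂ hj hF2 haux hy
      have htot2 : s₂.v .total = k ^ i := (hF2.v .total rfl).trans (by simpa using htot)
      refine wp_assign ?_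
      simp [hy, haux, htot2, Nat.succ_mul]
    · rintro s₂ hF2 haux - hclk
      have hx2 : s₂.v .i = i := (hF2.v .i rfl).trans (by simpa using hx)
      refine wp_cons (wp_assign (wp_nil ?_))
      simp only [St.setv_v, reduceCtorEq, if_false, if_true, St.tick_v, hx2, Exp.eval_tick,
        Exp.eval_v, haux, St.setv_clk, St.tick_clk, true_and] at hclk ⊢
      refine ⟨by ring, by omega⟩
  · rintro s₁ hF htot - hclk
    refine wp_nil ⟨htot, ?_⟩
    simp only [St.setv_clk] at hclk
    omega

end

end RAM

namespace RAM

open Cmd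

/-! ### Trying one assignment of chains -/

/-- The candidate value of `a` is too small, because of `b`. -/
def smallTest : Exp :=
  let xa : Exp := .sub (.aget .ptr (.v .a)) (.c 1)
  let xb : Exp := .sub (.aget .ptr (.v .b)) (.c 1)
  .and (.not (.eq (.v .a) (.v .b)))
    (.or (.and (entryQ (.v .b) (.v .a)) (.not (.and (entryP xb xa) (.not (.eq xb xa)))))
      (.and (.not (entryQ (.v .b) (.v .a)))
        (.and (.not (entryQ (.v .a) (.v .b))) (entryP xa xb))))

/-- Look for an embedding that maps every `i` to the chain that starts in `heads (idx i)`: move the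
candidate values up along the chains, as long as one of them is too small. -/
def tryChains : Cmd :=
  block [for' .i (.v .q) (aset .ptr (.v .i) (.add (.aget .heads (.aget .idx (.v .i))) (.c 1))),
    assign .go (.c 1),
    loop (.v .go) (block [search (.v .q) (.v .q) smallTest,
      ite (.v .r)
        (block [assign .aux (.sub (.v .r) (.c 1)),
          assign .go (.aget .nxt (.sub (.aget .ptr (.v .aux)) (.c 1))),
          aset .ptr (.v .aux) (.v .go)])
        (block [assign .ans (.c 1), assign .go (.c 0)])])]

/-- Add one to the number with the digits `idx 0, …, idx (q - 1)` in base `k`. -/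
def increment : Cmd :=
  block [assign .carry (.c 1),
    for' .i (.v .q) (ite (.v .carry)
      (ite (.eq (.add (.aget .idx (.v .i)) (.c 1)) (.v .k)) (aset .idx (.v .i) (.c 0))
        (block [aset .idx (.v .i) (.add (.aget .idx (.v .i)) (.c 1)), assign .carry (.c 0)]))
      skip)]

section

variable {q n : ℕ} {leQ le : ℕ → ℕ → Prop}

/-- The array `ptr` holds candidates plus one, the format of `nxt`: an entry of `nxt` can be stored
directly, and 0 means that the chain is exhausted. -/
theorem eval_smallTest {s : St} (h : Ctx q n leQ le s) (ha : s.v .a < q) (hb : s.v .b < q)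
    (hx : ∀ i < q, s.arr .ptr i - 1 < n) :
    smallTest.eval s ≠ 0 ↔ TooSmall leQ le (fun i => s.arr .ptr i - 1) (s.v .a) (s.v .b) := by
  have h1 := h.eval_entryQ (e := .v .b) (f := .v .a) hb ha
  have h2 := h.eval_entryQ (e := .v .a) (f := .v .b) ha hb
  have h3 := h.eval_entryP (e := .sub (.aget .ptr (.v .b)) (.c 1))
    (f := .sub (.aget .ptr (.v .a)) (.c 1)) (by simpa using hx _ hb) (by simpa using hx _ ha)
  have h4 := h.eval_entryP (e := .sub (.aget .ptr (.v .a)) (.c 1))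
    (f := .sub (.aget .ptr (.v .b)) (.c 1)) (by simpa using hx _ ha) (by simpa using hx _ hb)
  simp only [smallTest, TooSmall, Ne, Exp.eval_and, Exp.eval_or, Exp.eval_not, Exp.eval_eq, not_not,
    Exp.eval_aget, Exp.eval_sub, Exp.eval_v, Exp.eval_c] at h1 h2 h3 h4 ⊢
  rw [h3, h4, h1, ← not_iff_comm.1 h1, ← not_iff_comm.1 h2, or_iff_not_and_not]

/-- While `go ≠ 0`, each candidate is on its chain at or below the image under every compatible
embedding. In case of success the candidates give some embedding, which is all that the decision
problem needs, so compatibility is not recorded. -/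
theorem wp_tryChains {s : St} {hd : ℕ → ℕ} (h : Ctx q n leQ le s) (hQ : NatOrder q leQ)
    (hP : NatOrder n le) (hM : IsMatching n le (s.arr .nxt) (s.arr .prd) 0)
    (hhd : ∀ i < q, hd i < n ∧ s.arr .heads (s.arr .idx i) = hd i) (hq : 0 < q) (hn : 0 < n) :
    tryChains.wp s fun s' =>
      ((s'.v .ans = 1 ∧ ∃ e, NatEmb q n leQ le e) ∨ (s'.v .ans = s.v .ans ∧
        ∀ e, NatEmb q n leQ le e → ¬ ∀ i < q, OnChain (s.arr .nxt) (hd i) (e i))) ∧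
      s'.clk ≤ s.clk + 60 * (q ^ 3 * n) := by
  refine wp_cons (wp_for q (fun i s₁ => ∀ i' < i, s₁.arr .ptr i' = hd i' + 1) 3 (by simp)
    (fun i s₁ hF _ _ => (hF.v .q rfl).trans h.hq) ?_ ?_)
  · intro i s₁ hi hF hI hx
    have hh : s₁.arr .heads = s.arr .heads := hF.arr rfl .heads rfl
    have hidx : s₁.arr .idx = s.arr .idx := hF.arr rfl .idx rfl
    refine wp_aset ?_
    simp only [Exp.eval_v, St.tick_v, hx, Exp.eval_add, Exp.eval_aget, St.tick_arr, hidx, hh,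
      (hhd i hi).2, Exp.eval_c, St.aset_v, ne_eq, reduceCtorEq, not_false_eq_true, St.setv_arr,
      St.aset_arr_self, St.aset_clk, St.tick_clk, true_and]
    refine ⟨fun i' hi' => ?_, by omega⟩
    by_cases h : i' = i
    · simp [h]
    · rw [Function.update_of_ne h, hI i' (by omega)]
  intro s₁ hF1 hI1 _ hclk1
  have hC1 := h.frame hF1 rfl
  have hnxt1 : s₁.arr .nxt = s.arr .nxt := hF1.arr rfl .nxt rfl
  have hans1 : s₁.v .ans = s.v .ans := hF1.v .ans rfl
  refine wp_cons (wp_assign (wp_cons ?_))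
  refine wp_loop (fun s₂ => (s₂.v .go ≠ 0 → s₂.v .ans = s.v .ans ∧ ∀ i < q, s₂.arr .ptr i - 1 < n ∧
      ∀ e, NatEmb q n leQ le e → (∀ i < q, OnChain (s.arr .nxt) (hd i) (e i)) →
        OnChain (s.arr .nxt) (s₂.arr .ptr i - 1) (e i)) ∧
      (s₂.v .go = 0 → ((s₂.v .ans = 1 ∧ ∃ e, NatEmb q n leQ le e) ∨ (s₂.v .ans = s.v .ans ∧
        ∀ e, NatEmb q n leQ le e → ¬ ∀ i < q, OnChain (s.arr .nxt) (hd i) (e i)))))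
    -- A move replaces one candidate by a strictly larger one, with fewer elements above it.
    (fun s₂ => if s₂.v .go = 0 then 0 else
      1 + ∑ i ∈ Finset.range q, numAbove n le (s₂.arr .ptr i - 1))
    (q * (q * 5 + 4) + 8) ?_ ?_ ?_
  · simp only [St.setv_v, St.setv_arr, St.tick_arr, ne_eq, reduceCtorEq, not_false_eq_true,
      if_true, if_false, Exp.eval_c, one_ne_zero, true_imp_iff, false_imp_iff, and_true, St.tick_v,
      hans1, true_and]
    intro i hi
    rw [hI1 i hi, Nat.add_sub_cancel]
    exact ⟨(hhd i hi).1, fun e _ he => he i hi⟩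
  · rintro s₂ hF2 ⟨hI, -⟩ hgo
    rw [Exp.eval_v] at hgo
    obtain ⟨hans2, hI⟩ := hI hgo
    have hC2 : Ctx q n leQ le s₂ := (hC1.tick.setv 1 rfl).frame hF2 rfl
    have hnxt2 : s₂.arr .nxt = s.arr .nxt := (hF2.arr rfl .nxt rfl).trans (by simpa using hnxt1)
    refine wp_cons (wp_search q q (TooSmall leQ le fun i => s₂.arr .ptr i - 1)
      (fun s₃ hF3 => (hF3.v .q rfl).trans hC2.hq)
      (fun s₃ hF3 => (hF3.v .q rfl).trans hC2.hq) (fun s₃ hF3 ha hb => ?_) ?_)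
    · have hp3 : s₃.arr .ptr = s₂.arr .ptr := hF3.arr rfl .ptr rfl
      have := eval_smallTest (hC2.tick.frame hF3 rfl) ha hb
        (fun i hi => by rw [hp3]; exact (hI i hi).1)
      rwa [hp3] at this
    · intro s₃ hF3 hres hclk3
      have hptr3 : s₃.arr .ptr = s₂.arr .ptr := hF3.arr rfl .ptr rfl
      have hnxt3 : s₃.arr .nxt = s.arr .nxt := (hF3.arr rfl .nxt rfl).trans hnxt2
      have hans3 : s₃.v .ans = s.v .ans := (hF3.v .ans rfl).trans hans2
      rw [St.tick_clk] at hclk3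
      rcases hres with ⟨hr0, hno⟩ | ⟨i, j, hi, hj, hT, hr1, -⟩
      · refine wp_cons (wp_ite (fun h => absurd hr0 h) fun _ => wp_cons (wp_assign (wp_cons
          (wp_assign (wp_nil (wp_nil ?_))))))
        simp only [St.setv_v, if_true, Exp.eval_c, reduceCtorEq, if_false, ne_eq, not_true,
          false_imp_iff, true_and, true_imp_iff, St.setv_clk, St.tick_clk, hgo]
        refine ⟨Or.inl ⟨_, natEmb_of_forall_not_tooSmall hQ hP (fun i hi => (hI i hi).1) hno⟩,
          by omega, by omega⟩
      · refine wp_cons (wp_ite (fun _ => ?_) fun h => absurd h (by simp [hr1]))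
        refine wp_cons (wp_assign (wp_cons (wp_assign (wp_cons (wp_aset (wp_nil (wp_nil ?_)))))))
        simp only [St.setv_v, Exp.eval_v, Exp.eval_sub, St.tick_v, hr1, Exp.eval_c,
          Nat.add_sub_cancel, Exp.eval_aget, if_true, reduceCtorEq, if_false, ne_eq,
          not_false_eq_true, St.setv_arr, St.tick_arr, hptr3, hnxt3, St.aset_v, St.aset_arr_self,
          hans3, true_and, St.aset_clk, St.setv_clk, St.tick_clk, hgo]
        -- By `TooSmall.ne` the image of `i` differs from the candidate, so the chain continues and
        -- the image is at or beyond the next element. In particular a chain that ends here excludes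
        -- `e`.
        have hadv : ∀ e, NatEmb q n leQ le e → (∀ i < q, OnChain (s.arr .nxt) (hd i) (e i)) →
            ∃ z, s.arr .nxt (s₂.arr .ptr i - 1) = z + 1 ∧ OnChain (s.arr .nxt) z (e i) :=
          fun e he hch => ((hI i hi).2 e he hch).of_ne (hT.ne hQ hP hM he (fun i hi => (hI i hi).1)
            (fun i hi => (hI i hi).2 e he hch) hi hj)
        refine ⟨⟨fun hne i' hi' => ?_, fun h0 => Or.inr fun e he hch => ?_⟩, ?_, by omega⟩
        · by_cases hii : i' = i
          · subst hii
            obtain ⟨z, hz⟩ := Nat.exists_eq_succ_of_ne_zero hne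
            rw [Nat.succ_eq_add_one] at hz
            rw [Function.update_self, hz, Nat.add_sub_cancel]
            refine ⟨(hM.nxt_spec (hI i' hi).1 hz).1, fun e he hch => ?_⟩
            obtain ⟨z', hz', hch'⟩ := hadv e he hch
            obtain rfl : z = z' := by omega
            exact hch'
          · rw [Function.update_of_ne hii]
            exact hI i' hi'
        · obtain ⟨z, hz, -⟩ := hadv e he hch
          omega
        · split_ifs with h0
          · omega
          · obtain ⟨z, hz⟩ := Nat.exists_eq_succ_of_ne_zero h0
            rw [Nat.succ_eq_add_one] at hz
            obtain ⟨h1, h2, h3, -⟩ := hM.nxt_spec (hI i hi).1 hz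
            have h4 := hP.numAbove_lt h2 h3
            refine Nat.add_lt_add_left (Finset.sum_lt_sum (fun i' _ => ?_)
              ⟨i, Finset.mem_range.2 hi, ?_⟩) 1
            · by_cases hii : i' = i
              · rw [hii, Function.update_self, hz, Nat.add_sub_cancel]
                exact h4.le
              · rw [Function.update_of_ne hii]
            · rw [Function.update_self, hz, Nat.add_sub_cancel]
              exact h4
  · rintro s₂ hF2 ⟨-, hI⟩ hgo hclk2
    refine wp_nil ⟨hI hgo, ?_⟩
    simp only [St.setv_v, if_true, Exp.eval_c, one_ne_zero, if_false, St.setv_clk] at hclk2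
    have h1 : (1 + ∑ i ∈ Finset.range q, numAbove n le
        ((s₁.tick.setv .go 1).arr .ptr i - 1)) ≤ 2 * (q * n) := by
      have : ∑ i ∈ Finset.range q, numAbove n le ((s₁.tick.setv .go 1).arr .ptr i - 1) ≤ q * n := by
        refine (Finset.sum_le_card_nsmul _ _ n fun i _ => numAbove_le _).trans ?_
        simp
      have : 0 < q * n := by positivity
      omega
    have h2 := Nat.mul_le_mul_right (q * (q * 5 + 4) + 8) h1
    -- The coefficients on the left sum to 43, and `q`, `n` are positive.
    have h3 : 2 * (q * n) * (q * (q * 5 + 4) + 8) + (3 * q + 6) ≤ 60 * (q ^ 3 * n) := by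
      obtain ⟨a, rfl⟩ := Nat.exists_eq_add_of_lt hq
      obtain ⟨b, rfl⟩ := Nat.exists_eq_add_of_lt hn
      ring_nf
      have : 0 ≤ a * b := by positivity
      have : 0 ≤ a ^ 2 * b := by positivity
      have : 0 ≤ a ^ 3 * b := by positivity
      nlinarith
    omega

/-- When one is added in base `k`, the carry reaches digit `i` exactly if `k ^ i` divides `t + 1`.
Here the digit is `k - 1` and overflows. -/
theorem digit_carry {k t i : ℕ} (h : k ^ i ∣ t + 1) (hd : t / k ^ i % k + 1 = k) :
    (t + 1) / k ^ i % k = 0 ∧ k ^ (i + 1) ∣ t + 1 := by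
  have h1 : k ∣ (t + 1) / k ^ i := by
    rw [Nat.succ_div, if_pos h]
    have := Nat.div_add_mod (t / k ^ i) k
    exact ⟨t / k ^ i / k + 1, by rw [mul_add]; omega⟩
  refine ⟨Nat.mod_eq_zero_of_dvd h1, ?_⟩
  rw [pow_succ]
  exact (Nat.dvd_div_iff_mul_dvd h).1 h1

/-- The carry reaches digit `i` and is absorbed there. -/
theorem digit_no_carry {k t i : ℕ} (hk : 0 < k) (h : k ^ i ∣ t + 1) (hd : t / k ^ i % k + 1 ≠ k) :
    (t + 1) / k ^ i % k = t / k ^ i % k + 1 ∧ ¬ k ^ (i + 1) ∣ t + 1 := by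
  have h0 := Nat.mod_lt (t / k ^ i) hk
  have h1 : (t + 1) / k ^ i % k = t / k ^ i % k + 1 := by
    rw [Nat.succ_div, if_pos h, Nat.add_mod, Nat.mod_eq_of_lt (a := 1) (by omega),
      Nat.mod_eq_of_lt (by omega)]
  refine ⟨h1, fun h2 => ?_⟩
  rw [pow_succ] at h2
  have h3 := Nat.mod_eq_zero_of_dvd ((Nat.dvd_div_iff_mul_dvd h).2 h2)
  omega

theorem digit_of_not_dvd {k t i : ℕ} (h : ¬ k ^ i ∣ t + 1) :
    (t + 1) / k ^ i % k = t / k ^ i % k ∧ ¬ k ^ (i + 1) ∣ t + 1 := by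
  refine ⟨by rw [Nat.succ_div, if_neg h, add_zero], fun h' => h ((pow_dvd_pow k ?_).trans h')⟩
  omega

/-- The invariant translates `carry` into divisibility of `t + 1` by `k ^ i`. A carry out of the
last digit is dropped, which does no harm as only `q` digits are compared. -/
theorem wp_increment {s : St} {k t : ℕ} (hq : s.v .q = q) (hk : s.v .k = k) (hk0 : 0 < k)
    (hidx : ∀ i < q, s.arr .idx i = t / k ^ i % k) :
    increment.wp s fun s' => (∀ i < q, s'.arr .idx i = (t + 1) / k ^ i % k) ∧
      s'.clk ≤ s.clk + (6 * q + 3) := by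
  refine wp_cons (wp_assign (wp_cons (wp_for q (fun i s₁ =>
    (∀ i' < i, s₁.arr .idx i' = (t + 1) / k ^ i' % k) ∧
    (∀ i' < q, i ≤ i' → s₁.arr .idx i' = t / k ^ i' % k) ∧
    (s₁.v .carry ≠ 0 ↔ k ^ i ∣ t + 1)) 6 (by simpa using hidx)
    (fun i s₁ hF _ _ => (hF.v .q rfl).trans (by simpa using hq)) ?_ ?_)))
  · rintro i s₁ hi hF ⟨h1, h2, h3⟩ hx
    have hk1 : s₁.v .k = k := (hF.v .k rfl).trans (by simpa using hk)
    have hd := h2 i hi le_rfl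
    refine wp_ite (fun hc => wp_ite (fun he => wp_aset ?_) (fun he => wp_cons (wp_aset (wp_cons
      (wp_assign (wp_nil ?_)))))) (fun hc => wp_skip ?_)
    · rw [Ne, Exp.eval_eq, not_not] at he
      simp only [Exp.eval_v, Exp.eval_add, Exp.eval_aget, Exp.eval_c, St.tick_v, St.tick_arr, hx,
        hd, hk1] at hc he
      obtain ⟨h4, h5⟩ := digit_carry (h3.1 hc) he
      simp only [Exp.eval_v, Exp.eval_c, St.tick_v, hx, St.aset_v, ne_eq, reduceCtorEq,
        not_false_eq_true, St.setv_arr, St.aset_arr_self, St.tick_arr, St.setv_v, if_false,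
        St.aset_clk, St.tick_clk, true_and, hc, true_iff]
      refine ⟨⟨fun i' hi' => ?_, fun i' hi' hii => ?_, h5⟩, by omega⟩
      · by_cases hii : i' = i
        · rw [hii, Function.update_self, h4]
        · rw [Function.update_of_ne hii, h1 i' (by omega)]
      · rw [Function.update_of_ne (by omega), h2 i' hi' (by omega)]
    · rw [Exp.eval_eq] at he
      simp only [Exp.eval_v, Exp.eval_add, Exp.eval_aget, Exp.eval_c, St.tick_v, St.tick_arr, hx,
        hd, hk1] at hc he
      obtain ⟨h4, h5⟩ := digit_no_carry hk0 (h3.1 hc) he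
      simp only [Exp.eval_v, Exp.eval_c, Exp.eval_add, Exp.eval_aget, St.tick_v, hx, St.aset_v,
        ne_eq, reduceCtorEq, not_false_eq_true, St.setv_arr, St.aset_arr_self, St.tick_arr,
        St.setv_v, if_false, if_true, St.aset_clk, St.setv_clk, St.tick_clk, true_and, not_true,
        false_iff, hd]
      refine ⟨⟨fun i' hi' => ?_, fun i' hi' hii => ?_, h5⟩, by omega⟩
      · by_cases hii : i' = i
        · rw [hii, Function.update_self, h4]
        · rw [Function.update_of_ne hii, h1 i' (by omega)]
      · rw [Function.update_of_ne (by omega), h2 i' hi' (by omega)]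
    · simp only [Exp.eval_v, St.tick_v] at hc
      obtain ⟨h4, h5⟩ := digit_of_not_dvd fun h => h3.2 h hc
      simp only [St.tick_v, hx, ne_eq, reduceCtorEq, not_false_eq_true, St.setv_arr, St.tick_arr,
        St.setv_v, if_false, St.tick_clk, true_and, hc, not_true, false_iff]
      refine ⟨⟨fun i' hi' => ?_, fun i' hi' hii => h2 i' hi' (by omega), h5⟩, by omega⟩
      by_cases hii : i' = i
      · rw [hii, h4, hd]
      · exact h1 i' (by omega)
  · rintro s₁ hF ⟨h1, -, -⟩ - hclk
    refine wp_nil ⟨h1, ?_⟩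
    simp only [St.setv_clk] at hclk
    omega

end

end RAM

namespace RAM

open Cmd

/-! ### Deciding the embedding problem -/

/-- Decide the embedding problem for nonempty orders. -/
def solveNonempty : Cmd :=
  block [setup, findMatching, listHeads, power, assign .ans (.c 0),
    -- The final assignment puts the answer into `base`, that is register 0.
    for' .t (.v .total) (block [tryChains, increment]), assign .base (.v .ans)]

/-- Decide the embedding problem. -/
def solve : Cmd :=
  block [assign .q (.get (.c 0)), assign .n (.get (.c 1)),
    ite (.v .q) (ite (.v .n) solveNonempty (assign .base (.c 0))) (assign .base (.c 1))]

section

variable {q n : ℕ} {leQ le : ℕ → ℕ → Prop}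

/-- Hence counting up to `k ^ q` visits every assignment of chains. -/
theorem exists_digits {k q : ℕ} {g : ℕ → ℕ} (hg : ∀ i < q, g i < k) :
    ∃ t < k ^ q, ∀ i < q, t / k ^ i % k = g i := by
  let f : Fin q → Fin k := fun i => ⟨g i, hg i i.2⟩
  refine ⟨finFunctionFinEquiv f, (finFunctionFinEquiv f).2, fun i hi => ?_⟩
  have h := finFunctionFinEquiv_symm_apply_val (finFunctionFinEquiv f) ⟨i, hi⟩
  rw [Equiv.symm_apply_apply] at h
  exact h.symm

/-- Every term is a multiple of `q ^ 4 * n ^ 4`, up to the factor `k ^ q ≤ w ^ q`. The assumption `k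
≤ n` serves the cost of computing the power, and `0 < k` gives `1 ≤ w ^ q`. -/
theorem solve_cost {q n k w : ℕ} (hq : 0 < q) (hn : 0 < n) (hkn : k ≤ n) (hkw : k ≤ w)
    (hk : 0 < k) :
    (7 * q + 7 * n + 12) + 200 * n ^ 4 + (5 * n + 3) + (q * (3 * k + 6) + 3) + 1 +
      (k ^ q * (60 * (q ^ 3 * n) + (6 * q + 3) + 3) + 2) + 1 ≤
    400 * (w ^ q * q ^ 4 * n ^ 4) := by
  have hq4 : 1 ≤ q ^ 4 := Nat.one_le_pow _ _ hq
  have hn4 : 1 ≤ n ^ 4 := Nat.one_le_pow _ _ hn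
  have h1 : q ≤ q ^ 4 * n ^ 4 := (Nat.le_self_pow (by decide) q).trans (Nat.le_mul_of_pos_right _ hn4)
  have h2 : n ≤ q ^ 4 * n ^ 4 := (Nat.le_self_pow (by decide) n).trans (Nat.le_mul_of_pos_left _ hq4)
  have h3 : n ^ 4 ≤ q ^ 4 * n ^ 4 := Nat.le_mul_of_pos_left _ hq4
  have h4 : q * k ≤ q ^ 4 * n ^ 4 :=
    Nat.mul_le_mul (Nat.le_self_pow (by decide) q) (hkn.trans (Nat.le_self_pow (by decide) n))
  have h5 : q ^ 3 * n ≤ q ^ 4 * n ^ 4 :=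
    Nat.mul_le_mul (Nat.pow_le_pow_right hq (by decide)) (Nat.le_self_pow (by decide) n)
  have h6 : 1 ≤ q ^ 4 * n ^ 4 := Nat.mul_pos hq4 hn4
  have h7 : k ^ q ≤ w ^ q := Nat.pow_le_pow_left hkw q
  have h8 : 1 ≤ w ^ q := Nat.one_le_pow _ _ (hk.trans_le hkw)
  have h9 : k ^ q * (60 * (q ^ 3 * n) + (6 * q + 3) + 3) ≤ w ^ q * (72 * (q ^ 4 * n ^ 4)) :=
    Nat.mul_le_mul h7 (by omega)
  have h10 : q ^ 4 * n ^ 4 ≤ w ^ q * (q ^ 4 * n ^ 4) := Nat.le_mul_of_pos_left _ h8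
  have h11 : q * (3 * k + 6) = 3 * (q * k) + 6 * q := by ring
  have h12 : w ^ q * (72 * (q ^ 4 * n ^ 4)) = 72 * (w ^ q * (q ^ 4 * n ^ 4)) := by ring
  rw [mul_assoc (w ^ q)]
  omega

theorem wp_solveNonempty {s : St} {w : ℕ} (hQo : NatOrder q leQ) (hPo : NatOrder n le)
    (hq : s.v .q = q) (hn : s.v .n = n) (hq0 : 0 < q) (hn0 : 0 < n)
    (hQ : ∀ i < q, ∀ j < q, (s.m (2 + i * q + j) ≠ 0 ↔ leQ i j))
    (hP : ∀ i < n, ∀ j < n, (s.m (2 + q * q + i * n + j) ≠ 0 ↔ le i j))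
    (h0 : ∀ a, 2 + q * q + n * n ≤ a → s.m a = 0)
    (hw : ∀ A : Finset ℕ, (∀ a ∈ A, a < n) → (∀ a ∈ A, ∀ b ∈ A, a ≠ b → ¬ le a b) → A.card ≤ w) :
    solveNonempty.wp s fun s' => ((∃ e, NatEmb q n leQ le e) → s'.v .base = 1) ∧
      ((¬ ∃ e, NatEmb q n leQ le e) → s'.v .base = 0) ∧
      s'.clk ≤ s.clk + 400 * (w ^ q * q ^ 4 * n ^ 4) := by
  refine wp_cons ((wp_setup hq hn hQ hP h0).mono ?_)
  rintro s₁ - ⟨hC1, harr, hclk1⟩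
  have hM0 : IsMatching n le (s₁.arr .nxt) (s₁.arr .prd) 0 := by
    constructor
    · intro a b _ h
      rw [harr .nxt (by decide) (by decide)] at h
      omega
    · intro a b _ h
      rw [harr .prd (by decide) (by decide)] at h
      omega
  refine wp_cons ((wp_findMatching hC1 hM0 hn0).mono ?_)
  rintro s₂ hF2 ⟨hM2, ⟨A, hA1, hA2, hA3⟩, hclk2⟩
  have hC2 := hC1.frame hF2 rfl
  have hidx2 : s₂.arr .idx = s₁.arr .idx := hF2.arr rfl .idx rfl
  refine wp_cons ((wp_listHeads hC2.hn).mono ?_)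
  rintro s₃ hF3 ⟨hk3, hheads3, hheads3', hclk3⟩
  have hC3 := hC2.frame hF3 rfl
  have hidx3 : s₃.arr .idx = s₁.arr .idx := (hF3.arr rfl .idx rfl).trans hidx2
  have hnxt3 : s₃.arr .nxt = s₂.arr .nxt := hF3.arr rfl .nxt rfl
  have hprd3 : s₃.arr .prd = s₂.arr .prd := hF3.arr rfl .prd rfl
  obtain ⟨k, hk⟩ : ∃ k, s₃.v .k = k := ⟨_, rfl⟩
  rw [hk] at hk3 hheads3 hheads3'
  have hkn : k ≤ n := hk3 ▸ zeros_le n _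
  -- The only place where the width enters: the number of chains is at most the size of an
  -- antichain.
  have hkw : k ≤ w := by rw [hk3]; exact hA3.trans (hw A hA1 hA2)
  -- The chain through the element 0 has a head. Positivity makes the digits in base `k` genuine
  -- indices of chains.
  have hk0 : 0 < k := by
    obtain ⟨h, h1, h2, -⟩ := hM2.exists_head hPo hn0
    obtain ⟨c, hc, -⟩ := hheads3' h h1 h2
    omega
  refine wp_cons ((wp_power hC3.hq hk).mono ?_)
  rintro s₄ hF4 ⟨htot4, hclk4⟩
  have hC4 := hC3.frame hF4 rfl
  have hidx4 : s₄.arr .idx = s₁.arr .idx := (hF4.arr rfl .idx rfl).trans hidx3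
  have hnxt4 : s₄.arr .nxt = s₂.arr .nxt := (hF4.arr rfl .nxt rfl).trans hnxt3
  have hprd4 : s₄.arr .prd = s₂.arr .prd := (hF4.arr rfl .prd rfl).trans hprd3
  have hheads4 : s₄.arr .heads = s₃.arr .heads := hF4.arr rfl .heads rfl
  have hk4 : s₄.v .k = k := (hF4.v .k rfl).trans hk
  let Compat (t : ℕ) (e : ℕ → ℕ) : Prop :=
    ∀ i < q, OnChain (s₂.arr .nxt) (s₃.arr .heads (t / k ^ i % k)) (e i)
  refine wp_cons (wp_assign (wp_cons (wp_for (k ^ q)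
    (fun t s₅ => (∀ i < q, s₅.arr .idx i = t / k ^ i % k) ∧
      ((s₅.v .ans = 1 ∧ ∃ e, NatEmb q n leQ le e) ∨ (s₅.v .ans = 0 ∧
        ∀ e, NatEmb q n leQ le e → ∀ t' < t, ¬ Compat t' e)))
    (60 * (q ^ 3 * n) + (6 * q + 3) + 3) ?_
    (fun t s₅ hF _ _ => (hF.v .total rfl).trans (by simpa using htot4)) ?_ ?_)))
  · simp only [ne_eq, reduceCtorEq, not_false_eq_true, St.setv_arr, Nat.zero_div, Nat.zero_mod,
      St.setv_v, if_false, if_true, Exp.eval_c, Nat.not_lt_zero, false_imp_iff, implies_true,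
      and_true]
    exact ⟨fun i _ => by rw [hidx4, harr .idx (by decide) (by decide)], Or.inr trivial⟩
  · rintro t s₅ ht hF5 ⟨hidx5, hans5⟩ hx
    have hC5 : Ctx q n leQ le s₅ := (hC4.setv 0 rfl).frame hF5 rfl
    have hnxt5 : s₅.arr .nxt = s₂.arr .nxt := (hF5.arr rfl .nxt rfl).trans (by simpa using hnxt4)
    have hprd5 : s₅.arr .prd = s₂.arr .prd := (hF5.arr rfl .prd rfl).trans (by simpa using hprd4)
    have hheads5 : s₅.arr .heads = s₃.arr .heads :=
      (hF5.arr rfl .heads rfl).trans (by simpa using hheads4)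
    have hk5 : s₅.v .k = k := (hF5.v .k rfl).trans (by simpa using hk4)
    refine wp_cons ((wp_tryChains (hd := fun i => s₃.arr .heads (t / k ^ i % k)) hC5.tick hQo hPo
      (by simpa [hnxt5, hprd5] using hM2) (fun i hi => ⟨hheads3 _ (Nat.mod_lt _ hk0), ?_⟩)
      hq0 hn0).mono ?_)
    · simp [hidx5 i hi, hheads5]
    · rintro s₆ hF6 ⟨hres, hclk6⟩
      have hC6 := hC5.tick.frame hF6 rfl
      simp only [St.tick_v, St.tick_arr, St.tick_clk, hnxt5] at hres hclk6
      refine wp_cons ((wp_increment (t := t) hC6.hq ((hF6.v .k rfl).trans hk5) hk0 ?_).mono ?_)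
      · rw [hF6.arr rfl .idx rfl]
        exact hidx5
      · rintro s₇ hF7 ⟨hidx7, hclk7⟩
        have hans7 : s₇.v .ans = s₆.v .ans := hF7.v .ans rfl
        refine wp_nil ⟨(hF7.v .t rfl).trans ((hF6.v .t rfl).trans hx), ?_, by omega⟩
        simp only [ne_eq, reduceCtorEq, not_false_eq_true, St.setv_arr, St.setv_v, if_false, hans7]
        refine ⟨hidx7, ?_⟩
        rcases hres with h | ⟨h1, h2⟩
        · exact Or.inl h
        · rw [h1]
          rcases hans5 with h3 | ⟨h3, h4⟩
          · exact Or.inl h3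
          · refine Or.inr ⟨h3, fun e he t' ht' => ?_⟩
            rcases Nat.lt_succ_iff_lt_or_eq.1 ht' with h5 | rfl
            · exact h4 e he t' h5
            · exact h2 e he
  · rintro s₅ hF5 ⟨-, hans5⟩ - hclk5
    refine wp_cons (wp_assign (wp_nil ?_))
    simp only [Exp.eval_v, St.setv_v, if_true, St.setv_clk] at hclk5 ⊢
    have hcost := solve_cost hq0 hn0 hkn hkw hk0
    refine ⟨fun ⟨e, he⟩ => ?_, fun hne => ?_, by omega⟩
    · rcases hans5 with h | ⟨-, h⟩
      · exact h.1
      -- The chains cover everything, so an embedding is compatible with the assignment of some `t <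
      -- k ^ q`, which was tried.
      · have hex : ∀ i, ∃ c, i < q → c < k ∧ OnChain (s₂.arr .nxt) (s₃.arr .heads c) (e i) := by
          intro i
          by_cases hi : i < q
          · obtain ⟨x, h1, h2, h3⟩ := hM2.exists_head hPo (he i hi).1
            obtain ⟨c, hc, rfl⟩ := hheads3' x h1 h2
            exact ⟨c, fun _ => ⟨hc, h3⟩⟩
          · exact ⟨0, fun h => absurd h hi⟩
        choose g hg using hex
        obtain ⟨t, ht, hgt⟩ := exists_digits (k := k) fun i hi => (hg i hi).1
        exact absurd (fun i hi => by rw [hgt i hi]; exact (hg i hi).2) (h e he t ht)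
    · rcases hans5 with h | ⟨h, -⟩
      · exact absurd h.2 hne
      · exact h

end

end RAM

/-! ### Entries of matrices listed row by row -/

theorem getD_ofFn_divNat_modNat {m n : ℕ} (g : Fin m → Fin n → ℕ) {i j : ℕ} (hi : i < m)
    (hj : j < n) : (List.ofFn fun t : Fin (m * n) => g t.divNat t.modNat).getD (i * n + j) 0 =
      g ⟨i, hi⟩ ⟨j, hj⟩ := by
  have hlt := RAM.mul_add_lt hi hj
  rw [List.getD_eq_getElem _ _ (by simpa using hlt), List.getElem_ofFn]
  congr 1
  · ext
    simp only [Fin.coe_divNat]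
    rw [mul_comm, Nat.mul_add_div (by omega), Nat.div_eq_of_lt hj, add_zero]
  · ext
    simp only [Fin.coe_modNat]
    rw [mul_comm, Nat.mul_add_mod, Nat.mod_eq_of_lt hj]

/-! ### Finite posets as orders on natural numbers -/

namespace FinPoset

/-- The order of `P`, as a relation between the labels. -/
def natLe (P : FinPoset) (i j : ℕ) : Prop :=
  ∃ (hi : i < P.size) (hj : j < P.size), P.label.symm ⟨i, hi⟩ ≤ P.label.symm ⟨j, hj⟩

variable (P : FinPoset)

theorem natOrder : NatOrder P.size P.natLe where
  bound := fun ⟨hi, hj, _⟩ => ⟨hi, hj⟩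
  refl := fun hi => ⟨hi, hi, le_rfl⟩
  trans := fun ⟨hi, _, h⟩ ⟨_, hk, h'⟩ => ⟨hi, hk, h.trans h'⟩
  antisymm := fun ⟨_, _, h⟩ ⟨_, _, h'⟩ => by simpa using le_antisymm h h'

theorem natLe_label (a b : P) : P.natLe (P.label a) (P.label b) ↔ a ≤ b := by
  simp [natLe]

theorem exists_natEmb_iff (Q P : FinPoset) :
    (∃ e, NatEmb Q.size P.size Q.natLe P.natLe e) ↔ Nonempty (Q ↪o P) := by
  constructor
  · rintro ⟨e, he⟩
    refine ⟨OrderEmbedding.ofMapLEIff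
      (fun a => P.label.symm ⟨e (Q.label a), (he _ (Q.label a).2).1⟩) fun a b => ?_⟩
    rw [← natLe_label, ← natLe_label Q, (he _ (Q.label a).2).2 _ (Q.label b).2]
    simp
  · rintro ⟨e⟩
    refine ⟨fun i => if h : i < Q.size then P.label (e (Q.label.symm ⟨i, h⟩)) else 0,
      fun i hi => ⟨by simp [hi], fun j hj => ?_⟩⟩
    simp only [hi, hj, dif_pos, natLe_label, e.le_iff_le]
    exact ⟨fun ⟨_, _, h⟩ => h, fun h => ⟨hi, hj, h⟩⟩

theorem card_le_width {A : Finset ℕ} (hA : ∀ a ∈ A, a < P.size)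
    (hA' : ∀ a ∈ A, ∀ b ∈ A, a ≠ b → ¬ P.natLe a b) : A.card ≤ P.width := by
  classical
  have : Fintype P := Fintype.ofEquiv _ P.label.symm
  let f : A → P := fun a => P.label.symm ⟨a, hA a a.2⟩
  have hf : Function.Injective f := by
    intro a b h
    exact Subtype.ext (Fin.mk.inj_iff.1 (P.label.symm.injective h))
  -- Boundedness is essential, since the supremum of an unbounded set of natural numbers is 0.
  refine le_csSup ⟨Fintype.card P, ?_⟩ ⟨Finset.univ.image f, ?_, ?_⟩
  · rintro k ⟨B, -, rfl⟩
    exact Finset.card_le_univ B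
  · intro x hx y hy hne hle
    obtain ⟨a, -, rfl⟩ := Finset.mem_image.1 (Finset.mem_coe.1 hx)
    obtain ⟨b, -, rfl⟩ := Finset.mem_image.1 (Finset.mem_coe.1 hy)
    refine hA' a a.2 b b.2 (fun h => hne ?_) ⟨hA a a.2, hA b b.2, hle⟩
    rw [Subtype.ext h]
  · rw [Finset.card_image_of_injective _ hf, Finset.card_univ, Fintype.card_coe]

@[simp] theorem length_matrix : P.matrix.length = P.size * P.size := by
  simp [matrix]

open Classical in
theorem getD_matrix {i j : ℕ} (hi : i < P.size) (hj : j < P.size) :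
    P.matrix.getD (i * P.size + j) 0 = if P.natLe i j then 1 else 0 := by
  rw [matrix, getD_ofFn_divNat_modNat
    (fun a b => if P.label.symm a ≤ P.label.symm b then 1 else 0) hi hj]
  congr 1
  exact propext ⟨fun h => ⟨hi, hj, h⟩, fun ⟨_, _, h⟩ => h⟩

end FinPoset

/-! ### Deciding encoded instances, and fixed-parameter tractability -/

namespace RAM

open Cmd

theorem wp_solve (Q P : FinPoset) :
    solve.wp (St.start (embeddingProblem.encode (Q, P))) fun s' =>
      (Nonempty (Q ↪o P) → s'.v .base = 1) ∧ (¬ Nonempty (Q ↪o P) → s'.v .base = 0) ∧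
      s'.clk ≤ 400 * (P.width ^ Q.size * Q.size ^ 4 * P.size ^ 4 + 1) := by
  have hm : (St.start (embeddingProblem.encode (Q, P))).m =
      fun i => ([Q.size, P.size] ++ (Q.matrix ++ P.matrix)).getD i 0 := by
    simp [St.start, embeddingProblem]
  have hclk : (St.start (embeddingProblem.encode (Q, P))).clk = 0 := rfl
  obtain ⟨s, hs⟩ : ∃ s, s = St.start (embeddingProblem.encode (Q, P)) := ⟨_, rfl⟩
  rw [← hs] at hm hclk ⊢
  have hq : s.m 0 = Q.size := by simp [hm]
  have hn : s.m 1 = P.size := by simp [hm]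
  have hQ : ∀ i < Q.size, ∀ j < Q.size, (s.m (2 + i * Q.size + j) ≠ 0 ↔ Q.natLe i j) := by
    intro i hi j hj
    have hlt := mul_add_lt hi hj
    have h := Q.getD_matrix hi hj
    rw [hm]
    dsimp only
    rw [List.getD_append_right _ _ _ _ (by simp [add_assoc]), List.getD_append _ _ _ _ (by
      simp only [List.length_cons, List.length_nil, FinPoset.length_matrix]; omega),
      show 2 + i * Q.size + j - [Q.size, P.size].length = i * Q.size + j by simp; omega, h]
    simp
  have hP : ∀ i < P.size, ∀ j < P.size,
      (s.m (2 + Q.size * Q.size + i * P.size + j) ≠ 0 ↔ P.natLe i j) := by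
    intro i hi j hj
    have h := P.getD_matrix hi hj
    rw [hm]
    dsimp only
    rw [List.getD_append_right _ _ _ _ (by simp [add_assoc]), List.getD_append_right _ _ _ _ (by
      simp only [List.length_cons, List.length_nil, FinPoset.length_matrix]; omega),
      show 2 + Q.size * Q.size + i * P.size + j - [Q.size, P.size].length - Q.matrix.length =
        i * P.size + j by simp; omega, h]
    simp
  have h0 : ∀ a, 2 + Q.size * Q.size + P.size * P.size ≤ a → s.m a = 0 := by
    intro a ha
    rw [hm]
    refine List.getD_eq_default _ _ ?_
    simp only [List.length_append, List.length_cons, List.length_nil, FinPoset.length_matrix]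
    omega
  -- If `Q` or `P` is empty, the product in the time bound is 0 and the summand 1 pays for
  -- everything. Emptiness of `Q` is tested first, because the empty poset embeds even into the
  -- empty poset.
  refine wp_cons (wp_assign (wp_cons (wp_assign (wp_cons (wp_ite (fun hq0 => wp_ite (fun hn0 => ?_)
    fun hn0 => wp_assign (wp_nil ?_)) fun hq0 => wp_assign (wp_nil ?_))))))
  · simp [hq] at hq0
    simp [hn] at hn0
    refine wp.mono (wp_solveNonempty (w := P.width) Q.natOrder P.natOrder (by simp [hq]) (by simp [hn])
      (Nat.pos_of_ne_zero hq0) (Nat.pos_of_ne_zero hn0) hQ hP h0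
      (fun A h1 h2 => P.card_le_width h1 h2)) ?_
    rintro s' - ⟨h1, h2, h3⟩
    rw [FinPoset.exists_natEmb_iff] at h1 h2
    simp only [St.tick_clk, St.setv_clk, hclk] at h3
    exact wp_nil ⟨h1, h2, by omega⟩
  · simp [hq] at hq0
    simp [hn] at hn0
    have : ¬ Nonempty (Q ↪o P) := fun ⟨e⟩ => by
      have := (P.label (e (Q.label.symm ⟨0, by omega⟩))).2
      omega
    simp [this, hclk]
    omega
  · simp [hq] at hq0
    have : IsEmpty Q := ⟨fun a => by have := (Q.label a).2; omega⟩
    have : Nonempty (Q ↪o P) := ⟨OrderEmbedding.ofIsEmpty⟩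
    simp [this, hclk]
    omega

theorem exists_decides : ∃ (A : Program) (K : ℕ), ∀ Q P : FinPoset,
    A.DecidesWithin (embeddingProblem.encode (Q, P)) (Nonempty (Q ↪o P))
      (K * (P.width ^ Q.size * Q.size ^ 4 * P.size ^ 4 + 1)) := by
  refine ⟨solve.code 0, (solve.code 0).length * 400, fun Q P => ?_⟩
  obtain ⟨s, hs, h1, h2, h3⟩ := wp_solve Q P
  obtain ⟨t, ht, hh, hr⟩ := hs.halts
  refine ⟨t, ht.trans ?_, hh, fun hy => ?_, fun hy => ?_⟩
  · rw [mul_assoc]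
    exact Nat.mul_le_mul_left _ h3
  · exact (hr.1 .base).trans (h1 hy)
  · exact (hr.1 .base).trans (h2 hy)

theorem embeddingProblem_fixedParameterTractable :
    embeddingProblem.FixedParameterTractable := by
  obtain ⟨A, K, h⟩ := exists_decides
  -- The exponent 4 comes from `|P| ^ 4`, as `|P|` is at most the length of the input; the remaining
  -- factors depend only on the parameter.
  refine ⟨A, fun x => K * (x.1 ^ x.2 * x.2 ^ 4 + 1), 4, ?_, fun ⟨Q, P⟩ => ?_⟩
  · have hpow : Primrec₂ fun a b : ℕ => a ^ b := by
      refine (Primrec.nat_rec' (f := fun p : ℕ × ℕ => p.2) (g := fun _ => 1)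
        (h := fun p q => q.2 * p.1) Primrec.snd (Primrec.const 1) ?_).of_eq fun p => ?_
      · exact Primrec.nat_mul.comp₂ (Primrec.snd.comp₂ Primrec₂.right)
          (Primrec.fst.comp₂ Primrec₂.left)
      · induction p.2 with
        | zero => rfl
        | succ b ih => simp [pow_succ, ← ih]
    refine Primrec.to_comp ?_
    refine Primrec.nat_mul.comp (Primrec.const K) (Primrec.succ.comp (Primrec.nat_mul.comp
      (hpow.comp Primrec.fst Primrec.snd) (hpow.comp Primrec.snd (Primrec.const 4))))
  · obtain ⟨t, ht, hres⟩ := h Q P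
    refine ⟨t, ht.trans ?_, hres⟩
    have hlen : P.size ≤ (embeddingProblem.encode (Q, P)).length ∧
        1 ≤ (embeddingProblem.encode (Q, P)).length := by
      have := Nat.le_mul_self P.size
      simp only [embeddingProblem, List.length_append, FinPoset.length_matrix, List.length_cons,
        List.length_nil]
      omega
    change _ ≤ K * (P.width ^ Q.size * Q.size ^ 4 + 1) * _
    rw [mul_assoc K]
    refine Nat.mul_le_mul_left K ?_
    rw [add_mul, one_mul]
    exact Nat.add_le_add (Nat.mul_le_mul_left _ (Nat.pow_le_pow_left hlen.1 4))
      (Nat.one_le_pow _ _ hlen.2)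

end RAM

namespace RAM

open Cmd

/-! ### Writing a list to the memory -/

/-- Append the value of `e` to the output. -/
def emit (e : Exp) : Cmd := seq (store (.v .out) e) (assign .out (.add (.v .out) (.c 1)))

def St.emit (s : St) (x : ℕ) : St := (s.sto (s.v .out) x).setv .out (s.v .out + 1)

theorem wp_emit {e : Exp} {s : St} {R : St → Prop} (h : R (s.emit (e.eval s))) :
    (emit e).wp s R :=
  wp_seq (wp_store (wp_assign h))

@[simp] theorem St.emit_v (s : St) (x : ℕ) (y : Var) :
    (s.emit x).v y = if y = .out then s.v .out + 1 else s.v y := by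
  simp [St.emit]

@[simp] theorem St.emit_clk (s : St) (x : ℕ) : (s.emit x).clk = s.clk + 2 := rfl

/-- The input `inp` is in the memory below the address `B`, and the output list `L` is from `B`
on. -/
structure Out (inp : ℕ → ℕ) (B : ℕ) (L : List ℕ) (s : St) : Prop where
  base : s.v .base = B
  out : s.v .out = B + L.length
  input : ∀ i < B, s.m i = inp i
  output : ∀ i < L.length, s.m (B + i) = L.getD i 0

section

variable {inp : ℕ → ℕ} {B : ℕ} {L L' : List ℕ} {s s' : St}

theorem Out.congr (h : Out inp B L s) (hb : s'.v .base = s.v .base) (ho : s'.v .out = s.v .out)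
    (hm : s'.m = s.m) : Out inp B L s' :=
  ⟨hb.trans h.base, ho.trans h.out, hm ▸ h.input, hm ▸ h.output⟩

theorem Out.tick (h : Out inp B L s) : Out inp B L s.tick := h.congr rfl rfl rfl

theorem Out.setv (h : Out inp B L s) {x : Var} (hb : Var.base ≠ x) (ho : Var.out ≠ x) (n : ℕ) :
    Out inp B L (s.setv x n) := h.congr (by simp [hb]) (by simp [ho]) rfl

theorem Out.emit (h : Out inp B L s) (x : ℕ) : Out inp B (L ++ [x]) (s.emit x) := by
  refine ⟨by simp [h.base], by simp [h.out, add_assoc], fun i hi => ?_, fun i hi => ?_⟩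
  · simp only [St.emit, St.setv_m, St.sto_m, h.out]
    rw [if_neg (by omega), h.input i hi]
  · simp only [St.emit, St.setv_m, St.sto_m, h.out]
    simp only [List.length_append, List.length_singleton] at hi
    by_cases h' : i = L.length
    · subst h'
      simp
    · rw [if_neg (by omega), h.output i (by omega), List.getD_append _ _ _ _ (by omega)]

/-- The numbers of tuples and of constraints precede the lists that they count, but are known only
afterwards. So a placeholder 0 is written first and overwritten later. -/
theorem Out.patch {x : ℕ} (h : Out inp B (L ++ x :: L') s) {a : ℕ} (ha : a = B + L.length)
    (y : ℕ) : Out inp B (L ++ y :: L') (s.sto a y) := by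
  subst ha
  refine ⟨h.base, by simpa using h.out, fun i hi => ?_, fun i hi => ?_⟩
  · rw [St.sto_m, if_neg (by omega), h.input i hi]
  · have h1 := h.output i (by simpa using hi)
    rw [St.sto_m]
    rcases lt_trichotomy i L.length with h' | rfl | h'
    · rw [if_neg (by omega), h1, List.getD_append _ _ _ _ h', List.getD_append _ _ _ _ h']
    · rw [if_pos rfl, List.getD_append_right _ _ _ _ le_rfl, Nat.sub_self, List.getD_cons_zero]
    · obtain ⟨d, rfl⟩ := Nat.exists_eq_add_of_lt h'
      rw [if_neg (by omega), h1, List.getD_append_right _ _ _ _ (by omega),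
        List.getD_append_right _ _ _ _ (by omega),
        show L.length + d + 1 - L.length = d + 1 by omega, List.getD_cons_succ,
        List.getD_cons_succ]

end

/-! ### Computing the constraint satisfaction problem of an assignment of chains -/

/-- Compute in `x` the address of the row of the chain matrix for the chain of the element `y`. -/
def chainRow (x y : Var) : Cmd :=
  block [assign x (.v .cb),
    for' .t (.get (.add (.v .fb) (.v y))) (assign x (.add (.v x) (.v .n)))]

/-- Write the constraint that the value of `i` is in the chain of `i`. -/
def emitDomain : Cmd :=
  block [chainRow .ci .i, emit (.c 1), emit (.v .i), assign .slot (.v .out), emit (.c 0),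
    assign .cnt (.c 0),
    for' .a (.v .n) (ite (.get (.add (.v .ci) (.v .a)))
      (block [emit (.v .a), assign .cnt (.add (.v .cnt) (.c 1))]) skip),
    store (.v .slot) (.v .cnt), assign .num (.add (.v .num) (.c 1))]

/-- Is `(a, b)` in the relation of the constraint for `i` and `j`? -/
def orderTest : Exp :=
  .and (.get (.add (.v .ci) (.v .a))) (.and (.get (.add (.v .cj) (.v .b)))
    (.and (.eq (.get (.add (.v .rowA) (.v .b))) (.get (.add (.v .rowI) (.v .j))))
      (.eq (.get (.add (.v .rowB) (.v .a))) (.get (.add (.v .rowJ) (.v .i))))))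

/-- Write the constraint for the pair of `i` and `j`. -/
def emitOrder : Cmd :=
  block [chainRow .cj .j, emit (.c 2), emit (.v .i), emit (.v .j), assign .slot (.v .out),
    emit (.c 0), assign .cnt (.c 0), assign .rowA (.v .pb),
    for' .a (.v .n) (block [assign .rowB (.v .pb),
      for' .b (.v .n) (block [ite orderTest
        (block [emit (.v .a), emit (.v .b), assign .cnt (.add (.v .cnt) (.c 1))]) skip,
        assign .rowB (.add (.v .rowB) (.v .n))]),
      assign .rowA (.add (.v .rowA) (.v .n))]),
    store (.v .slot) (.v .cnt), assign .num (.add (.v .num) (.c 1))]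

/-- The first `B` cells of `inp` encode two orders, a membership matrix and an assignment of chains. -/
structure CspCtx (q n k : ℕ) (leQ le chain : ℕ → ℕ → Prop) (f : ℕ → ℕ) (inp : ℕ → ℕ) (B : ℕ) :
    Prop where
  hB : B = 3 + q * q + n * n + k * n + q
  kn : k ≤ n
  fk : ∀ i < q, f i < k
  inpQ : ∀ i < q, ∀ j < q, (inp (3 + i * q + j) ≤ 1 ∧ (inp (3 + i * q + j) = 1 ↔ leQ i j))
  inpP : ∀ i < n, ∀ j < n,
    (inp (3 + q * q + i * n + j) ≤ 1 ∧ (inp (3 + q * q + i * n + j) = 1 ↔ le i j))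
  inpC : ∀ c < k, ∀ a < n, (inp (3 + q * q + n * n + c * n + a) ≠ 0 ↔ chain c a)
  inpF : ∀ i < q, inp (3 + q * q + n * n + k * n + i) = f i

/-- The values of the variables that hold the sizes and addresses of the parts of the input. -/
structure Layout (q n k : ℕ) (s : St) : Prop where
  hq : s.v .q = q
  hn : s.v .n = n
  hk : s.v .k = k
  pb : s.v .pb = 3 + q * q
  cb : s.v .cb = 3 + q * q + n * n
  fb : s.v .fb = 3 + q * q + n * n + k * n

section

variable {q n k : ℕ} {leQ le chain : ℕ → ℕ → Prop} {f : ℕ → ℕ} {inp : ℕ → ℕ} {B : ℕ}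

theorem Layout.frame {c : Cmd} {s s' : St} (h : Layout q n k s) (F : Frame c s s')
    (hc : (c.writes .q || c.writes .n || c.writes .k || c.writes .pb || c.writes .cb ||
      c.writes .fb) = false) : Layout q n k s' := by
  simp only [Bool.or_eq_false_iff] at hc
  obtain ⟨⟨⟨⟨⟨h1, h2⟩, h3⟩, h4⟩, h5⟩, h6⟩ := hc
  exact ⟨(F.v _ h1).trans h.hq, (F.v _ h2).trans h.hn, (F.v _ h3).trans h.hk,
    (F.v _ h4).trans h.pb, (F.v _ h5).trans h.cb, (F.v _ h6).trans h.fb⟩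

/-- The product `f i * n` is formed by repeated addition; `f i < k ≤ n` keeps this linear in `n`.
The loop bound is read from memory in each round, so the invariant records that memory is unchanged.
-/
theorem wp_chainRow {s : St} {x y : Var} {i : ℕ} {L : List ℕ} (hC : CspCtx q n k leQ le chain f inp B)
    (hL : Layout q n k s) (hO : Out inp B L s) (hi : i < q) (hy : s.v y = i)
    (hx : x ∉ [.t, .fb, .n, .base, .out]) (hxy : x ≠ y) (hyt : y ≠ .t) :
    (chainRow x y).wp s fun s' => s'.v x = 3 + q * q + n * n + f i * n ∧ Out inp B L s' ∧
      s'.clk ≤ s.clk + (3 * n + 3) := by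
  have hfi : s.m (3 + q * q + n * n + k * n + i) = f i := by
    rw [hO.input _ (by rw [hC.hB]; omega), hC.inpF i hi]
  have hfn : f i ≤ n := (hC.fk i hi).le.trans hC.kn
  simp only [List.mem_cons, List.not_mem_nil, or_false, not_or] at hx
  obtain ⟨hxt, hxfb, hxn, hxb, hxo⟩ := hx
  refine wp_cons (wp_assign (wp_cons (wp_for (f i) (fun t s₁ => s₁.m = s.m ∧
    s₁.v x = 3 + q * q + n * n + t * n) 3 (by simp [hL.cb, hxt]) (fun t s₁ hF hI _ => ?_) ?_ ?_)))
  · have h1 : s₁.v .fb = _ := (hF.v .fb (by simp [for', writes, hxfb])).trans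
      (by simpa [Ne.symm hxfb] using hL.fb)
    have h2 : s₁.v y = _ := (hF.v y (by simp [for', writes, hxy, Ne.symm hyt])).trans
      (by simpa [Ne.symm hxy] using hy)
    simp [h1, h2, hI.1, hfi]
  · rintro t s₁ ht hF ⟨hm, hv⟩ hvt
    have h1 : s₁.v .n = _ := (hF.v .n (by simp [for', writes, hxn])).trans
      (by simpa [Ne.symm hxn] using hL.hn)
    refine wp_assign ?_
    simp [hvt, hm, hv, h1, hxt, Ne.symm hxt, Nat.succ_mul, add_assoc]
  · rintro s₁ hF ⟨hm, hv⟩ - hclk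
    refine wp_nil ⟨hv, hO.congr ((hF.v .base (by simp [for', writes, hxb])).trans
      (by simp [Ne.symm hxb])) ((hF.v .out (by simp [for', writes, hxo])).trans
      (by simp [Ne.symm hxo])) hm, ?_⟩
    simp only [St.setv_clk] at hclk
    omega

open Classical in
/-- The tuples of the unary constraint for `i`. -/
noncomputable def domainTuples (n : ℕ) (chain : ℕ → ℕ → Prop) (f : ℕ → ℕ) (i : ℕ) :
    List (List ℕ) :=
  (List.range n).flatMap fun a => if chain (f i) a then [[a]] else []

open Classical in
/-- The tuples of the binary constraint for `i` and `j`. -/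
noncomputable def orderTuples (n : ℕ) (leQ le chain : ℕ → ℕ → Prop) (f : ℕ → ℕ) (i j : ℕ) :
    List (List ℕ) :=
  (List.range n).flatMap fun a => (List.range n).flatMap fun b =>
    if chain (f i) a ∧ chain (f j) b ∧ (le a b ↔ leQ i j) ∧ (le b a ↔ leQ j i) then [[a, b]] else []

/-- The invariant keeps the list `T` of tuples unflattened: the output is its flattening, while
`cnt` is its length. -/
theorem wp_emitDomain {s : St} {i c : ℕ} {L : List ℕ} (hC : CspCtx q n k leQ le chain f inp B)
    (hL : Layout q n k s) (hO : Out inp B L s) (hi : i < q) (hvi : s.v .i = i)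
    (hnum : s.v .num = c) :
    emitDomain.wp s fun s' =>
      Out inp B (L ++ ([1, i, (domainTuples n chain f i).length] ++
        (domainTuples n chain f i).flatten)) s' ∧
      s'.v .num = c + 1 ∧ s'.clk ≤ s.clk + (9 * n + 15) := by
  classical
  refine wp_cons ((wp_chainRow hC hL hO hi hvi (by decide) (by decide) (by decide)).mono ?_)
  rintro s₁ hF1 ⟨hci1, hO1, hclk1⟩
  have hL1 := hL.frame hF1 rfl
  have hvi1 : s₁.v .i = i := (hF1.v .i rfl).trans hvi
  have hnum1 : s₁.v .num = c := (hF1.v .num rfl).trans hnum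
  refine wp_cons (wp_emit (wp_cons (wp_emit (wp_cons (wp_assign (wp_cons (wp_emit (wp_cons
    (wp_assign (wp_cons ?_))))))))))
  have hO2 := (((hO1.emit 1).emit i).setv (x := .slot) (by decide) (by decide)
    (s₁.v .out + 1 + 1)).emit 0 |>.setv (x := .cnt) (by decide) (by decide) 0
  obtain ⟨s₂, hs₂⟩ : ∃ s₂, s₂ = ((((s₁.emit 1).emit i).setv .slot
    (s₁.v .out + 1 + 1)).emit 0).setv .cnt 0 := ⟨_, rfl⟩
  simp only [Exp.eval_c, Exp.eval_v, St.emit_v, reduceCtorEq, if_false, hvi1, if_true]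
  rw [← hs₂] at hO2 ⊢
  have hci2 : s₂.v .ci = 3 + q * q + n * n + f i * n := by simp [hs₂, hci1]
  have hn2 : s₂.v .n = n := by simp [hs₂, hL1.hn]
  have hcnt2 : s₂.v .cnt = 0 := by simp [hs₂]
  have hslot2 : s₂.v .slot = B + (L ++ [1, i]).length := by simp [hs₂, hO1.out, add_assoc]
  have hnum2 : s₂.v .num = c := by simp [hs₂, hnum1]
  have hclk2 : s₂.clk = s₁.clk + 8 := by simp [hs₂]
  clear hs₂
  refine wp_for n (fun a s₃ => ∃ T : List (List ℕ),
    T = ((List.range a).flatMap fun a => if chain (f i) a then [[a]] else []) ∧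
      Out inp B (L ++ [1] ++ [i] ++ [0] ++ T.flatten) s₃ ∧ s₃.v .cnt = T.length) 6
    ⟨[], by simp, by simpa using hO2.setv (by decide) (by decide) 0, by simpa using hcnt2⟩
    (fun a s₃ hF3 _ _ => (hF3.v .n rfl).trans hn2) ?_ ?_
  · rintro a s₃ ha hF3 ⟨T, hT, hO3, hcnt3⟩ hva
    have hci3 : s₃.v .ci = _ := (hF3.v .ci rfl).trans hci2
    have hlt : f i * n + a < k * n := mul_add_lt (hC.fk i hi) ha
    have htest : (Exp.get (.add (.v .ci) (.v .a))).eval s₃.tick ≠ 0 ↔ chain (f i) a := by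
      simp only [Exp.eval_get, Exp.eval_add, Exp.eval_v, St.tick_v, St.tick_m, hci3, hva]
      rw [hO3.input _ (by rw [hC.hB]; omega), hC.inpC _ (hC.fk i hi) a ha]
    refine wp_ite (fun h => ?_) (fun h => ?_)
    · have hch := htest.1 h
      refine wp_cons (wp_emit (wp_cons (wp_assign (wp_nil ⟨by simpa using hva,
        ⟨T ++ [[a]], by simp [List.range_succ, hT, hch], ?_, by simp [hcnt3]⟩, by simp⟩))))
      refine Out.setv (Out.setv ?_ (by decide) (by decide) _) (by decide) (by decide) _
      simpa [hva] using (hO3.tick.tick.emit a)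
    · have hch : ¬ chain (f i) a := fun h' => htest.2 h' h
      refine wp_skip ⟨hva, ⟨T, by simp [List.range_succ, hT, hch], hO3.tick.tick.setv (by decide)
        (by decide) _, by simp [hcnt3]⟩, by simp⟩
  · rintro s₃ hF3 ⟨T, hT, hO3, hcnt3⟩ - hclk3
    have hslot3 : s₃.v .slot = _ := (hF3.v .slot rfl).trans hslot2
    have hnum3 : s₃.v .num = c := (hF3.v .num rfl).trans hnum2
    change T = domainTuples n chain f i at hT
    refine wp_cons (wp_store (wp_cons (wp_assign (wp_nil ⟨?_, ?_, ?_⟩))))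
    · refine Out.setv ?_ (by decide) (by decide) _
      simp only [Exp.eval_v, St.tick_v, hcnt3, ← hT]
      have : Out inp B (L ++ [1, i] ++ 0 :: T.flatten) s₃.tick := by simpa using hO3.tick
      simpa using this.patch hslot3 T.length
    · simp [hnum3]
    · simp only [St.setv_clk, St.sto_clk]
      omega

/-- Matrix entries are 0 or 1, so an equivalence of two order relations is an equality of two
entries. This is why `CspCtx` bounds the entries of the order matrices by 1. -/
theorem eval_orderTest {s : St} {i j a b : ℕ} {L : List ℕ} (hC : CspCtx q n k leQ le chain f inp B)
    (hO : Out inp B L s) (hi : i < q) (hj : j < q) (ha : a < n) (hb : b < n)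
    (hvi : s.v .i = i) (hvj : s.v .j = j) (hva : s.v .a = a) (hvb : s.v .b = b)
    (hci : s.v .ci = 3 + q * q + n * n + f i * n) (hcj : s.v .cj = 3 + q * q + n * n + f j * n)
    (hrowI : s.v .rowI = 3 + i * q) (hrowJ : s.v .rowJ = 3 + j * q)
    (hrowA : s.v .rowA = 3 + q * q + a * n) (hrowB : s.v .rowB = 3 + q * q + b * n) :
    orderTest.eval s ≠ 0 ↔
      chain (f i) a ∧ chain (f j) b ∧ (le a b ↔ leQ i j) ∧ (le b a ↔ leQ j i) := by
  have h1 : f i * n + a < k * n := mul_add_lt (hC.fk i hi) ha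
  have h2 : f j * n + b < k * n := mul_add_lt (hC.fk j hj) hb
  have h3 : a * n + b < n * n := mul_add_lt ha hb
  have h4 : b * n + a < n * n := mul_add_lt hb ha
  have h5 : i * q + j < q * q := mul_add_lt hi hj
  have h6 : j * q + i < q * q := mul_add_lt hj hi
  have hB := hC.hB
  simp only [orderTest, Ne, Exp.eval_and, Exp.eval_eq, not_not, Exp.eval_get, Exp.eval_add,
    Exp.eval_v, hvi, hvj, hva, hvb, hci, hcj, hrowI, hrowJ, hrowA, hrowB]
  rw [hO.input _ (by omega), hO.input _ (by omega), hO.input _ (by omega), hO.input _ (by omega),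
    hO.input _ (by omega), hO.input _ (by omega), ← hC.inpC _ (hC.fk i hi) a ha,
    ← hC.inpC _ (hC.fk j hj) b hb]
  have hPab := hC.inpP a ha b hb
  have hPba := hC.inpP b hb a ha
  have hQij := hC.inpQ i hi j hj
  have hQji := hC.inpQ j hj i hi
  rw [← hPab.2, ← hPba.2, ← hQij.2, ← hQji.2]
  refine and_congr Iff.rfl (and_congr Iff.rfl (and_congr ?_ ?_)) <;> omega

end

end RAM

/-! ### Assembling the whole output -/

namespace RAM

open Cmd

/-- Write all constraints, if there are variables. -/
def computeNonempty : Cmd :=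
  block [assign .pb (.c 3), for' .i (.v .q) (assign .pb (.add (.v .pb) (.v .q))),
    assign .cb (.v .pb), for' .i (.v .n) (assign .cb (.add (.v .cb) (.v .n))),
    assign .fb (.v .cb), for' .i (.v .k) (assign .fb (.add (.v .fb) (.v .n))),
    assign .base (.add (.v .fb) (.v .q)), assign .out (.v .base),
    emit (.v .q), emit (.v .n), emit (.c 0), assign .num (.c 0),
    for' .i (.v .q) emitDomain,
    assign .rowI (.c 3),
    for' .i (.v .q) (block [chainRow .ci .i, assign .rowJ (.c 3),
      for' .j (.v .q) (block [ite (.eq (.v .i) (.v .j)) skip emitOrder,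
        assign .rowJ (.add (.v .rowJ) (.v .q))]),
      assign .rowI (.add (.v .rowI) (.v .q))]),
    store (.add (.v .base) (.c 2)) (.v .num), assign .len (.sub (.v .out) (.v .base))]

/-- Compute the constraint satisfaction problem of an assignment of chains. -/
def compute : Cmd :=
  block [assign .q (.get (.c 0)), assign .n (.get (.c 1)), assign .k (.get (.c 2)),
    ite (.v .q) computeNonempty
      (block [assign .base (.c 3), store (.c 3) (.c 0), store (.c 4) (.v .n), store (.c 5) (.c 0),
        assign .len (.c 3)])]

section

variable {q n k : ℕ} {leQ le chain : ℕ → ℕ → Prop} {f : ℕ → ℕ} {inp : ℕ → ℕ} {B : ℕ}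

/-- The addresses `rowA` and `rowB` advance by `n` along with `a` and `b`, so each pair costs
constant time. -/
theorem wp_emitOrder {s : St} {i j c : ℕ} {L : List ℕ} (hC : CspCtx q n k leQ le chain f inp B)
    (hL : Layout q n k s) (hO : Out inp B L s) (hi : i < q) (hj : j < q) (hvi : s.v .i = i)
    (hvj : s.v .j = j) (hci : s.v .ci = 3 + q * q + n * n + f i * n) (hrowI : s.v .rowI = 3 + i * q)
    (hrowJ : s.v .rowJ = 3 + j * q) (hnum : s.v .num = c) :
    emitOrder.wp s fun s' =>
      Out inp B (L ++ ([2, i, j, (orderTuples n leQ le chain f i j).length] ++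
        (orderTuples n leQ le chain f i j).flatten)) s' ∧
      s'.v .num = c + 1 ∧ s'.clk ≤ s.clk + (9 * (n * n) + 9 * n + 20) := by
  classical
  refine wp_cons ((wp_chainRow hC hL hO hj hvj (by decide) (by decide) (by decide)).mono ?_)
  rintro s₁ hF1 ⟨hcj1, hO1, hclk1⟩
  have hL1 := hL.frame hF1 rfl
  have hvi1 : s₁.v .i = i := (hF1.v .i rfl).trans hvi
  have hvj1 : s₁.v .j = j := (hF1.v .j rfl).trans hvj
  refine wp_cons (wp_emit (wp_cons (wp_emit (wp_cons (wp_emit (wp_cons (wp_assign (wp_cons (wp_emit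
    (wp_cons (wp_assign (wp_cons (wp_assign (wp_cons ?_))))))))))))))
  have hO2 := ((((hO1.emit 2).emit i).emit j).setv (x := .slot) (by decide) (by decide)
    (s₁.v .out + 1 + 1 + 1)).emit 0 |>.setv (x := .cnt) (by decide) (by decide) 0
    |>.setv (x := .rowA) (by decide) (by decide) (3 + q * q)
  obtain ⟨s₂, hs₂⟩ : ∃ s₂, s₂ = ((((((s₁.emit 2).emit i).emit j).setv .slot
    (s₁.v .out + 1 + 1 + 1)).emit 0).setv .cnt 0).setv .rowA (3 + q * q) := ⟨_, rfl⟩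
  simp only [Exp.eval_c, Exp.eval_v, St.emit_v, St.setv_v, reduceCtorEq, if_false, hvi1, hvj1,
    if_true, hL1.pb]
  rw [← hs₂] at hO2 ⊢
  have hci2 : s₂.v .ci = 3 + q * q + n * n + f i * n := by simpa [hs₂] using (hF1.v .ci rfl).trans hci
  have hcj2 : s₂.v .cj = 3 + q * q + n * n + f j * n := by simpa [hs₂] using hcj1
  have hrowI2 : s₂.v .rowI = 3 + i * q := by simpa [hs₂] using (hF1.v .rowI rfl).trans hrowI
  have hrowJ2 : s₂.v .rowJ = 3 + j * q := by simpa [hs₂] using (hF1.v .rowJ rfl).trans hrowJ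
  have hrowA2 : s₂.v .rowA = 3 + q * q := by simp [hs₂]
  have hvi2 : s₂.v .i = i := by simp [hs₂, hvi1]
  have hvj2 : s₂.v .j = j := by simp [hs₂, hvj1]
  have hpb2 : s₂.v .pb = 3 + q * q := by simp [hs₂, hL1.pb]
  have hn2 : s₂.v .n = n := by simp [hs₂, hL1.hn]
  have hcnt2 : s₂.v .cnt = 0 := by simp [hs₂]
  have hslot2 : s₂.v .slot = B + (L ++ [2, i, j]).length := by simp [hs₂, hO1.out, add_assoc]
  have hnum2 : s₂.v .num = c := by simpa [hs₂] using (hF1.v .num rfl).trans hnum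
  have hclk2 : s₂.clk = s₁.clk + 11 := by simp [hs₂]
  clear hs₂
  let G (a b : ℕ) : List (List ℕ) :=
    if chain (f i) a ∧ chain (f j) b ∧ (le a b ↔ leQ i j) ∧ (le b a ↔ leQ j i) then [[a, b]] else []
  refine wp_for n (fun a s₃ => s₃.v .rowA = 3 + q * q + a * n ∧ ∃ T : List (List ℕ),
    T = ((List.range a).flatMap fun a => (List.range n).flatMap fun b => G a b) ∧
      Out inp B (L ++ [2] ++ [i] ++ [j] ++ [0] ++ T.flatten) s₃ ∧ s₃.v .cnt = T.length) (9 * n + 6)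
    ⟨by simpa using hrowA2, [], by simp, by simpa using hO2.setv (by decide) (by decide) 0,
      by simpa using hcnt2⟩
    (fun a s₃ hF3 _ _ => (hF3.v .n rfl).trans hn2) ?_ ?_
  · rintro a s₃ ha hF3 ⟨hrowA3, T, hT, hO3, hcnt3⟩ hva3
    have hpb3 : s₃.v .pb = _ := (hF3.v .pb rfl).trans hpb2
    have hn3 : s₃.v .n = n := (hF3.v .n rfl).trans hn2
    refine wp_cons (wp_assign (wp_cons (wp_for n (fun b s₄ =>
      s₄.v .rowB = 3 + q * q + b * n ∧ ∃ T' : List (List ℕ),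
      T' = T ++ ((List.range b).flatMap fun b => G a b) ∧
        Out inp B (L ++ [2] ++ [i] ++ [j] ++ [0] ++ T'.flatten) s₄ ∧ s₄.v .cnt = T'.length) 9
      ⟨by simp [hpb3], T, by simp, (hO3.tick.setv (by decide) (by decide) _).setv (by decide)
        (by decide) _, by simpa using hcnt3⟩
      (fun b s₄ hF4 _ _ => (hF4.v .n rfl).trans (by simpa using hn3)) ?_ ?_)))
    · rintro b s₄ hb hF4 ⟨hrowB4, T', hT', hO4, hcnt4⟩ hvb4
      have hn4 : s₄.v .n = n := (hF4.v .n rfl).trans (by simpa using hn3)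
      have hva4 : s₄.v .a = a := (hF4.v .a rfl).trans (by simpa using hva3)
      have htest := eval_orderTest hC hO4.tick hi hj ha hb
        ((hF4.v .i rfl).trans (by simpa using (hF3.v .i rfl).trans hvi2))
        ((hF4.v .j rfl).trans (by simpa using (hF3.v .j rfl).trans hvj2)) hva4 hvb4
        ((hF4.v .ci rfl).trans (by simpa using (hF3.v .ci rfl).trans hci2))
        ((hF4.v .cj rfl).trans (by simpa using (hF3.v .cj rfl).trans hcj2))
        ((hF4.v .rowI rfl).trans (by simpa using (hF3.v .rowI rfl).trans hrowI2))
        ((hF4.v .rowJ rfl).trans (by simpa using (hF3.v .rowJ rfl).trans hrowJ2))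
        ((hF4.v .rowA rfl).trans (by simpa using hrowA3)) hrowB4
      refine wp_cons (wp_ite (fun h => ?_) (fun h => ?_))
      · have hG : G a b = [[a, b]] := if_pos (htest.1 h)
        refine wp_cons (wp_emit (wp_cons (wp_emit (wp_cons (wp_assign (wp_nil (wp_cons (wp_assign
          (wp_nil ⟨by simpa using hvb4, ⟨by simp [hrowB4, hn4]; ring, T' ++ [[a, b]],
            by simp [List.range_succ, hT', hG], ?_, by simp [hcnt4]⟩, by simp⟩)))))))))
        refine Out.setv (Out.setv (Out.setv ?_ (by decide) (by decide) _) (by decide) (by decide) _)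
          (by decide) (by decide) _
        simpa [hva4, hvb4] using ((hO4.tick.tick.emit a).emit b)
      · have hG : G a b = [] := if_neg fun h' => htest.2 h' h
        refine wp_skip (wp_cons (wp_assign (wp_nil ⟨by simpa using hvb4,
          ⟨by simp [hrowB4, hn4]; ring, T', by simp [List.range_succ, hT', hG],
            (hO4.tick.tick.setv (by decide) (by decide) _).setv (by decide) (by decide) _,
            by simp [hcnt4]⟩, by simp⟩)))
    · rintro s₄ hF4 ⟨-, T', hT', hO4, hcnt4⟩ - hclk4
      have hn4 : s₄.v .n = n := (hF4.v .n rfl).trans (by simpa using hn3)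
      have hrowA4 : s₄.v .rowA = _ := (hF4.v .rowA rfl).trans (by simpa using hrowA3)
      have hva4 : s₄.v .a = a := (hF4.v .a rfl).trans (by simpa using hva3)
      refine wp_cons (wp_assign (wp_nil ⟨by simpa using hva4, ⟨by simp [hrowA4, hn4]; ring, T',
        by simp [List.range_succ, hT', hT],
        (hO4.tick.setv (by decide) (by decide) _).setv (by decide) (by decide) _,
        by simp [hcnt4]⟩, ?_⟩))
      simp only [St.setv_clk, St.tick_clk] at hclk4 ⊢
      omega
  · rintro s₃ hF3 ⟨-, T, hT, hO3, hcnt3⟩ - hclk3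
    have hslot3 : s₃.v .slot = _ := (hF3.v .slot rfl).trans hslot2
    have hnum3 : s₃.v .num = c := (hF3.v .num rfl).trans hnum2
    change T = orderTuples n leQ le chain f i j at hT
    refine wp_cons (wp_store (wp_cons (wp_assign (wp_nil ⟨?_, ?_, ?_⟩))))
    · refine Out.setv ?_ (by decide) (by decide) _
      simp only [Exp.eval_v, St.tick_v, hcnt3, ← hT]
      have : Out inp B (L ++ [2, i, j] ++ 0 :: T.flatten) s₃.tick := by simpa using hO3.tick
      simpa using this.patch hslot3 T.length
    · simp [hnum3]
    · simp only [St.setv_clk, St.sto_clk]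
      have : n * (9 * n + 6) = 9 * (n * n) + 6 * n := by ring
      omega

/-- The encodings of the unary constraints. -/
noncomputable def domainCodes (n : ℕ) (chain : ℕ → ℕ → Prop) (f : ℕ → ℕ) (q : ℕ) :
    List (List ℕ) :=
  (List.range q).flatMap fun i =>
    [[1, i, (domainTuples n chain f i).length] ++ (domainTuples n chain f i).flatten]

/-- The encodings of the first `j` binary constraints with first variable `i`. -/
noncomputable def orderCodes (n : ℕ) (leQ le chain : ℕ → ℕ → Prop) (f : ℕ → ℕ) (i j : ℕ) :
    List (List ℕ) :=
  (List.range j).flatMap fun j => if i = j then [] else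
    [[2, i, j, (orderTuples n leQ le chain f i j).length] ++
      (orderTuples n leQ le chain f i j).flatten]

/-- The encodings of all constraints. -/
noncomputable def cspCodes (q n : ℕ) (leQ le chain : ℕ → ℕ → Prop) (f : ℕ → ℕ) :
    List (List ℕ) :=
  domainCodes n chain f q ++ (List.range q).flatMap fun i => orderCodes n leQ le chain f i q

/-- The dominant terms are the pairs of variables times the pairs of values; positivity of `q` and
`n` absorbs all others. -/
theorem compute_cost {q n k : ℕ} (hq : 0 < q) (hn : 0 < n) (hk : k ≤ n) :
    (3 * q + 3 * n + 3 * k + 18) + (q * (9 * n + 17) + 3) +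
      (q * (q * (9 * (n * n) + 9 * n + 24) + 3 * n + 10) + 4) ≤ 200 * (q * n) ^ 2 := by
  have h1 : 1 ≤ q * n := Nat.mul_pos hq hn
  have h2 : q * n ≤ (q * n) ^ 2 := Nat.le_self_pow (by decide) _
  have h3 : q ≤ q * n := Nat.le_mul_of_pos_right _ hn
  have h4 : n ≤ q * n := Nat.le_mul_of_pos_left _ hq
  have h5 : q * (9 * n + 17) = 9 * (q * n) + 17 * q := by ring
  have h6 : q * q * n ≤ (q * n) ^ 2 := by
    rw [mul_pow, sq, sq]
    exact Nat.mul_le_mul_left _ (Nat.le_mul_of_pos_left _ hn)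
  have h7 : q * q ≤ (q * n) ^ 2 := (Nat.le_mul_of_pos_right _ hn).trans h6
  have h8 : q * (q * (9 * (n * n) + 9 * n + 24) + 3 * n + 10) =
      9 * (q * n) ^ 2 + 9 * (q * q * n) + 24 * (q * q) + 3 * (q * n) + 10 * q := by ring
  omega

theorem wp_computeNonempty {s : St} (hC : CspCtx q n k leQ le chain f inp B) (hq : s.v .q = q)
    (hn : s.v .n = n) (hk : s.v .k = k) (hq0 : 0 < q) (hm : s.m = inp) :
    computeNonempty.wp s fun s' =>
      Out inp B ([q, n, (cspCodes q n leQ le chain f).length] ++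
        (cspCodes q n leQ le chain f).flatten) s' ∧
      s'.v .len = ([q, n, (cspCodes q n leQ le chain f).length] ++
        (cspCodes q n leQ le chain f).flatten).length ∧
      s'.clk ≤ s.clk + 200 * (q * n) ^ 2 := by
  -- A variable needs a chain, and there are at most `n` chains.
  have hn0 : 0 < n := (Nat.zero_le _).trans_lt ((hC.fk 0 hq0).trans_le hC.kn)
  refine wp_cons (wp_assign (wp_cons (wp_for q (fun i s₁ => s₁.m = inp ∧ s₁.v .pb = 3 + i * q) 3
    (by simp [hm]) (fun i s₁ hF _ _ => (hF.v .q rfl).trans (by simpa using hq)) ?_ ?_)))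
  · rintro i s₁ hi hF ⟨hm, hpb⟩ hx
    have hq1 : s₁.v .q = q := (hF.v .q rfl).trans (by simpa using hq)
    refine wp_assign ?_
    simp [hx, hm, hpb, hq1, Nat.succ_mul, add_assoc]
  rintro s₁ hF1 ⟨hm1, hpb1⟩ - hclk1
  have hq1 : s₁.v .q = q := (hF1.v .q rfl).trans (by simpa using hq)
  have hn1 : s₁.v .n = n := (hF1.v .n rfl).trans (by simpa using hn)
  have hk1 : s₁.v .k = k := (hF1.v .k rfl).trans (by simpa using hk)
  refine wp_cons (wp_assign (wp_cons (wp_for n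
    (fun i s₂ => s₂.m = inp ∧ s₂.v .cb = 3 + q * q + i * n) 3
    (by simp [hm1, hpb1]) (fun i s₂ hF _ _ => (hF.v .n rfl).trans (by simpa using hn1)) ?_ ?_)))
  · rintro i s₂ hi hF ⟨hm, hpb⟩ hx
    have hn2 : s₂.v .n = n := (hF.v .n rfl).trans (by simpa using hn1)
    refine wp_assign ?_
    simp [hx, hm, hpb, hn2, Nat.succ_mul, add_assoc]
  rintro s₂ hF2 ⟨hm2, hcb2⟩ - hclk2
  have hq2 : s₂.v .q = q := (hF2.v .q rfl).trans (by simpa using hq1)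
  have hn2 : s₂.v .n = n := (hF2.v .n rfl).trans (by simpa using hn1)
  have hk2 : s₂.v .k = k := (hF2.v .k rfl).trans (by simpa using hk1)
  have hpb2 : s₂.v .pb = 3 + q * q := (hF2.v .pb rfl).trans (by simpa using hpb1)
  refine wp_cons (wp_assign (wp_cons (wp_for k
    (fun i s₃ => s₃.m = inp ∧ s₃.v .fb = 3 + q * q + n * n + i * n) 3
    (by simp [hm2, hcb2]) (fun i s₃ hF _ _ => (hF.v .k rfl).trans (by simpa using hk2)) ?_ ?_)))
  · rintro i s₃ hi hF ⟨hm, hpb⟩ hx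
    have hn3 : s₃.v .n = n := (hF.v .n rfl).trans (by simpa using hn2)
    refine wp_assign ?_
    simp [hx, hm, hpb, hn3, Nat.succ_mul, add_assoc]
  rintro s₃ hF3 ⟨hm3, hfb3⟩ - hclk3
  have hL3 : Layout q n k s₃ := ⟨(hF3.v .q rfl).trans (by simpa using hq2),
    (hF3.v .n rfl).trans (by simpa using hn2), (hF3.v .k rfl).trans (by simpa using hk2),
    (hF3.v .pb rfl).trans (by simpa using hpb2), (hF3.v .cb rfl).trans (by simpa using hcb2), hfb3⟩
  refine wp_cons (wp_assign (wp_cons (wp_assign (wp_cons (wp_emit (wp_cons (wp_emit (wp_cons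
    (wp_emit (wp_cons (wp_assign (wp_cons ?_))))))))))))
  have hO4 : Out inp B [] ((s₃.tick.setv .base B).setv .out B) :=
    ⟨by simp, by simp, fun i _ => by simp [hm3], by simp⟩
  have hO4 := (((hO4.emit q).emit n).emit 0).setv (x := .num) (by decide) (by decide) 0
  simp only [Exp.eval_add, Exp.eval_v, Exp.eval_c, St.tick_v, St.setv_v, St.emit_v, reduceCtorEq,
    if_false, if_true, hL3.fb, hL3.hq, hL3.hn, ← hC.hB]
  obtain ⟨s₄, hs₄⟩ : ∃ s₄, s₄ = (((((s₃.tick.setv .base B).setv .out B).emit q).emit n).emit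
    0).setv .num 0 := ⟨_, rfl⟩
  rw [← hs₄] at hO4 ⊢
  have hL4 : Layout q n k s₄ := by
    constructor <;> simp [hs₄, hL3.hq, hL3.hn, hL3.hk, hL3.pb, hL3.cb, hL3.fb]
  have hnum4 : s₄.v .num = 0 := by simp [hs₄]
  have hclk4 : s₄.clk = s₃.tick.clk + 9 := by simp [hs₄]
  clear hs₄
  simp only [St.setv_clk] at hclk1 hclk2 hclk3
  refine wp_for q (fun i s₅ => Out inp B ([q] ++ [n] ++ [0] ++
      (domainCodes n chain f i).flatten) s₅ ∧ s₅.v .num = (domainCodes n chain f i).length)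
    (9 * n + 17) ⟨by simpa [domainCodes] using hO4.setv (by decide) (by decide) 0,
      by simpa [domainCodes] using hnum4⟩
    (fun i s₅ hF _ _ => (hF.v .q rfl).trans hL4.hq) ?_ ?_
  · rintro i s₅ hi hF5 ⟨hO5, hnum5⟩ hvi5
    refine wp.mono (wp_emitDomain hC ((hL4.frame hF5 rfl).frame (.tick .skip _) rfl) hO5.tick hi
      hvi5 hnum5) ?_
    rintro s₆ hF6 ⟨hO6, hnum6, hclk6⟩
    refine ⟨(hF6.v .i rfl).trans hvi5, ⟨?_, ?_⟩, ?_⟩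
    · refine Out.setv ?_ (by decide) (by decide) _
      simpa [domainCodes, List.range_succ] using hO6
    · simp [domainCodes, List.range_succ, hnum6]
    · rw [St.tick_clk] at hclk6
      omega
  rintro s₅ hF5 ⟨hO5, hnum5⟩ - hclk5
  have hL5 := (hL4.frame hF5 rfl).frame (.tick .skip _) rfl
  refine wp_cons (wp_assign (wp_cons (wp_for q (fun i s₆ => s₆.v .rowI = 3 + i * q ∧
      ∃ T : List (List ℕ), T = domainCodes n chain f q ++
        ((List.range i).flatMap fun i => orderCodes n leQ le chain f i q) ∧
      Out inp B ([q] ++ [n] ++ [0] ++ T.flatten) s₆ ∧ s₆.v .num = T.length)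
    (q * (9 * (n * n) + 9 * n + 24) + 3 * n + 10) ⟨by simp, _, rfl, by
      simpa using (hO5.tick.setv (by decide) (by decide) _).setv (by decide) (by decide) _,
      by simp [hnum5]⟩ (fun i s₆ hF _ _ => (hF.v .q rfl).trans (by simpa using hL5.hq)) ?_ ?_)))
  · rintro i s₆ hi hF6 ⟨hrowI6, T, hT, hO6, hnum6⟩ hvi6
    have hL6 : Layout q n k s₆ := (hL5.frame (Runs.assign .rowI (.c 3) _).frame rfl).frame hF6 rfl
    refine wp_cons (wp.mono (wp_chainRow hC (hL6.frame (.tick .skip _) rfl) hO6.tick hi hvi6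
      (by decide) (by decide) (by decide)) ?_)
    rintro s₇ hF7 ⟨hci7, hO7, hclk7⟩
    have hL7 := (hL6.frame (.tick .skip _) rfl).frame hF7 rfl
    have hvi7 : s₇.v .i = i := (hF7.v .i rfl).trans hvi6
    have hnum7 : s₇.v .num = _ := (hF7.v .num rfl).trans hnum6
    have hrowI7 : s₇.v .rowI = _ := (hF7.v .rowI rfl).trans hrowI6
    refine wp_cons (wp_assign (wp_cons (wp_for q (fun j s₈ => s₈.v .rowJ = 3 + j * q ∧
        ∃ T' : List (List ℕ), T' = T ++ orderCodes n leQ le chain f i j ∧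
        Out inp B ([q] ++ [n] ++ [0] ++ T'.flatten) s₈ ∧ s₈.v .num = T'.length)
      (9 * (n * n) + 9 * n + 24) ⟨by simp, T, by simp [orderCodes],
        (hO7.setv (by decide) (by decide) _).setv (by decide) (by decide) _,
        by simp [hnum7]⟩ (fun j s₈ hF _ _ => (hF.v .q rfl).trans (by simpa using hL7.hq)) ?_ ?_)))
    · rintro j s₈ hj hF8 ⟨hrowJ8, T', hT', hO8, hnum8⟩ hvj8
      have hL8 : Layout q n k s₈ := (hL7.frame (Runs.assign .rowJ (.c 3) _).frame rfl).frame hF8 rfl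
      have hvi8 : s₈.v .i = i := (hF8.v .i rfl).trans (by simpa using hvi7)
      have hci8 : s₈.v .ci = _ := (hF8.v .ci rfl).trans (by simpa using hci7)
      have hrowI8 : s₈.v .rowI = _ := (hF8.v .rowI rfl).trans (by simpa using hrowI7)
      refine wp_cons (wp_ite (fun h => ?_) (fun h => ?_))
      · have hij : i = j := by
          rw [Ne, Exp.eval_eq, not_not] at h
          simpa [hvi8, hvj8] using h
        refine wp_skip (wp_cons (wp_assign (wp_nil ⟨by simpa using hvj8,
          ⟨by simp [hrowJ8, hL8.hq]; ring, T', ?_,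
            (hO8.tick.tick.setv (by decide) (by decide) _).setv (by decide) (by decide) _,
            by simp [hnum8]⟩, by simp only [St.setv_clk, St.tick_clk]; omega⟩)))
        rw [hT', orderCodes, orderCodes, List.range_succ]
        simp [hij]
      · have hij : i ≠ j := by
          rw [Exp.eval_eq] at h
          simpa [hvi8, hvj8] using h
        refine wp.mono (wp_emitOrder hC (hL8.frame (.tick .skip _) rfl |>.frame (.tick .skip _) rfl)
          hO8.tick.tick hi hj hvi8 hvj8 hci8 hrowI8 hrowJ8 hnum8) ?_
        rintro s₉ hF9 ⟨hO9, hnum9, hclk9⟩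
        have hvj9 : s₉.v .j = j := (hF9.v .j rfl).trans hvj8
        have hrowJ9 : s₉.v .rowJ = _ := (hF9.v .rowJ rfl).trans hrowJ8
        have hq9 : s₉.v .q = q := (hF9.v .q rfl).trans hL8.hq
        refine wp_cons (wp_assign (wp_nil ⟨by simpa using hvj9,
          ⟨by simp [hrowJ9, hq9]; ring, _, rfl, ?_, ?_⟩, ?_⟩))
        · refine Out.setv (Out.setv ?_ (by decide) (by decide) _) (by decide) (by decide) _
          simpa [hT', orderCodes, List.range_succ, hij] using hO9
        · simp [hT', orderCodes, List.range_succ, hij, hnum9, add_assoc]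
        · simp only [St.setv_clk, St.tick_clk] at hclk9 ⊢
          omega
    · rintro s₈ hF8 ⟨-, T', hT', hO8, hnum8⟩ - hclk8
      have hvi8 : s₈.v .i = i := (hF8.v .i rfl).trans (by simpa using hvi7)
      have hrowI8 : s₈.v .rowI = _ := (hF8.v .rowI rfl).trans (by simpa using hrowI7)
      have hq8 : s₈.v .q = q := (hF8.v .q rfl).trans (by simpa using hL7.hq)
      refine wp_cons (wp_assign (wp_nil ⟨by simpa using hvi8,
        ⟨by simp [hrowI8, hq8]; ring, T', by simp [hT', hT, List.range_succ],
          (hO8.tick.setv (by decide) (by decide) _).setv (by decide) (by decide) _,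
          by simp [hnum8]⟩, ?_⟩))
      simp only [St.setv_clk, St.tick_clk] at hclk8 hclk7 ⊢
      omega
  · rintro s₆ hF6 ⟨-, T, hT, hO6, hnum6⟩ - hclk6
    change T = cspCodes q n leQ le chain f at hT
    have hO7 : Out inp B ([q, n] ++ T.length :: T.flatten) (s₆.tick.sto (B + 2) T.length) := by
      have : Out inp B ([q, n] ++ 0 :: T.flatten) s₆.tick := by simpa using hO6.tick
      exact this.patch rfl _
    refine wp_cons (wp_store (wp_cons (wp_assign (wp_nil ?_))))
    simp only [Exp.eval_add, Exp.eval_sub, Exp.eval_v, Exp.eval_c, St.tick_v, hO6.base, hnum6,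
      ← hT]
    refine ⟨by simpa using hO7.setv (by decide) (by decide) _, ?_, ?_⟩
    · have h1 := hO7.out
      simp only [St.sto_v, St.tick_v] at h1 ⊢
      simp [h1, hO6.base]
    · have := compute_cost hq0 hn0 hC.kn
      simp only [St.setv_clk, St.sto_clk, St.tick_clk] at *
      omega

end

end RAM

/-! ### The encoding of the constraint satisfaction problem -/

theorem List.map_filter_eq_flatMap_ite {α β : Type*} (p : α → Prop) [DecidablePred p] (g : α → β)
    (l : List α) : (l.filter fun a => p a).map g = l.flatMap fun a => if p a then [g a] else [] := by
  induction l with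
  | nil => rfl
  | cons a l ih => by_cases h : p a <;> simp [h, ih]

theorem List.product_flatMap {α β γ : Type*} (l : List α) (l' : List β) (g : α × β → List γ) :
    (l ×ˢ l').flatMap g = l.flatMap fun a => l'.flatMap fun b => g (a, b) := by
  change (l.flatMap fun a => l'.map (Prod.mk a)).flatMap g = _
  rw [List.flatMap_assoc]
  simp only [List.flatMap_map]

/-- Turns the loops of the machine over labels into traversals of the list of elements. -/
theorem FinPoset.range_flatMap (P : FinPoset) {β : Type*} (g : ℕ → List β) :
    (List.range P.size).flatMap g = P.elems.flatMap fun p => g (P.label p) := by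
  rw [← List.map_coe_finRange_eq_range, FinPoset.elems, List.flatMap_map, List.flatMap_map]
  simp

section

variable (Q P : FinPoset) {k : ℕ} (C : ChainPartition P k) (f : Q → Fin k)

/-- Membership in the chains, as a relation between the numbers of chains and the labels. -/
def ChainPartition.natMem {P : FinPoset} {k : ℕ} (C : ChainPartition P k) (c a : ℕ) : Prop :=
  ∃ (hc : c < k) (ha : a < P.size), P.label.symm ⟨a, ha⟩ ∈ C.part ⟨c, hc⟩

theorem ChainPartition.natMem_label {P : FinPoset} {k : ℕ} (C : ChainPartition P k) (c : Fin k)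
    (p : P) : C.natMem c (P.label p) ↔ p ∈ C.part c := by
  simp [natMem]

/-- Nonempty disjoint parts have distinct representatives. Without this bound, the `k` additions
that locate the end of the chain matrix would not fit into the time bound. -/
theorem ChainPartition.le_size {P : FinPoset} {k : ℕ} (C : ChainPartition P k) : k ≤ P.size := by
  choose g hg using C.nonempty
  have hinj : Function.Injective fun c => P.label (g c) := by
    intro c d h
    by_contra hne
    have h' : g c = g d := P.label.injective h
    exact Set.disjoint_left.1 (C.disjoint c d hne) (hg c) (h' ▸ hg d)
  simpa using Fintype.card_le_of_injective _ hinj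

/-- The assignment of chains, as a function of the labels. -/
def natAssignment {Q : FinPoset} {k : ℕ} (f : Q → Fin k) (i : ℕ) : ℕ :=
  if h : i < Q.size then f (Q.label.symm ⟨i, h⟩) else 0

theorem natAssignment_label {Q : FinPoset} {k : ℕ} (f : Q → Fin k) (x : Q) :
    natAssignment f (Q.label x) = f x := by
  simp [natAssignment]

theorem domainTuples_label (x : Q) :
    (domainConstraint Q P C f x).rel.map (fun t => List.ofFn fun j => (P.label (t j) : ℕ)) =
      RAM.domainTuples P.size C.natMem (natAssignment f) (Q.label x) := by
  classical
  rw [RAM.domainTuples, P.range_flatMap]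
  simp only [domainConstraint, List.map_map, natAssignment_label, ChainPartition.natMem_label]
  rw [List.map_filter_eq_flatMap_ite]
  congr 1

theorem orderTuples_label (x y : Q) (h : x ≠ y) :
    (orderConstraint Q P C f x y h).rel.map (fun t => List.ofFn fun j => (P.label (t j) : ℕ)) =
      RAM.orderTuples P.size Q.natLe P.natLe C.natMem (natAssignment f) (Q.label x)
        (Q.label y) := by
  classical
  rw [RAM.orderTuples, P.range_flatMap]
  simp only [P.range_flatMap]
  simp only [orderConstraint, List.map_map, natAssignment_label, ChainPartition.natMem_label,
    FinPoset.natLe_label]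
  rw [List.map_filter_eq_flatMap_ite, List.product_flatMap]
  congr 1

theorem encode_domainConstraint (x : Q) :
    (domainConstraint Q P C f x).encode Q.label P.label =
      [1, (Q.label x : ℕ),
        (RAM.domainTuples P.size C.natMem (natAssignment f) (Q.label x)).length] ++
      (RAM.domainTuples P.size C.natMem (natAssignment f) (Q.label x)).flatten := by
  rw [← domainTuples_label, List.length_map, ← List.flatMap_def, Constraint.encode]
  simp [domainConstraint]

theorem encode_orderConstraint (x y : Q) (h : x ≠ y) :
    (orderConstraint Q P C f x y h).encode Q.label P.label =
      [2, (Q.label x : ℕ), (Q.label y : ℕ),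
        (RAM.orderTuples P.size Q.natLe P.natLe C.natMem (natAssignment f) (Q.label x)
          (Q.label y)).length] ++
      (RAM.orderTuples P.size Q.natLe P.natLe C.natMem (natAssignment f) (Q.label x)
        (Q.label y)).flatten := by
  rw [← orderTuples_label Q P C f x y h, List.length_map, ← List.flatMap_def, Constraint.encode]
  simp [orderConstraint]

/-- The product of lists is lexicographic, which is the order in which the nested loops write the
binary constraints; the pairs on the diagonal contribute nothing on either side. -/
theorem map_encode_constraints :
    (assignmentCSP Q P C f).constraints.map (Constraint.encode Q.label P.label) =
      RAM.cspCodes Q.size P.size Q.natLe P.natLe C.natMem (natAssignment f) := by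
  classical
  rw [assignmentCSP, List.map_append, RAM.cspCodes, RAM.domainCodes, Q.range_flatMap,
    Q.range_flatMap, List.filterMap_eq_flatMap_toList, List.map_flatMap, List.product_flatMap]
  congr 1
  · rw [List.map_map]
    simp only [← encode_domainConstraint]
    rw [← List.map_eq_flatMap]
    rfl
  · congr 1
    funext x
    rw [RAM.orderCodes, Q.range_flatMap]
    congr 1
    funext y
    by_cases h : x = y
    · simp [h]
    · have h' : (Q.label x : ℕ) ≠ Q.label y := fun e => h (Q.label.injective (Fin.ext e))
      simp only [ne_eq, h, not_false_eq_true, dif_pos, Option.toList_some, List.map_cons,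
        List.map_nil, h', if_false, encode_orderConstraint]

theorem encode_assignmentCSP :
    (assignmentCSP Q P C f).encode Q.label P.label =
      [Q.size, P.size,
        (RAM.cspCodes Q.size P.size Q.natLe P.natLe C.natMem (natAssignment f)).length] ++
      (RAM.cspCodes Q.size P.size Q.natLe P.natLe C.natMem (natAssignment f)).flatten := by
  rw [← map_encode_constraints, List.length_map, ← List.flatMap_def, CSP.encode]

theorem cspCtx_encodeAssignment :
    RAM.CspCtx Q.size P.size k Q.natLe P.natLe C.natMem (natAssignment f)
      (fun i => (encodeAssignment Q P C f).getD i 0)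
      (3 + Q.size * Q.size + P.size * P.size + k * P.size + Q.size) := by
  classical
  have hsplit : encodeAssignment Q P C f = [Q.size, P.size, k] ++ (Q.matrix ++ (P.matrix ++
      ((List.ofFn fun t : Fin (k * P.size) =>
        if P.label.symm t.modNat ∈ C.part t.divNat then 1 else 0) ++
      Q.elems.map fun q => (f q : ℕ)))) := by
    simp [encodeAssignment]
  have hhead : ∀ (L : List ℕ) (i : ℕ), ([Q.size, P.size, k] ++ L).getD (3 + i) 0 = L.getD i 0 := by
    intro L i
    rw [List.getD_append_right _ _ _ _ (by simp)]
    simp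
  have hQ : ∀ (L : List ℕ) (i : ℕ),
      (Q.matrix ++ L).getD (Q.size * Q.size + i) 0 = L.getD i 0 := by
    intro L i
    rw [List.getD_append_right _ _ _ _ (by simp)]
    simp
  have hP : ∀ (L : List ℕ) (i : ℕ),
      (P.matrix ++ L).getD (P.size * P.size + i) 0 = L.getD i 0 := by
    intro L i
    rw [List.getD_append_right _ _ _ _ (by simp)]
    simp
  rw [hsplit]
  refine ⟨rfl, C.le_size, fun i hi => ?_, fun i hi j hj => ?_, fun i hi j hj => ?_,
    fun c hc a ha => ?_, fun i hi => ?_⟩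
  · simp [natAssignment, hi]
  · have h : (Q.matrix ++ (P.matrix ++ ((List.ofFn fun t : Fin (k * P.size) =>
        if P.label.symm t.modNat ∈ C.part t.divNat then 1 else 0) ++
        Q.elems.map fun q => (f q : ℕ)))).getD (i * Q.size + j) 0 =
        if Q.natLe i j then 1 else 0 := by
      rw [List.getD_append _ _ _ _ (by simpa using RAM.mul_add_lt hi hj), Q.getD_matrix hi hj]
    simp only [add_assoc, hhead, h]
    split_ifs with h' <;> simp [h']
  · have h : (P.matrix ++ ((List.ofFn fun t : Fin (k * P.size) =>
        if P.label.symm t.modNat ∈ C.part t.divNat then 1 else 0) ++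
        Q.elems.map fun q => (f q : ℕ))).getD (i * P.size + j) 0 =
        if P.natLe i j then 1 else 0 := by
      rw [List.getD_append _ _ _ _ (by simpa using RAM.mul_add_lt hi hj), P.getD_matrix hi hj]
    simp only [add_assoc, hhead, hQ, h]
    split_ifs with h' <;> simp [h']
  · simp only [add_assoc, hhead, hQ, hP]
    rw [List.getD_append _ _ _ _ (by simpa using RAM.mul_add_lt hc ha), getD_ofFn_divNat_modNat
      (fun c a => if P.label.symm a ∈ C.part c then 1 else 0) hc ha]
    simp [ChainPartition.natMem, hc, ha]
  · simp only [add_assoc, hhead, hQ, hP]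
    rw [List.getD_append_right _ _ _ _ (by simp)]
    simp only [List.length_ofFn, Nat.add_sub_cancel_left]
    rw [List.getD_eq_getElem _ _ (by simpa [FinPoset.elems] using hi)]
    simp [FinPoset.elems, natAssignment, hi]

end

/-! ### Correctness of the computed encoding -/

namespace RAM

open Cmd

theorem wp_compute (Q P : FinPoset) {k : ℕ} (C : ChainPartition P k) (f : Q → Fin k) :
    compute.wp (St.start (encodeAssignment Q P C f)) fun s' =>
      s'.v .len = ((assignmentCSP Q P C f).encode Q.label P.label).length ∧
      (∀ i < ((assignmentCSP Q P C f).encode Q.label P.label).length,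
        s'.m (s'.v .base + i) = ((assignmentCSP Q P C f).encode Q.label P.label).getD i 0) ∧
      s'.clk ≤ 200 * ((Q.size * P.size) ^ 2 + 1) := by
  obtain ⟨s, hs⟩ : ∃ s, s = St.start (encodeAssignment Q P C f) := ⟨_, rfl⟩
  have hq : s.m 0 = Q.size := by simp [hs, St.start, encodeAssignment]
  have hn : s.m 1 = P.size := by simp [hs, St.start, encodeAssignment]
  have hk : s.m 2 = k := by simp [hs, St.start, encodeAssignment]
  have hm : s.m = fun i => (encodeAssignment Q P C f).getD i 0 := by rw [hs]; rfl
  have hclk : s.clk = 0 := by rw [hs]; rfl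
  rw [← hs]
  refine wp_cons (wp_assign (wp_cons (wp_assign (wp_cons (wp_assign (wp_cons (wp_ite (fun hq0 => ?_)
    fun hq0 => ?_)))))))
  · simp [hq] at hq0
    refine wp.mono (wp_computeNonempty (cspCtx_encodeAssignment Q P C f) (by simp [hq])
      (by simp [hn]) (by simp [hk]) (Nat.pos_of_ne_zero hq0) hm) ?_
    rintro s' - ⟨hO, hlen, hclk'⟩
    rw [← encode_assignmentCSP] at hO hlen
    refine wp_nil ⟨hlen, fun i hi => by rw [hO.base, hO.output i hi], ?_⟩
    simp only [St.tick_clk, St.setv_clk, hclk] at hclk'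
    omega
  · simp [hq] at hq0
    have hcodes : (assignmentCSP Q P C f).encode Q.label P.label = [0, P.size, 0] := by
      rw [encode_assignmentCSP, cspCodes, domainCodes, hq0]
      simp
    rw [hcodes]
    -- Without variables the three numbers are written directly over the input, because locating the
    -- end of the input would take time depending on `P`.
    refine wp_cons (wp_assign (wp_cons (wp_store (wp_cons (wp_store (wp_cons (wp_store (wp_cons
      (wp_assign (wp_nil (wp_nil ⟨by simp, fun i hi => ?_, ?_⟩)))))))))))
    · simp only [List.length_cons, List.length_nil] at hi
      interval_cases i <;> simp [hn]
    · simp [hclk]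
      omega

theorem exists_computes : ∃ (A : Program) (K : ℕ), ∀ (Q P : FinPoset) (k : ℕ)
    (C : ChainPartition P k) (f : Q → Fin k),
    A.ComputesWithin (encodeAssignment Q P C f) ((assignmentCSP Q P C f).encode Q.label P.label)
      (K * ((Q.size * P.size) ^ 2 + 1)) := by
  refine ⟨compute.code 0, (compute.code 0).length * 200, fun Q P k C f => ?_⟩
  obtain ⟨s, hs, h1, h2, h3⟩ := wp_compute Q P C f
  obtain ⟨t, ht, hh, hr⟩ := hs.halts
  refine ⟨t, ht.trans ?_, hh, (hr.1 .len).trans h1, fun i hi => ?_⟩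
  · rw [mul_assoc]
    exact Nat.mul_le_mul_left _ h3
  · have hb := hr.1 .base
    change _ = s.v .base at hb
    rw [hr.2]
    change s.m (Config.reg _ (Var.reg .base) + i) = _
    rw [hb, h2 i hi, List.getD_eq_getElem _ _ hi]

end RAM

/-! ### Solutions and polymorphisms -/

section

variable {Q P : FinPoset} {k : ℕ} {C : ChainPartition P k} {f : Q → Fin k}

theorem FinPoset.mem_elems (p : P) : p ∈ P.elems :=
  List.mem_map.2 ⟨P.label p, List.mem_finRange _, by simp⟩

theorem mem_domainConstraint {x : Q} {t : Fin 1 → P} :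
    t ∈ (domainConstraint Q P C f x).rel ↔ t 0 ∈ C.part (f x) := by
  classical
  refine List.mem_map.trans ?_
  simp only [List.mem_filter, FinPoset.mem_elems, true_and,
    decide_eq_true_eq]
  constructor
  · rintro ⟨p, hp, rfl⟩
    exact hp
  · intro h
    refine ⟨t 0, h, ?_⟩
    funext j
    fin_cases j
    rfl

theorem mem_orderConstraint {x y : Q} {h : x ≠ y} {t : Fin 2 → P} :
    t ∈ (orderConstraint Q P C f x y h).rel ↔ t 0 ∈ C.part (f x) ∧ t 1 ∈ C.part (f y) ∧
      (t 0 ≤ t 1 ↔ x ≤ y) ∧ (t 1 ≤ t 0 ↔ y ≤ x) := by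
  classical
  refine List.mem_map.trans ?_
  simp only [List.mem_filter, decide_eq_true_eq, Prod.exists]
  constructor
  · rintro ⟨a, b, hp, rfl⟩
    exact hp.2
  · intro h
    refine ⟨t 0, t 1, ⟨List.pair_mem_product.2 ⟨FinPoset.mem_elems _, FinPoset.mem_elems _⟩, h⟩, ?_⟩
    funext j
    fin_cases j <;> rfl

theorem forall_constraints {p : Constraint Q P → Prop} :
    (∀ c ∈ (assignmentCSP Q P C f).constraints, p c) ↔
      (∀ x, p (domainConstraint Q P C f x)) ∧
      ∀ x y (h : x ≠ y), p (orderConstraint Q P C f x y h) := by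
  classical
  simp only [assignmentCSP, List.mem_append, List.mem_map, List.mem_filterMap]
  constructor
  · intro hc
    refine ⟨fun x => hc _ (Or.inl ⟨x, FinPoset.mem_elems x, rfl⟩), fun x y h => hc _ (Or.inr
      ⟨(x, y), List.pair_mem_product.2 ⟨FinPoset.mem_elems x, FinPoset.mem_elems y⟩, ?_⟩)⟩
    rw [dif_pos h]
  · rintro ⟨h1, h2⟩ c (⟨x, -, rfl⟩ | ⟨⟨x, y⟩, -, h⟩)
    · exact h1 x
    · split_ifs at h with h'
      · obtain rfl := Option.some.inj h
        exact h2 x y h'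

/-- No constraint of injectivity is needed: a map that preserves and reflects the order of a partial
order is injective by antisymmetry. -/
theorem isSolution_iff (τ : Q → P) :
    (assignmentCSP Q P C f).IsSolution τ ↔ ∃ e : Q ↪o P, CompatibleWith C f e ∧ ⇑e = τ := by
  rw [CSP.IsSolution, forall_constraints]
  constructor
  · rintro ⟨h1, h2⟩
    have hle : ∀ x y, τ x ≤ τ y ↔ x ≤ y := by
      intro x y
      by_cases h : x = y
      · subst h; simp
      · exact (mem_orderConstraint.1 (h2 x y h)).2.2.1
    exact ⟨OrderEmbedding.ofMapLEIff τ hle, fun x => mem_domainConstraint.1 (h1 x), rfl⟩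
  · rintro ⟨e, he, rfl⟩
    exact ⟨fun x => mem_domainConstraint.2 (he x), fun x y h =>
      mem_orderConstraint.2 ⟨he x, he y, e.le_iff_le, e.le_iff_le⟩⟩

/-- On a chain, a linear extension agrees with the order. -/
theorem FinPoset.IsLinearExtension.le_of_chain {L : LinearOrder P} (hL : P.IsLinearExtension L)
    {c : Fin k} {a b : P} (ha : a ∈ C.part c) (hb : b ∈ C.part c) (h : L.le a b) : a ≤ b := by
  by_cases hab : a = b
  · exact hab.le
  · rcases C.chain c ha hb hab with h' | h'
    · exact h'
    · exact absurd (L.le_antisymm _ _ h (hL _ _ h')) hab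

theorem minOp_cases {D : Type} (L : LinearOrder D) (x : Fin 2 → D) :
    (minOp L x = x 0 ∧ L.le (x 0) (x 1)) ∨ (minOp L x = x 1 ∧ L.le (x 1) (x 0)) := by
  let := L
  rcases le_total (x 0) (x 1) with h | h
  · exact Or.inl ⟨min_eq_left h, h⟩
  · exact Or.inr ⟨min_eq_right h, h⟩

/-- If both minima are taken from the same tuple, nothing is to be shown. Otherwise let the tuples
be `(a, b)` and `(c, d)` with minimum `(a, d)`. On the chains `L` agrees with the order of `P`, so
`a ≤ c` and `d ≤ b`. Then `a ≤ d` implies `a ≤ b`, hence `x ≤ y`, and `x ≤ y` implies `a ≤ c ≤ d`.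
The converse direction of the order and the case `(c, b)` are symmetric. -/
theorem closedUnder_minOp (L : LinearOrder P) (hL : P.IsLinearExtension L) :
    (assignmentCSP Q P C f).ClosedUnder (minOp L) := by
  rw [CSP.ClosedUnder, forall_constraints]
  constructor
  · intro x t ht
    refine mem_domainConstraint.2 ?_
    rcases minOp_cases L fun i => t i (0 : Fin 1) with ⟨h, -⟩ | ⟨h, -⟩
    · rw [h]; exact mem_domainConstraint.1 (ht 0)
    · rw [h]; exact mem_domainConstraint.1 (ht 1)
  · intro x y hxy t ht
    obtain ⟨h1, h2, h3, h4⟩ := mem_orderConstraint.1 (ht 0)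
    obtain ⟨h5, h6, h7, h8⟩ := mem_orderConstraint.1 (ht 1)
    refine mem_orderConstraint.2 ?_
    rcases minOp_cases L fun i => t i (0 : Fin 2) with ⟨h, hle⟩ | ⟨h, hle⟩ <;>
    rcases minOp_cases L fun i => t i (1 : Fin 2) with ⟨h', hle'⟩ | ⟨h', hle'⟩ <;>
    rw [h, h']
    · exact ⟨h1, h2, h3, h4⟩
    · have ha := hL.le_of_chain h1 h5 hle
      have hb := hL.le_of_chain h6 h2 hle'
      exact ⟨h1, h6, ⟨fun e => h3.1 (e.trans hb), fun e => ha.trans (h7.2 e)⟩,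
        ⟨fun e => h8.1 (e.trans ha), fun e => hb.trans (h4.2 e)⟩⟩
    · have ha := hL.le_of_chain h5 h1 hle
      have hb := hL.le_of_chain h2 h6 hle'
      exact ⟨h5, h2, ⟨fun e => h7.1 (e.trans hb), fun e => ha.trans (h3.2 e)⟩,
        ⟨fun e => h4.1 (e.trans ha), fun e => hb.trans (h8.2 e)⟩⟩
    · exact ⟨h5, h6, h7, h8⟩

/-- Szpilrajn's theorem, which makes the closure under minima nonvacuous. -/
theorem exists_isLinearExtension (P : FinPoset) : ∃ L : LinearOrder P, P.IsLinearExtension L := by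
  let L : LinearOrder P := (inferInstance : LinearOrder (LinearExtension P))
  exact ⟨L, fun _ _ h => (toLinearExtension (α := P)).monotone h⟩

end

/-! ### The theorem -/

theorem mainTheorem3 :
    -- the embedding problem is fixed-parameter tractable
    embeddingProblem.FixedParameterTractable ∧
    -- it is solved in time `O(width(P) ^ |Q| * |Q| ^ 4 * |P| ^ 4)`
    (∃ (A : RAM.Program) (K : ℕ), ∀ Q P : FinPoset,
      A.DecidesWithin (embeddingProblem.encode (Q, P)) (Nonempty (Q ↪o P))
        (K * (P.width ^ Q.size * Q.size ^ 4 * P.size ^ 4 + 1))) ∧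
    -- for a chain assignment `f`, a CSP instance is computed in time `O((|Q| * |P|) ^ 2)`
    (∃ (A : RAM.Program) (K : ℕ), ∀ (Q P : FinPoset) (k : ℕ) (C : ChainPartition P k)
      (f : Q → Fin k),
      A.ComputesWithin (encodeAssignment Q P C f)
        ((assignmentCSP Q P C f).encode Q.label P.label)
        (K * ((Q.size * P.size) ^ 2 + 1))) ∧
    -- its solutions are the compatible embeddings, and it is closed under min polymorphisms
    (∀ (Q P : FinPoset) (k : ℕ) (C : ChainPartition P k) (f : Q → Fin k),
      (∀ τ : Q → P, (assignmentCSP Q P C f).IsSolution τ ↔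
        ∃ e : Q ↪o P, CompatibleWith C f e ∧ ⇑e = τ) ∧
      (∃ φ : (Fin 2 → P) → P, IsMinOp φ ∧ (assignmentCSP Q P C f).ClosedUnder φ) ∧
      (∀ L : LinearOrder P, P.IsLinearExtension L →
        (assignmentCSP Q P C f).ClosedUnder (minOp L))) := by
  refine ⟨RAM.embeddingProblem_fixedParameterTractable, RAM.exists_decides, RAM.exists_computes,
    fun Q P k C f => ⟨isSolution_iff, ?_, closedUnder_minOp⟩⟩
  obtain ⟨L, hL⟩ := exists_isLinearExtension P
  exact ⟨minOp L, ⟨L, rfl⟩, closedUnder_minOp L hL⟩
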